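/- **Setting.** Let $h>0$, let $\Theta=\Theta_1\times\Theta_2\subset\mathbb R^{s_1}\times\mathbb R^{s_2}$ be a parameter space, $s=s_1+s_2$, $\vartheta=(\vartheta_1,\vartheta_2)$, and let $\vartheta^0\in\Theta$ be the true parameter. For $\vartheta\in\Theta$ let $A_{2,\vartheta_2}\in\mathbb R^{(N-c)\times(N-c)}$, $B_{1,\vartheta_2}\in\mathbb R^{c\times m}$, $B_{2,\vartheta_2}\in\mathbb R^{(N-c)\times m}$, $C_{1,\vartheta_1}\in\mathbb R^{d\times c}$, $C_{2,\vartheta_2}\in\mathbb R^{d\times(N-c)}$, let $(L_{\vartheta_2}(t))_{t\in\mathbb R}$ be an $\mathbb R^m$-valued two-sided Lévy process, $X_{st,\vartheta}=(X_{st,\vartheta}(t))_{t\in\mathbb R}$ a stationary solution of $dX_{st,\vartheta}(t)=A_{2,\vartheta}X_{st,\vartheta}(t)\,dt+B_{2,\vartheta}\,dL_\vartheta(t)$, $Z$ a $c$-dimensional random vector, and $$Y_\vartheta(t)=C_{1,\vartheta}Z+C_{1,\vartheta}B_{1,\vartheta}L_\vartheta(t)+C_{2,\vartheta}X_{st,\vartheta}(t),\qquad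 t\in\mathbb R .$$ Put $A_\vartheta=\operatorname{diag}(0_{c\times c},A_{2,\vartheta})$, $B_\vartheta=(B_{1,\vartheta}^{\mathsf T},B_{2,\vartheta}^{\mathsf T})^{\mathsf T}$, $C_\vartheta=(C_{1,\vartheta},C_{2,\vartheta})$, $\Sigma^L_\vartheta=\mathbb E[L_\vartheta(1)L_\vartheta(1)^{\mathsf T}]$. The observations are $Y_k=Y_{\vartheta^0}(kh)$, $k\in\mathbb Z$. **Assumption A.** For every $\vartheta\in\Theta$: (A1) $\Theta$ is compact. (A2) $\vartheta^0$ lies in the interior of $\Theta$. (A3) $L_\vartheta$ has mean zero, $\Sigma_\vartheta^L$ is non-singular, and for some $\delta>0$ not depending on $\vartheta$, $\mathbb E\|L_\vartheta(1)\|^{4+\delta}<\infty$. (A4) The eigenvalues of $A_{2,\vartheta}$ have strictly negative real parts. (A5) $(A_{2,\vartheta},B_{2,\vartheta},C_{2,\vartheta})$ is minimal with McMillan degree $N-c$, i.e. no triplet of smaller state dimension has the same transfer function $z\mapsto C_{2,\vartheta}(zI-A_{2,\vartheta})^{-1}B_{2,\vartheta}$. (A6) $B_{1,\vartheta}$ and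 $C_{1,\vartheta}$ have rank $c$. (A7) $Z$ does not depend on $\vartheta$, $\mathbb E\|Z\|^2<\infty$, and $Z$ is independent of $(L_\vartheta(t))_{t\ge0}$. (A8) The functions $A_{2,\vartheta},B_{i,\vartheta},C_{i,\vartheta}$ $(i=1,2)$ and $\Sigma^L_\vartheta$ of $\vartheta$ are three times continuously differentiable on an open neighbourhood of their parameter set, and so is, as a function of $\vartheta_1$, some choice of lower triangular matrices $C_{1,\vartheta_1}^\perp\in\mathbb R^{d\times(d-c)}$ with $C_{1,\vartheta_1}^{\perp\mathsf T}C_{1,\vartheta_1}^{\perp}=I_{d-c}$ and $C_{1,\vartheta_1}^{\perp\mathsf T}C_{1,\vartheta_1}=0$. (A9) $C_\vartheta$ has rank $d$. (A10) $\lambda-\lambda'\ne 2\pi i k/h$ for all eigenvalues $\lambda,\lambda'$ of $A_\vartheta$ and all $k\in\mathbb Z\setminus\{0\}$. **Likelihoods.** Let $\Omega_\vartheta$ be the positive semidefinite solution, with $C_\vartheta\Omega_\vartheta C_\vartheta^{\mathsf T}$ invertible, of the Riccati equation $$\Omega_\vartheta=e^{A_\vartheta h}\Omega_\vartheta e^{A_\vartheta^{\mathsf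 T}h}-e^{A_\vartheta h}\Omega_\vartheta C_\vartheta^{\mathsf T}(C_\vartheta\Omega_\vartheta C_\vartheta^{\mathsf T})^{-1}C_\vartheta\Omega_\vartheta e^{A_\vartheta^{\mathsf T}h}+\int_0^he^{A_\vartheta u}B_\vartheta\Sigma^L_\vartheta B_\vartheta^{\mathsf T}e^{A_\vartheta^{\mathsf T}u}\,du ,$$ and let $V_\vartheta=C_\vartheta\Omega_\vartheta C_\vartheta^{\mathsf T}$, $K_\vartheta=e^{A_\vartheta h}\Omega_\vartheta C_\vartheta^{\mathsf T}V_\vartheta^{-1}$, $F_\vartheta=e^{A_\vartheta h}-K_\vartheta C_\vartheta$. For $k\ge1$ define the pseudo-innovations from the infinite past $$\varepsilon_k(\vartheta)=Y_k-\sum_{j=1}^\infty C_\vartheta F_\vartheta^{\,j-1}K_\vartheta Y_{k-j},$$ and, for a random starting value $\widehat X_1(\vartheta)\in\mathbb R^N$, the approximate ones from the Kalman recursion $$\widehat X_k(\vartheta)=F_\vartheta\widehat X_{k-1}(\vartheta)+K_\vartheta Y_{k-1}\ (k\ge2),\qquad \widehat\varepsilon_k(\vartheta)=Y_k-C_\vartheta\widehat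 X_k(\vartheta).$$ Let $$\mathcal L_n(\vartheta)=\frac1n\sum_{k=1}^n\big[d\log2\pi+\log\det V_\vartheta+\varepsilon_k(\vartheta)^{\mathsf T}V_\vartheta^{-1}\varepsilon_k(\vartheta)\big],$$ and let $\widehat{\mathcal L}_n(\vartheta)$ be the same expression with $\widehat\varepsilon_k$ in place of $\varepsilon_k$. **Assumption B.** Almost surely $\vartheta\mapsto\widehat X_1(\vartheta)$ is twice continuously differentiable on a neighbourhood of $\Theta$; for all $u,v\in\{1,\dots,s\}$ the expectations of $\sup_{\vartheta\in\Theta}\|\widehat X_1(\vartheta)\|^2$, $\sup_{\vartheta\in\Theta}\|\partial_u\widehat X_1(\vartheta)\|^2$ and $\sup_{\vartheta\in\Theta}\|\partial_{u,v}\widehat X_1(\vartheta)\|^2$ are finite; and for every $\vartheta\in\Theta$, $\widehat X_1(\vartheta)$ is independent of $(L_\vartheta(t))_{t\ge0}$. **Proposition 2.4.** Let Assumptions A and B hold. Then for every $\vartheta\in\Theta$ the matrix $\Omega_\vartheta$ exists and is unique; almost surely, the series defining $\varepsilon_k(\vartheta)$ converges for all $k\ge1$ and $\vartheta\in\Theta$,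 and $\mathcal L_n$ and $\widehat{\mathcal L}_n$ are, for all $n$, twice continuously differentiable in a neighbourhood of every point of $\Theta$. Moreover, for every $\gamma<1$ and all $u,v\in\{1,\dots,s\}$, as $n\to\infty$, (a) $n^{\gamma}\sup_{\vartheta\in\Theta}|\widehat{\mathcal L}_n(\vartheta)-\mathcal L_n(\vartheta)|\to0$ in probability, (b) $n^{\gamma}\sup_{\vartheta\in\Theta}|\partial_u\widehat{\mathcal L}_n(\vartheta)-\partial_u\mathcal L_n(\vartheta)|\to0$ in probability, (c) $n^{\gamma}\sup_{\vartheta\in\Theta}|\partial_{u,v}\widehat{\mathcal L}_n(\vartheta)-\partial_{u,v}\mathcal L_n(\vartheta)|\to0$ in probability. -/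

import Mathlib

open MeasureTheory ProbabilityTheory Filter Topology Matrix
open scoped ENNReal

namespace CointSSM

noncomputable section

/-! ### Parameters and partial derivatives -/

/-- A parameter `ϑ = (ϑ₁, ϑ₂)`: `s₁` long-run and `s₂` short-run coordinates. -/
abbrev Param (s₁ s₂ : ℕ) : Type := (Fin s₁ → ℝ) × (Fin s₂ → ℝ)

/-- The coordinate vector of `ℝ^{s₁} × ℝ^{s₂}` in direction `u`. -/
def coordVec {s₁ s₂ : ℕ} : Fin s₁ ⊕ Fin s₂ → Param s₁ s₂
  | Sum.inl i => (Pi.single i 1, 0)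
  | Sum.inr j => (0, Pi.single j 1)

/-- The partial derivative of `f` with respect to the coordinate `u`. -/
def partialDeriv {s₁ s₂ : ℕ} {F : Type*} [NormedAddCommGroup F] [NormedSpace ℝ F]
    (u : Fin s₁ ⊕ Fin s₂) (f : Param s₁ s₂ → F) (ϑ : Param s₁ s₂) : F :=
  lineDeriv ℝ f ϑ (coordVec u)

/-- `n ^ γ * sup_{ϑ ∈ S} |f n ϑ|` tends to `0` in probability. The supremum is taken in `[0, ∞]`. -/
def NegligibleAtRate {Ω E : Type*} [MeasurableSpace Ω] (P : Measure Ω) (S : Set E) (γ : ℝ)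
    (f : ℕ → E → Ω → ℝ) : Prop :=
  ∀ ε : ℝ≥0∞, 0 < ε →
    Tendsto (fun n : ℕ => P {ω | ε ≤ ENNReal.ofReal ((n : ℝ) ^ γ) * ⨆ ϑ ∈ S, ‖f n ϑ ω‖ₑ})
      atTop (𝓝 0)

/-! ### Linear systems -/

/-- A real matrix regarded as a complex one. -/
def toComplex {α β : Type*} (A : Matrix α β ℝ) : Matrix α β ℂ := A.map Complex.ofReal

/-- The transfer function `z ↦ C (z I - A)⁻¹ B`, for `z` outside the spectrum of `A`. -/
def transferFunction {n m d : ℕ} (A : Matrix (Fin n) (Fin n) ℝ) (B : Matrix (Fin n) (Fin m) ℝ)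
    (C : Matrix (Fin d) (Fin n) ℝ) (z : ℂ) : Matrix (Fin d) (Fin m) ℂ :=
  toComplex C * (z • (1 : Matrix (Fin n) (Fin n) ℂ) - toComplex A)⁻¹ * toComplex B

/-- `(A, B, C)` is minimal (its McMillan degree is its state dimension `n`): no triplet of smaller
state dimension has the same transfer function. -/
def IsMinimal {n m d : ℕ} (A : Matrix (Fin n) (Fin n) ℝ) (B : Matrix (Fin n) (Fin m) ℝ)
    (C : Matrix (Fin d) (Fin n) ℝ) : Prop :=
  ∀ (q : ℕ) (A' : Matrix (Fin q) (Fin q) ℝ) (B' : Matrix (Fin q) (Fin m) ℝ)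
    (C' : Matrix (Fin d) (Fin q) ℝ),
    (∀ z : ℂ, z ∉ spectrum ℂ (toComplex A) → z ∉ spectrum ℂ (toComplex A') →
      transferFunction A B C z = transferFunction A' B' C' z) →
    n ≤ q

/-- `W` is a positive semidefinite solution of the discrete-time algebraic Riccati equation
`W = F W Fᵀ - F W Cᵀ (C W Cᵀ)⁻¹ C W Fᵀ + S`, where `C W Cᵀ` is invertible. -/
def IsRiccatiSolution {ι κ : Type*} [Fintype ι] [DecidableEq ι] [Fintype κ] [DecidableEq κ]
    (F : Matrix ι ι ℝ) (C : Matrix κ ι ℝ) (S W : Matrix ι ι ℝ) : Prop :=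
  W.PosSemidef ∧ IsUnit (C * W * Cᵀ).det ∧
    W = F * W * Fᵀ - F * W * Cᵀ * (C * W * Cᵀ)⁻¹ * C * W * Fᵀ + S

open Classical in
/-- The solution of the Riccati equation (`0` if there is none). -/
def riccati {ι κ : Type*} [Fintype ι] [DecidableEq ι] [Fintype κ] [DecidableEq κ]
    (F : Matrix ι ι ℝ) (C : Matrix κ ι ℝ) (S : Matrix ι ι ℝ) : Matrix ι ι ℝ :=
  if H : ∃ W, IsRiccatiSolution F C S W then H.choose else 0

/-! ### Lévy processes and stationary solutions

Vectors are functions `Fin k → ℝ`. Their norm is the maximum norm, which is equivalent to the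
Euclidean one; below, norms only enter through the finiteness of moments. -/

/-- A Lévy process indexed by the real line: it vanishes at `0`, has independent and stationary
increments and càdlàg paths. -/
structure IsTwoSidedLevy {Ω : Type*} [MeasurableSpace Ω] (P : Measure Ω) {m : ℕ}
    (L : ℝ → Ω → (Fin m → ℝ)) : Prop where
  measurable : ∀ t, Measurable (L t)
  zero : ∀ᵐ ω ∂P, L 0 ω = 0
  indep : HasIndepIncrements L P
  stationary : ∀ s t : ℝ, s ≤ t →
    IdentDistrib (fun ω => L t ω - L s ω) (fun ω => L (t - s) ω) P P
  cadlag : ∀ᵐ ω ∂P, ∀ t : ℝ,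
    ContinuousWithinAt (fun u => L u ω) (Set.Ici t) t ∧
      ∃ l, Tendsto (fun u => L u ω) (𝓝[<] t) (𝓝 l)

/-- `X` is a (strictly) stationary solution on the real line of `dX(t) = A X(t) dt + B dL(t)`, that
is, `X(t) - X(s) = ∫_s^t A X(u) du + B (L(t) - L(s))` for all `s ≤ t`. -/
structure IsStationarySolution {Ω : Type*} [MeasurableSpace Ω] (P : Measure Ω) {p m : ℕ}
    (A : Matrix (Fin p) (Fin p) ℝ) (B : Matrix (Fin p) (Fin m) ℝ)
    (L : ℝ → Ω → (Fin m → ℝ)) (X : ℝ → Ω → (Fin p → ℝ)) : Prop where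
  measurable : ∀ t, Measurable (X t)
  stationary : ∀ τ : ℝ, IdentDistrib (fun ω t => X (t + τ) ω) (fun ω t => X t ω) P P
  equation : ∀ᵐ ω ∂P, ∀ s t : ℝ, s ≤ t →
    IntervalIntegrable (fun u => X u ω) volume s t ∧
      X t ω - X s ω = (∫ u in s..t, A *ᵥ X u ω) + B *ᵥ (L t ω - L s ω)

/-! ### The parametric model -/

/-- The data of a parametric family of cointegrated state space models with state dimension
`N = c + p`, output dimension `d` and noise dimension `m`, observed at distance `h`. The matrix
`C₁` is parametrized by `ϑ₁` and everything else by `ϑ₂`. Values at parameters outside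
`Θ = Θ₁ × Θ₂` are auxiliary: they extend the functions beyond the boundary of `Θ`. -/
structure Model (Ω : Type*) (s₁ s₂ c p d m : ℕ) where
  h : ℝ
  Theta1 : Set (Fin s₁ → ℝ)
  Theta2 : Set (Fin s₂ → ℝ)
  theta0 : Param s₁ s₂
  A2 : (Fin s₂ → ℝ) → Matrix (Fin p) (Fin p) ℝ
  B1 : (Fin s₂ → ℝ) → Matrix (Fin c) (Fin m) ℝ
  B2 : (Fin s₂ → ℝ) → Matrix (Fin p) (Fin m) ℝ
  C1 : (Fin s₁ → ℝ) → Matrix (Fin d) (Fin c) ℝ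
  C2 : (Fin s₂ → ℝ) → Matrix (Fin d) (Fin p) ℝ
  L : (Fin s₂ → ℝ) → ℝ → Ω → (Fin m → ℝ)
  Xst : (Fin s₂ → ℝ) → ℝ → Ω → (Fin p → ℝ)
  Z : Ω → (Fin c → ℝ)

namespace Model

variable {Ω : Type*} {s₁ s₂ c p d m : ℕ} (M : Model Ω s₁ s₂ c p d m)

/-- The parameter space `Θ = Θ₁ × Θ₂`. -/
def Theta : Set (Param s₁ s₂) := M.Theta1 ×ˢ M.Theta2

/-- `A_ϑ = diag(0, A_{2,ϑ})`. -/
def A (ϑ : Param s₁ s₂) : Matrix (Fin c ⊕ Fin p) (Fin c ⊕ Fin p) ℝ :=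
  Matrix.fromBlocks 0 0 0 (M.A2 ϑ.2)

/-- `B_ϑ = (B_{1,ϑ}ᵀ, B_{2,ϑ}ᵀ)ᵀ`. -/
def B (ϑ : Param s₁ s₂) : Matrix (Fin c ⊕ Fin p) (Fin m) ℝ :=
  Matrix.fromRows (M.B1 ϑ.2) (M.B2 ϑ.2)

/-- `C_ϑ = (C_{1,ϑ}, C_{2,ϑ})`. -/
def C (ϑ : Param s₁ s₂) : Matrix (Fin d) (Fin c ⊕ Fin p) ℝ :=
  Matrix.fromCols (M.C1 ϑ.1) (M.C2 ϑ.2)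

/-- `Y_ϑ(t) = C_{1,ϑ} Z + C_{1,ϑ} B_{1,ϑ} L_ϑ(t) + C_{2,ϑ} X_{st,ϑ}(t)`, for real `t`. -/
def Y (ϑ : Param s₁ s₂) (t : ℝ) (ω : Ω) : Fin d → ℝ :=
  M.C1 ϑ.1 *ᵥ M.Z ω + (M.C1 ϑ.1 * M.B1 ϑ.2) *ᵥ M.L ϑ.2 t ω + M.C2 ϑ.2 *ᵥ M.Xst ϑ.2 t ω

/-- The observed process `Y_k = Y_{ϑ⁰}(k h)`, for integer `k`. -/
def Yobs (k : ℤ) (ω : Ω) : Fin d → ℝ := M.Y M.theta0 (k * M.h) ω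

/-- The transition matrix `e^{A_ϑ h}` of the sampled state process. -/
def expAh (ϑ : Param s₁ s₂) : Matrix (Fin c ⊕ Fin p) (Fin c ⊕ Fin p) ℝ :=
  NormedSpace.exp (M.h • M.A ϑ)

variable [MeasurableSpace Ω] (P : Measure Ω)

/-- The matrix `Σ_ϑ^L = E[L_ϑ(1) L_ϑ(1)ᵀ]`. -/
def SigmaL (η : Fin s₂ → ℝ) : Matrix (Fin m) (Fin m) ℝ :=
  Matrix.of fun i j => ∫ ω, M.L η 1 ω i * M.L η 1 ω j ∂P

/-- The covariance matrix `∫_0^h e^{A_ϑ u} B_ϑ Σ_ϑ^L B_ϑᵀ e^{A_ϑᵀ u} du` of the sampled state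
noise. -/
def SigmaH (ϑ : Param s₁ s₂) : Matrix (Fin c ⊕ Fin p) (Fin c ⊕ Fin p) ℝ :=
  Matrix.of fun i j => ∫ u in (0 : ℝ)..M.h,
    (NormedSpace.exp (u • M.A ϑ) * M.B ϑ * M.SigmaL P ϑ.2 * (M.B ϑ)ᵀ *
      NormedSpace.exp (u • (M.A ϑ)ᵀ)) i j

/-- The solution `Ω_ϑ` of the Riccati equation of the Kalman filter. -/
def Omega (ϑ : Param s₁ s₂) : Matrix (Fin c ⊕ Fin p) (Fin c ⊕ Fin p) ℝ :=
  riccati (M.expAh ϑ) (M.C ϑ) (M.SigmaH P ϑ)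

/-- The prediction covariance matrix `V_ϑ = C_ϑ Ω_ϑ C_ϑᵀ`. -/
def V (ϑ : Param s₁ s₂) : Matrix (Fin d) (Fin d) ℝ := M.C ϑ * M.Omega P ϑ * (M.C ϑ)ᵀ

/-- The steady-state Kalman gain `K_ϑ = e^{A_ϑ h} Ω_ϑ C_ϑᵀ (C_ϑ Ω_ϑ C_ϑᵀ)⁻¹`. -/
def K (ϑ : Param s₁ s₂) : Matrix (Fin c ⊕ Fin p) (Fin d) ℝ :=
  M.expAh ϑ * M.Omega P ϑ * (M.C ϑ)ᵀ * (M.V P ϑ)⁻¹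

/-- `e^{A_ϑ h} - K_ϑ C_ϑ`. -/
def closedLoop (ϑ : Param s₁ s₂) : Matrix (Fin c ⊕ Fin p) (Fin c ⊕ Fin p) ℝ :=
  M.expAh ϑ - M.K P ϑ * M.C ϑ

/-- The `j`-th term `C_ϑ (e^{A_ϑ h} - K_ϑ C_ϑ)^{j-1} K_ϑ Y_{k-j}` of the one-step prediction of
`Y_k` from the infinite past, with `j = i + 1`. -/
def predictionTerm (ϑ : Param s₁ s₂) (k : ℕ) (ω : Ω) (i : ℕ) : Fin d → ℝ :=
  (M.C ϑ * M.closedLoop P ϑ ^ i * M.K P ϑ) *ᵥ M.Yobs ((k : ℤ) - ((i : ℤ) + 1)) ω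

/-- The pseudo-innovation `ε_k(ϑ)`. -/
def innovation (k : ℕ) (ϑ : Param s₁ s₂) (ω : Ω) : Fin d → ℝ :=
  M.Yobs k ω - ∑' i : ℕ, M.predictionTerm P ϑ k ω i

variable (X1 : Param s₁ s₂ → Ω → (Fin c ⊕ Fin p → ℝ))

/-- The Kalman recursion `X̂_k(ϑ)` for `k ≥ 1` with starting value `X̂_1(ϑ) = X1 ϑ`. (The value at
`k = 0` is never used.) -/
def filterState (ϑ : Param s₁ s₂) (ω : Ω) : ℕ → (Fin c ⊕ Fin p → ℝ)
  | 0 => 0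
  | 1 => X1 ϑ ω
  | k + 2 => M.closedLoop P ϑ *ᵥ filterState ϑ ω (k + 1) + M.K P ϑ *ᵥ M.Yobs ((k : ℤ) + 1) ω

/-- The approximate pseudo-innovation `ε̂_k(ϑ) = Y_k - C_ϑ X̂_k(ϑ)`, for `k ≥ 1`. -/
def approxInnovation (k : ℕ) (ϑ : Param s₁ s₂) (ω : Ω) : Fin d → ℝ :=
  M.Yobs k ω - M.C ϑ *ᵥ M.filterState P X1 ϑ ω k

/-- `n⁻¹ ∑_{k=1}^n [d log 2π + log det V_ϑ + e_kᵀ V_ϑ⁻¹ e_k]`. -/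
def gaussLik (e : ℕ → (Fin d → ℝ)) (n : ℕ) (ϑ : Param s₁ s₂) : ℝ :=
  (1 / (n : ℝ)) * ∑ k ∈ Finset.Icc 1 n,
    ((d : ℝ) * Real.log (2 * Real.pi) + Real.log (M.V P ϑ).det + e k ⬝ᵥ ((M.V P ϑ)⁻¹ *ᵥ e k))

/-- `L_n(ϑ)`: minus two over `n` times the pseudo-Gaussian log-likelihood, from the infinite
past. -/
def lik (n : ℕ) (ω : Ω) (ϑ : Param s₁ s₂) : ℝ :=
  M.gaussLik P (fun k => M.innovation P k ϑ ω) n ϑ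

/-- `L̂_n(ϑ)`: the approximation of `L_n(ϑ)` computed from the Kalman recursion started in
`X̂_1(ϑ)`. -/
def approxLik (n : ℕ) (ω : Ω) (ϑ : Param s₁ s₂) : ℝ :=
  M.gaussLik P (fun k => M.approxInnovation P X1 k ϑ ω) n ϑ

/-! ### Assumptions -/

/-- The assumptions on the parametric model. A function is `n` times continuously differentiable
at a point if it is so in a neighbourhood of the point; requiring this at all points of a set means
that it is `n` times continuously differentiable on an open neighbourhood of the set. -/
structure AssumptionA : Prop where
  h_pos : 0 < M.h
  levy : ∀ ϑ ∈ M.Theta, IsTwoSidedLevy P (M.L ϑ.2)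
  stationary_solution : ∀ ϑ ∈ M.Theta,
    IsStationarySolution P (M.A2 ϑ.2) (M.B2 ϑ.2) (M.L ϑ.2) (M.Xst ϑ.2)
  compact : IsCompact M.Theta
  interior : M.theta0 ∈ _root_.interior M.Theta
  levy_mean : ∀ ϑ ∈ M.Theta, ∀ t, ∫ ω, M.L ϑ.2 t ω ∂P = 0
  levy_cov : ∀ ϑ ∈ M.Theta, IsUnit (M.SigmaL P ϑ.2).det
  levy_moment : ∃ δ : ℝ, 0 < δ ∧ ∀ ϑ ∈ M.Theta, MemLp (M.L ϑ.2 1) (ENNReal.ofReal (4 + δ)) P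
  stable : ∀ ϑ ∈ M.Theta, ∀ z ∈ spectrum ℂ (toComplex (M.A2 ϑ.2)), z.re < 0
  /-- Minimality with McMillan degree `p = N - c`. -/
  minimal : ∀ ϑ ∈ M.Theta, IsMinimal (M.A2 ϑ.2) (M.B2 ϑ.2) (M.C2 ϑ.2)
  rank_B1 : ∀ ϑ ∈ M.Theta, (M.B1 ϑ.2).rank = c
  rank_C1 : ∀ ϑ ∈ M.Theta, (M.C1 ϑ.1).rank = c
  start_measurable : Measurable M.Z
  start_moment : MemLp M.Z 2 P
  start_indep : ∀ ϑ ∈ M.Theta, IndepFun M.Z (fun ω (t : Set.Ici (0 : ℝ)) => M.L ϑ.2 t ω) P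
  smooth_A2 : ∀ ϑ ∈ M.Theta, ∀ i j, ContDiffAt ℝ 3 (fun η => M.A2 η i j) ϑ.2
  smooth_B1 : ∀ ϑ ∈ M.Theta, ∀ i j, ContDiffAt ℝ 3 (fun η => M.B1 η i j) ϑ.2
  smooth_B2 : ∀ ϑ ∈ M.Theta, ∀ i j, ContDiffAt ℝ 3 (fun η => M.B2 η i j) ϑ.2
  smooth_C1 : ∀ ϑ ∈ M.Theta, ∀ i j, ContDiffAt ℝ 3 (fun η => M.C1 η i j) ϑ.1
  smooth_C2 : ∀ ϑ ∈ M.Theta, ∀ i j, ContDiffAt ℝ 3 (fun η => M.C2 η i j) ϑ.2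
  smooth_SigmaL : ∀ ϑ ∈ M.Theta, ∀ i j, ContDiffAt ℝ 3 (fun η => M.SigmaL P η i j) ϑ.2
  /-- A smooth choice of a lower triangular orthonormal basis of the complement of the range of
  `C_{1,ϑ₁}`. -/
  smooth_C1perp : ∃ D : (Fin s₁ → ℝ) → Matrix (Fin d) (Fin (d - c)) ℝ, ∀ ϑ ∈ M.Theta,
    (∀ i j, ContDiffAt ℝ 3 (fun η => D η i j) ϑ.1) ∧
    (∀ (i : Fin d) (j : Fin (d - c)), (i : ℕ) < j → D ϑ.1 i j = 0) ∧
    (D ϑ.1)ᵀ * D ϑ.1 = 1 ∧ (D ϑ.1)ᵀ * M.C1 ϑ.1 = 0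
  rank_C : ∀ ϑ ∈ M.Theta, (M.C ϑ).rank = d
  /-- The Kalman-Bertram criterion. -/
  kalman_bertram : ∀ ϑ ∈ M.Theta, ∀ z ∈ spectrum ℂ (toComplex (M.A ϑ)),
    ∀ z' ∈ spectrum ℂ (toComplex (M.A ϑ)), ∀ k : ℤ, k ≠ 0 →
      z - z' ≠ 2 * Real.pi * Complex.I * k / M.h

/-- The assumptions on the starting value `X̂_1` of the Kalman recursion: it is a random function,
twice continuously differentiable in `ϑ` on a neighbourhood of `Θ`, with uniformly bounded second
moments together with its partial derivatives, and independent of the Lévy process. -/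
structure AssumptionB : Prop where
  measurable : ∀ ϑ, Measurable (X1 ϑ)
  smooth : ∀ᵐ ω ∂P, ∀ ϑ ∈ M.Theta, ContDiffAt ℝ 2 (fun η => X1 η ω) ϑ
  moment : ∫⁻ ω, ⨆ ϑ ∈ M.Theta, ‖X1 ϑ ω‖ₑ ^ 2 ∂P < ∞
  moment_deriv : ∀ u,
    ∫⁻ ω, ⨆ ϑ ∈ M.Theta, ‖partialDeriv u (fun η => X1 η ω) ϑ‖ₑ ^ 2 ∂P < ∞
  moment_deriv_two : ∀ u v,
    ∫⁻ ω, ⨆ ϑ ∈ M.Theta,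
      ‖partialDeriv u (partialDeriv v (fun η => X1 η ω)) ϑ‖ₑ ^ 2 ∂P < ∞
  indep : ∀ ϑ ∈ M.Theta, IndepFun (X1 ϑ) (fun ω (t : Set.Ici (0 : ℝ)) => M.L ϑ.2 t ω) P

end Model

end

end CointSSM

/-! Write Φ = e^{Ah} - KC. The prediction of the state from the infinite past and the Kalman
recursion obey the same affine recursion with matrix Φ, so at time k + 1 they differ by Φ^k applied
to the initial discrepancy, and the innovations differ by C Φ^k of it (`approxInnovation_eq`). If
Φ^k decays geometrically together with its first two parameter derivatives, and the observations
grow at most polynomially along almost every path, then the differences of the quadratic forms are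
summable over k. The two likelihoods, with two derivatives, therefore differ by at most B / n on Θ,
where B is a finite random variable. No moment of B is needed: n^(γ-1) B tends to 0 almost surely,
hence in probability.

Decay. Controllability makes the covariance S of the sampled noise positive definite. A Riccati
solution satisfies W = ΦWΦᵀ + S, so W is a Lyapunov function and Φⁿ → 0. The same identity with two
different gains gives uniqueness. It also shows that the linearised Riccati equation H = ΦHΦᵀ has
only the zero solution, so the implicit function theorem makes the filter matrices smooth in ϑ.
Existence follows from monotone iteration started at S; the iterates stay bounded because the
sampled pair is observable, which is where the Kalman-Bertram criterion enters. Derivatives of Φⁿ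
are handled by `jet`, a submultiplicative weighted norm of second order jets: for a small weight
some power of Φ has jet below 1/2, at the point and nearby, so the jets of all powers decay
geometrically near it (`exists_jet_pow_le`). Compactness of Θ leaves finitely many neighbourhoods.

Growth. Independence of increments and integrability of L(1) give E‖L(kh)‖ = O(1 + |k|). No moment
of the stationary solution is assumed, but over a time τ with ‖e^{τA₂}‖ < 1 the equation is a
contraction up to an integrable error, and stationarity turns this into a tail bound c / t
(`measure_le_of_contraction`). Borel-Cantelli then bounds the observations by R (1 + |k|)^3
(`AssumptionA.exists_growth_bound`). -/

set_option linter.unusedSectionVars false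

namespace CointSSM

open scoped Matrix.Norms.Operator

/-! ### Real quadratic forms and positive definiteness -/

section QuadraticForms

variable {ι κ : Type*} [Fintype ι] [Fintype κ]

theorem dotProduct_mulVec_comm_of_isSymm {W : Matrix ι ι ℝ} (hW : Wᵀ = W) (x y : ι → ℝ) :
    x ⬝ᵥ W *ᵥ y = y ⬝ᵥ W *ᵥ x := by
  rw [dotProduct_mulVec, ← mulVec_transpose, hW, dotProduct_comm]

theorem quadForm_sub {W : Matrix ι ι ℝ} (hW : Wᵀ = W) (x y : ι → ℝ) :
    (x - y) ⬝ᵥ W *ᵥ (x - y) = x ⬝ᵥ W *ᵥ x - 2 * (y ⬝ᵥ W *ᵥ x) + y ⬝ᵥ W *ᵥ y := by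
  rw [mulVec_sub, sub_dotProduct, dotProduct_sub, dotProduct_sub,
    dotProduct_mulVec_comm_of_isSymm hW x y]
  ring

theorem quadForm_add {W : Matrix ι ι ℝ} (hW : Wᵀ = W) (x y : ι → ℝ) :
    (x + y) ⬝ᵥ W *ᵥ (x + y) = x ⬝ᵥ W *ᵥ x + 2 * (y ⬝ᵥ W *ᵥ x) + y ⬝ᵥ W *ᵥ y := by
  rw [mulVec_add, add_dotProduct, dotProduct_add, dotProduct_add,
    dotProduct_mulVec_comm_of_isSymm hW x y]
  ring

theorem quadForm_mul_mul_transpose (F : Matrix κ ι ℝ) (W : Matrix ι ι ℝ) (x : κ → ℝ) :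
    x ⬝ᵥ (F * W * Fᵀ) *ᵥ x = (Fᵀ *ᵥ x) ⬝ᵥ W *ᵥ (Fᵀ *ᵥ x) := by
  rw [← mulVec_mulVec, ← mulVec_mulVec, dotProduct_mulVec, ← mulVec_transpose]

theorem posSemidef_real_iff {W : Matrix ι ι ℝ} :
    W.PosSemidef ↔ Wᵀ = W ∧ ∀ x, 0 ≤ x ⬝ᵥ W *ᵥ x := by
  rw [posSemidef_iff_dotProduct_mulVec, IsHermitian, conjTranspose_eq_transpose_of_trivial]
  simp

theorem posDef_real_iff {W : Matrix ι ι ℝ} :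
    W.PosDef ↔ Wᵀ = W ∧ ∀ x, x ≠ 0 → 0 < x ⬝ᵥ W *ᵥ x := by
  rw [posDef_iff_dotProduct_mulVec, IsHermitian, conjTranspose_eq_transpose_of_trivial]
  simp

theorem PosDef.transpose_eq {W : Matrix ι ι ℝ} (hW : W.PosDef) : Wᵀ = W :=
  (posDef_real_iff.1 hW).1

/-- The minimum over the compact unit sphere is positive, and both sides are homogeneous of degree
two. -/
theorem PosDef.exists_coercive {S : Matrix ι ι ℝ} (hS : S.PosDef) :
    ∃ κ : ℝ, 0 < κ ∧ ∀ x : ι → ℝ, κ * ‖x‖ ^ 2 ≤ x ⬝ᵥ S *ᵥ x := by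
  have hS' := (posDef_real_iff.1 hS).2
  -- The sphere is empty precisely in dimension zero.
  rcases (Metric.sphere (0 : ι → ℝ) 1).eq_empty_or_nonempty with h | h
  · refine ⟨1, one_pos, fun x => ?_⟩
    have hx : x = 0 := by
      by_contra hx
      have : ‖x‖⁻¹ • x ∈ Metric.sphere (0 : ι → ℝ) 1 := by simp [norm_smul, hx]
      simp [h] at this
    simp [hx]
  · have hc : Continuous fun x : ι → ℝ => x ⬝ᵥ S *ᵥ x := by fun_prop
    obtain ⟨x₀, hx₀, hmin⟩ := (isCompact_sphere (0 : ι → ℝ) 1).exists_isMinOn h hc.continuousOn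
    have hne : x₀ ≠ 0 := by rintro rfl; simp at hx₀
    refine ⟨_, hS' x₀ hne, fun x => ?_⟩
    rcases eq_or_ne x 0 with rfl | hx
    · simp
    have hmem : ‖x‖⁻¹ • x ∈ Metric.sphere (0 : ι → ℝ) 1 := by simp [norm_smul, hx]
    have h1 : x₀ ⬝ᵥ S *ᵥ x₀ ≤ (‖x‖⁻¹ • x) ⬝ᵥ S *ᵥ (‖x‖⁻¹ • x) := hmin hmem
    rw [mulVec_smul, smul_dotProduct, dotProduct_smul, smul_eq_mul, smul_eq_mul] at h1
    have h2 : 0 < ‖x‖ := norm_pos_iff.2 hx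
    calc _ ≤ ‖x‖⁻¹ * (‖x‖⁻¹ * x ⬝ᵥ S *ᵥ x) * ‖x‖ ^ 2 := by gcongr
      _ = _ := by field_simp

/-- Positivity on the compact unit sphere is an open condition. Symmetry is not, so it is required
near the point separately. -/
theorem eventually_posDef {X : Type*} [TopologicalSpace X] {f : X → Matrix ι ι ℝ} {a : X}
    (hf : ContinuousAt f a) (hsymm : ∀ᶠ x in 𝓝 a, (f x)ᵀ = f x) (ha : (f a).PosDef) :
    ∀ᶠ x in 𝓝 a, (f x).PosDef := by
  have h : ∀ᶠ x in 𝓝 a, ∀ v ∈ Metric.sphere (0 : ι → ℝ) 1, 0 < v ⬝ᵥ f x *ᵥ v := by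
    refine (isCompact_sphere (0 : ι → ℝ) 1).eventually_forall_of_forall_eventually fun v hv => ?_
    have hv0 : v ≠ 0 := by rintro rfl; simp at hv
    have hc : ContinuousAt (fun z : X × (ι → ℝ) => z.2 ⬝ᵥ f z.1 *ᵥ z.2) (a, v) := by
      have h1 : ContinuousAt (fun z : X × (ι → ℝ) => f z.1) (a, v) :=
        ContinuousAt.comp (f := Prod.fst) (g := f) hf continuousAt_fst
      have h2 : Continuous fun z : Matrix ι ι ℝ × (ι → ℝ) => z.2 ⬝ᵥ z.1 *ᵥ z.2 := by fun_prop
      exact h2.continuousAt.comp (h1.prodMk continuousAt_snd)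
    exact hc.eventually (lt_mem_nhds ((posDef_real_iff.1 ha).2 v hv0))
  filter_upwards [h, hsymm] with x hx hs
  refine posDef_real_iff.2 ⟨hs, fun v hv => ?_⟩
  have hmem : ‖v‖⁻¹ • v ∈ Metric.sphere (0 : ι → ℝ) 1 := by simp [norm_smul, hv]
  have h1 := hx _ hmem
  rw [mulVec_smul, smul_dotProduct, dotProduct_smul, smul_eq_mul, smul_eq_mul] at h1
  have h2 : 0 < ‖v‖⁻¹ := inv_pos.2 (norm_pos_iff.2 hv)
  exact pos_of_mul_pos_right (pos_of_mul_pos_right h1 h2.le) h2.le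

end QuadraticForms

/-! ### The algebraic Riccati equation: uniqueness, stability, existence -/

section Riccati

variable {ι κ : Type*} [Fintype ι] [DecidableEq ι] [Fintype κ] [DecidableEq κ]
  {F S W : Matrix ι ι ℝ} {C : Matrix κ ι ℝ}

/-- The steady-state Kalman gain. -/
noncomputable def gain (F : Matrix ι ι ℝ) (C : Matrix κ ι ℝ) (W : Matrix ι ι ℝ) : Matrix ι κ ℝ :=
  F * W * Cᵀ * (C * W * Cᵀ)⁻¹

/-- The Riccati operator. -/
noncomputable def riccatiMap (F : Matrix ι ι ℝ) (C : Matrix κ ι ℝ) (S W : Matrix ι ι ℝ) :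
    Matrix ι ι ℝ :=
  F * W * Fᵀ - F * W * Cᵀ * (C * W * Cᵀ)⁻¹ * C * W * Fᵀ + S

/-- The gain is chosen such that (F - gain C) W Cᵀ = 0, so G drops out. With G the gain of W itself
this is the closed loop form of the equation; with G the gain of another matrix it compares two
Riccati values. -/
theorem closedLoop_mul_mul_transpose (hV : IsUnit (C * W * Cᵀ).det) (G : Matrix ι κ ℝ) :
    (F - gain F C W * C) * W * (F - G * C)ᵀ = riccatiMap F C S W - S := by
  have h0 : (F - gain F C W * C) * W * Cᵀ = 0 := by
    have : gain F C W * (C * W * Cᵀ) = F * W * Cᵀ := by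
      rw [gain, Matrix.mul_assoc, nonsing_inv_mul _ hV, Matrix.mul_one]
    rw [Matrix.sub_mul, Matrix.sub_mul, Matrix.mul_assoc (gain F C W),
      Matrix.mul_assoc (gain F C W), this, sub_self]
  rw [transpose_sub, transpose_mul, Matrix.mul_sub, ← Matrix.mul_assoc _ Cᵀ, h0, Matrix.zero_mul,
    sub_zero, riccatiMap, add_sub_cancel_right, Matrix.sub_mul, Matrix.sub_mul, gain]

/-- Lyapunov argument: along the orbit of Aᵀ the energy xᵀWx drops by xᵀSx at each step and stays
nonnegative. The losses are summable, hence tend to 0, and S is coercive. -/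
theorem tendsto_pow_of_eq_mul_mul_transpose_add {A : Matrix ι ι ℝ} (hW : W.PosSemidef)
    (hS : S.PosDef) (h : W = A * W * Aᵀ + S) :
    Tendsto (fun n => A ^ n) atTop (𝓝 0) := by
  obtain ⟨κ, hκ, hco⟩ := PosDef.exists_coercive hS
  have hvec : ∀ x : ι → ℝ, Tendsto (fun n => (Aᵀ ^ n) *ᵥ x) atTop (𝓝 0) := by
    intro x
    set a : ℕ → ι → ℝ := fun n => (Aᵀ ^ n) *ᵥ x with ha
    have hstep : ∀ n, a n ⬝ᵥ W *ᵥ a n = a (n + 1) ⬝ᵥ W *ᵥ a (n + 1) + a n ⬝ᵥ S *ᵥ a n := by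
      intro n
      have : a (n + 1) = Aᵀ *ᵥ a n := by simp only [ha, pow_succ', mulVec_mulVec]
      rw [this, ← quadForm_mul_mul_transpose]
      conv_lhs => rw [h]
      rw [add_mulVec, dotProduct_add]
    have hsum : ∀ n, ∑ i ∈ Finset.range n, a i ⬝ᵥ S *ᵥ a i ≤ x ⬝ᵥ W *ᵥ x := by
      intro n
      have : ∑ i ∈ Finset.range n, a i ⬝ᵥ S *ᵥ a i + a n ⬝ᵥ W *ᵥ a n = x ⬝ᵥ W *ᵥ x := by
        induction n with
        | zero => simp [ha]
        | succ n ih => rw [Finset.sum_range_succ, ← ih, hstep n]; ring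
      linarith [(posSemidef_real_iff.1 hW).2 (a n)]
    have hnn : ∀ i, 0 ≤ a i ⬝ᵥ S *ᵥ a i := fun i => (posSemidef_real_iff.1 hS.posSemidef).2 _
    have ht : Tendsto (fun n => a n ⬝ᵥ S *ᵥ a n) atTop (𝓝 0) :=
      (summable_of_sum_range_le hnn hsum).tendsto_atTop_zero
    have ht2 : Tendsto (fun n => ‖a n‖ ^ 2) atTop (𝓝 0) := by
      refine squeeze_zero (fun n => by positivity) (fun n => ?_)
        (by simpa using ht.const_mul κ⁻¹)
      rw [← div_eq_inv_mul, le_div_iff₀ hκ, mul_comm]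
      exact hco _
    rw [tendsto_zero_iff_norm_tendsto_zero]
    simpa using ht2.sqrt
  refine tendsto_pi_nhds.2 fun i => tendsto_pi_nhds.2 fun j => ?_
  have := (tendsto_pi_nhds.1 (hvec (Pi.single i 1))) j
  simpa [← transpose_pow] using this

theorem eq_zero_of_eq_mul_mul {A B : Matrix ι ι ℝ} {H : Matrix ι ι ℝ}
    (hA : Tendsto (fun n => A ^ n) atTop (𝓝 0)) (hB : Tendsto (fun n => B ^ n) atTop (𝓝 0))
    (h : H = A * H * B) : H = 0 := by
  have hn : ∀ n : ℕ, H = A ^ n * H * B ^ n := by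
    intro n
    induction n with
    | zero => simp
    | succ n ih =>
      conv_lhs => rw [ih, h]
      simp only [pow_succ A, pow_succ' B, Matrix.mul_assoc]
  have ht : Tendsto (fun n : ℕ => A ^ n * H * B ^ n) atTop (𝓝 (0 * H * 0)) :=
    (hA.mul_const H).mul hB
  simp_rw [← hn] at ht
  simpa using tendsto_nhds_unique tendsto_const_nhds ht

theorem tendsto_transpose_pow {A : Matrix ι ι ℝ} (hA : Tendsto (fun n => A ^ n) atTop (𝓝 0)) :
    Tendsto (fun n => Aᵀ ^ n) atTop (𝓝 0) := by
  have h : Continuous fun M : Matrix ι ι ℝ => Mᵀ := continuous_id.matrix_transpose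
  simpa [transpose_pow, Function.comp_def] using (h.tendsto 0).comp hA

theorem IsRiccatiSolution.eq_closedLoop (h : IsRiccatiSolution F C S W) :
    W = (F - gain F C W * C) * W * (F - gain F C W * C)ᵀ + S := by
  rw [closedLoop_mul_mul_transpose (S := S) h.2.1, sub_add_cancel]
  exact h.2.2

theorem IsRiccatiSolution.posDef (h : IsRiccatiSolution F C S W) (hS : S.PosDef) : W.PosDef := by
  rw [h.eq_closedLoop]
  refine PosDef.posSemidef_add ?_ hS
  simpa [conjTranspose_eq_transpose_of_trivial] using h.1.mul_mul_conjTranspose_same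
    (F - gain F C W * C)

theorem IsRiccatiSolution.tendsto_pow (h : IsRiccatiSolution F C S W) (hS : S.PosDef) :
    Tendsto (fun n => (F - gain F C W * C) ^ n) atTop (𝓝 0) :=
  tendsto_pow_of_eq_mul_mul_transpose_add h.1 hS h.eq_closedLoop

/-- With crossed gains, Φ₁W₁Φ₂ᵀ = W₁ - S and Φ₁W₂Φ₂ᵀ = W₂ - S, so W₁ - W₂ = Φ₁(W₁ - W₂)Φ₂ᵀ. Both
closed loops have powers tending to 0. -/
theorem IsRiccatiSolution.unique {W₁ W₂ : Matrix ι ι ℝ} (hS : S.PosDef)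
    (h₁ : IsRiccatiSolution F C S W₁) (h₂ : IsRiccatiSolution F C S W₂) : W₁ = W₂ := by
  have e₁ := closedLoop_mul_mul_transpose (F := F) (S := S) h₁.2.1 (gain F C W₂)
  have e₂ := closedLoop_mul_mul_transpose (F := F) (S := S) h₂.2.1 (gain F C W₁)
  rw [show riccatiMap F C S W₁ = W₁ from h₁.2.2.symm] at e₁
  rw [show riccatiMap F C S W₂ = W₂ from h₂.2.2.symm] at e₂
  have e₃ := congrArg transpose e₂
  rw [transpose_mul, transpose_transpose, transpose_mul, transpose_sub W₂,
    (posSemidef_real_iff.1 h₂.1).1, PosDef.transpose_eq hS] at e₃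
  rw [← sub_eq_zero]
  refine eq_zero_of_eq_mul_mul (h₁.tendsto_pow hS) (tendsto_transpose_pow (h₂.tendsto_pow hS)) ?_
  rw [Matrix.mul_sub, Matrix.sub_mul, e₁, Matrix.mul_assoc _ W₂, e₃]
  abel

/-- Completion of the square. -/
theorem quadForm_riccatiMap (hW : Wᵀ = W) (hV : IsUnit (C * W * Cᵀ).det) (x : ι → ℝ)
    (u : κ → ℝ) :
    ∃ u₀ : κ → ℝ, u₀ = (C * W * Cᵀ)⁻¹ *ᵥ (C *ᵥ (W *ᵥ (Fᵀ *ᵥ x))) ∧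
    (Fᵀ *ᵥ x - Cᵀ *ᵥ u) ⬝ᵥ W *ᵥ (Fᵀ *ᵥ x - Cᵀ *ᵥ u) + x ⬝ᵥ S *ᵥ x =
      x ⬝ᵥ riccatiMap F C S W *ᵥ x + (u - u₀) ⬝ᵥ (C * W * Cᵀ) *ᵥ (u - u₀) := by
  refine ⟨_, rfl, ?_⟩
  set u₀ := (C * W * Cᵀ)⁻¹ *ᵥ (C *ᵥ (W *ᵥ (Fᵀ *ᵥ x))) with hu₀
  set y := Fᵀ *ᵥ x with hy
  set V := C * W * Cᵀ with hVdef
  have hVs : Vᵀ = V := by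
    rw [hVdef, transpose_mul, transpose_mul, transpose_transpose, hW, Matrix.mul_assoc]
  have hVu : V *ᵥ u₀ = C *ᵥ (W *ᵥ y) := by
    rw [hu₀, mulVec_mulVec, mul_nonsing_inv _ hV, one_mulVec]
  have hR : x ⬝ᵥ riccatiMap F C S W *ᵥ x = y ⬝ᵥ W *ᵥ y - u₀ ⬝ᵥ V *ᵥ u₀ + x ⬝ᵥ S *ᵥ x := by
    rw [riccatiMap, add_mulVec, sub_mulVec, dotProduct_add, dotProduct_sub,
      quadForm_mul_mul_transpose]
    congr 2
    simp only [← mulVec_mulVec]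
    rw [← hVdef, ← hy, ← hu₀, dotProduct_mulVec x F, ← mulVec_transpose, ← hy, dotProduct_mulVec y W,
      ← mulVec_transpose, hW, dotProduct_mulVec _ Cᵀ, ← mulVec_transpose, transpose_transpose,
      ← hVu, dotProduct_comm]
  have hc : (Cᵀ *ᵥ u) ⬝ᵥ W *ᵥ y = u ⬝ᵥ V *ᵥ u₀ := by
    rw [hVu, dotProduct_mulVec u C, ← mulVec_transpose]
  have hq : (Cᵀ *ᵥ u) ⬝ᵥ W *ᵥ (Cᵀ *ᵥ u) = u ⬝ᵥ V *ᵥ u := (quadForm_mul_mul_transpose C W u).symm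
  rw [hR, quadForm_sub hW, quadForm_sub hVs, hc, hq, dotProduct_mulVec_comm_of_isSymm hVs u₀ u]
  ring

theorem posDef_mul_mul_transpose (hC : Function.Injective Cᵀ.mulVec) (hW : W.PosDef) :
    (C * W * Cᵀ).PosDef := by
  obtain ⟨hs, hp⟩ := posDef_real_iff.1 hW
  refine posDef_real_iff.2 ⟨by simp [transpose_mul, hs, Matrix.mul_assoc], fun x hx => ?_⟩
  rw [quadForm_mul_mul_transpose]
  exact hp _ fun h => hx (hC (by simpa using h))

theorem PosDef.isUnit_det {V : Matrix κ κ ℝ} (hV : V.PosDef) : IsUnit V.det :=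
  (isUnit_iff_isUnit_det _).1 hV.isUnit

theorem isSymm_riccatiMap (hW : Wᵀ = W) (hS : Sᵀ = S) :
    (riccatiMap F C S W)ᵀ = riccatiMap F C S W := by
  simp only [riccatiMap, transpose_add, transpose_sub, transpose_mul, transpose_transpose, hW, hS,
    transpose_nonsing_inv, Matrix.mul_assoc]

/-- Together with the next lemma: the Riccati form at x is a minimum over controls u of expressions
increasing in W. Monotonicity of the operator and its lower bound S follow. -/
theorem quadForm_riccatiMap_le (hC : Function.Injective Cᵀ.mulVec) (hW : W.PosDef) (x : ι → ℝ)
    (u : κ → ℝ) :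
    x ⬝ᵥ riccatiMap F C S W *ᵥ x ≤
      (Fᵀ *ᵥ x - Cᵀ *ᵥ u) ⬝ᵥ W *ᵥ (Fᵀ *ᵥ x - Cᵀ *ᵥ u) + x ⬝ᵥ S *ᵥ x := by
  have hV := posDef_mul_mul_transpose hC hW
  obtain ⟨u₀, -, h⟩ := quadForm_riccatiMap (F := F) (S := S) (PosDef.transpose_eq hW)
    (PosDef.isUnit_det hV) x u
  rw [h]
  linarith [(posSemidef_real_iff.1 hV.posSemidef).2 (u - u₀)]

theorem exists_quadForm_riccatiMap_eq (hC : Function.Injective Cᵀ.mulVec) (hW : W.PosDef)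
    (x : ι → ℝ) :
    ∃ u, x ⬝ᵥ riccatiMap F C S W *ᵥ x =
      (Fᵀ *ᵥ x - Cᵀ *ᵥ u) ⬝ᵥ W *ᵥ (Fᵀ *ᵥ x - Cᵀ *ᵥ u) + x ⬝ᵥ S *ᵥ x := by
  have hV := posDef_mul_mul_transpose hC hW
  refine ⟨(C * W * Cᵀ)⁻¹ *ᵥ (C *ᵥ (W *ᵥ (Fᵀ *ᵥ x))), ?_⟩
  obtain ⟨u₀, h₀, h⟩ := quadForm_riccatiMap (F := F) (S := S) (PosDef.transpose_eq hW)
    (PosDef.isUnit_det hV) x ((C * W * Cᵀ)⁻¹ *ᵥ (C *ᵥ (W *ᵥ (Fᵀ *ᵥ x))))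
  rw [h, ← h₀]
  simp

theorem riccatiMap_mono (hC : Function.Injective Cᵀ.mulVec) {W' : Matrix ι ι ℝ} (hW : W.PosDef)
    (hW' : W'.PosDef) (h : ∀ x, x ⬝ᵥ W *ᵥ x ≤ x ⬝ᵥ W' *ᵥ x) (x : ι → ℝ) :
    x ⬝ᵥ riccatiMap F C S W *ᵥ x ≤ x ⬝ᵥ riccatiMap F C S W' *ᵥ x := by
  obtain ⟨u, hu⟩ := exists_quadForm_riccatiMap_eq (F := F) (S := S) hC hW' x
  rw [hu]
  exact (quadForm_riccatiMap_le hC hW x u).trans (by gcongr; exact h _)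

theorem quadForm_le_riccatiMap (hC : Function.Injective Cᵀ.mulVec) (hW : W.PosDef) (x : ι → ℝ) :
    x ⬝ᵥ S *ᵥ x ≤ x ⬝ᵥ riccatiMap F C S W *ᵥ x := by
  obtain ⟨u, hu⟩ := exists_quadForm_riccatiMap_eq (F := F) (S := S) hC hW x
  rw [hu]
  linarith [(posSemidef_real_iff.1 hW.posSemidef).2 (Fᵀ *ᵥ x - Cᵀ *ᵥ u)]

theorem riccatiMap_posDef (hC : Function.Injective Cᵀ.mulVec) (hS : S.PosDef) (hW : W.PosDef) :
    (riccatiMap F C S W).PosDef :=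
  posDef_real_iff.2 ⟨isSymm_riccatiMap (PosDef.transpose_eq hW) (PosDef.transpose_eq hS), fun x hx =>
    ((posDef_real_iff.1 hS).2 x hx).trans_le (quadForm_le_riccatiMap hC hW x)⟩

theorem continuousAt_riccatiMap (hV : IsUnit (C * W * Cᵀ).det) :
    ContinuousAt (riccatiMap F C S) W := by
  have h1 : ContinuousAt (fun X : Matrix ι ι ℝ => (C * X * Cᵀ)⁻¹) W := by
    have h2 : ContinuousAt (fun X : Matrix ι ι ℝ => C * X * Cᵀ) W := by fun_prop
    have h3 : ContinuousAt (fun V : Matrix κ κ ℝ => V⁻¹) (C * W * Cᵀ) :=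
      continuousAt_matrix_inv _ (by
        obtain ⟨u, hu⟩ := hV
        simp [← hu, Ring.inverse_eq_inv'])
    exact ContinuousAt.comp (f := fun X : Matrix ι ι ℝ => C * X * Cᵀ) h3 h2
  unfold riccatiMap
  fun_prop

/-- Iterating the Riccati operator from `S`. -/
noncomputable def riccatiIter (F : Matrix ι ι ℝ) (C : Matrix κ ι ℝ) (S : Matrix ι ι ℝ) (n : ℕ) :
    Matrix ι ι ℝ := (riccatiMap F C S)^[n] S

theorem riccatiIter_succ (n : ℕ) :
    riccatiIter F C S (n + 1) = riccatiMap F C S (riccatiIter F C S n) :=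
  Function.iterate_succ_apply' _ _ _

theorem riccatiIter_posDef (hC : Function.Injective Cᵀ.mulVec) (hS : S.PosDef) (n : ℕ) :
    (riccatiIter F C S n).PosDef := by
  induction n with
  | zero => exact hS
  | succ n ih => rw [riccatiIter_succ]; exact riccatiMap_posDef hC hS ih

theorem monotone_riccatiIter (hC : Function.Injective Cᵀ.mulVec) (hS : S.PosDef) (x : ι → ℝ) :
    Monotone fun n => x ⬝ᵥ riccatiIter F C S n *ᵥ x := by
  refine monotone_nat_of_le_succ fun n => ?_
  induction n generalizing x with
  | zero =>
    rw [riccatiIter_succ]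
    exact quadForm_le_riccatiMap hC hS x
  | succ n ih =>
    rw [riccatiIter_succ n, riccatiIter_succ (n + 1)]
    exact riccatiMap_mono hC (riccatiIter_posDef hC hS _) (riccatiIter_posDef hC hS _) ih x

/-- Let U be the subspace of vectors at which the iterates stay bounded. By the variational bound,
Fᵀx - Cᵀu ∈ U forces x ∈ U, so the preimage under Fᵀ of U + range Cᵀ lies in U. As Fᵀ is invertible,
comparing dimensions shows that U contains the range of Cᵀ and is invariant; observability makes it
everything. -/
theorem bddAbove_riccatiIter (hC : Function.Injective Cᵀ.mulVec) (hS : S.PosDef)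
    (hF : IsUnit F.det)
    (hobs : ∀ U : Submodule ℝ (ι → ℝ), (∀ x ∈ U, Fᵀ *ᵥ x ∈ U) → (∀ u, Cᵀ *ᵥ u ∈ U) → U = ⊤)
    (x : ι → ℝ) : BddAbove (Set.range fun n => x ⬝ᵥ riccatiIter F C S n *ᵥ x) := by
  have hnn : ∀ n (x : ι → ℝ), 0 ≤ x ⬝ᵥ riccatiIter F C S n *ᵥ x := fun n =>
    (posSemidef_real_iff.1 (riccatiIter_posDef hC hS n).posSemidef).2
  have hsy : ∀ n, (riccatiIter F C S n)ᵀ = riccatiIter F C S n := fun n =>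
    PosDef.transpose_eq (riccatiIter_posDef hC hS n)
  let U : Submodule ℝ (ι → ℝ) :=
    { carrier := {x | ∃ b, ∀ n, x ⬝ᵥ riccatiIter F C S n *ᵥ x ≤ b}
      zero_mem' := ⟨0, by simp⟩
      add_mem' := by
        rintro x y ⟨b, hb⟩ ⟨b', hb'⟩
        refine ⟨2 * b + 2 * b', fun n => ?_⟩
        have h1 := quadForm_add (hsy n) x y
        have h2 := quadForm_sub (hsy n) x y
        linarith [hnn n (x - y), hb n, hb' n]
      smul_mem' := by
        rintro c x ⟨b, hb⟩
        refine ⟨c * (c * b), fun n => ?_⟩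
        rw [mulVec_smul, smul_dotProduct, dotProduct_smul, smul_eq_mul, smul_eq_mul, ← mul_assoc,
          ← mul_assoc]
        exact mul_le_mul_of_nonneg_left (hb n) (mul_self_nonneg c) }
  have key : ∀ x u, Fᵀ *ᵥ x - Cᵀ *ᵥ u ∈ U → x ∈ U := by
    rintro x u ⟨b, hb⟩
    refine ⟨b + x ⬝ᵥ S *ᵥ x, fun n => ?_⟩
    refine (monotone_riccatiIter hC hS x n.le_succ).trans ?_
    simp only [Nat.succ_eq_add_one, riccatiIter_succ]
    refine (quadForm_riccatiMap_le hC (riccatiIter_posDef hC hS n) x u).trans ?_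
    gcongr
    exact hb n
  have hFt : IsUnit Fᵀ := (isUnit_iff_isUnit_det _).2 (by rwa [det_transpose])
  let φ : (ι → ℝ) ≃ₗ[ℝ] (ι → ℝ) := Matrix.toLinearEquiv' Fᵀ (invertibleOfIsUnitDet Fᵀ
    (by rwa [det_transpose]))
  have hφ : ∀ x, φ x = Fᵀ *ᵥ x := fun x => rfl
  let R : Submodule ℝ (ι → ℝ) := LinearMap.range Cᵀ.mulVecLin
  have hle : (U ⊔ R).comap φ.toLinearMap ≤ U := by
    intro x hx
    obtain ⟨y, hy, r, ⟨u, rfl⟩, h⟩ := Submodule.mem_sup.1 (Submodule.mem_comap.1 hx)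
    refine key x u ?_
    have : Fᵀ *ᵥ x - Cᵀ *ᵥ u = y := by
      rw [← hφ, sub_eq_iff_eq_add]
      exact h.symm
    rwa [this]
  have hfin : ∀ X : Submodule ℝ (ι → ℝ),
      Module.finrank ℝ (X.comap φ.toLinearMap) = Module.finrank ℝ X := fun X => by
    have := Submodule.map_equiv_eq_comap_symm φ.symm X
    rw [LinearEquiv.symm_symm] at this
    rw [← this]
    exact LinearEquiv.finrank_map_eq φ.symm X
  -- The preimage of U ⊔ R has the dimension of U ⊔ R and lies in U, so the larger space cannot
  -- exceed U.
  have h1 : U = U ⊔ R := Submodule.eq_of_le_of_finrank_le le_sup_left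
    ((hfin _).symm.le.trans (Submodule.finrank_mono hle))
  have h2 : U.comap φ.toLinearMap = U :=
    Submodule.eq_of_le_of_finrank_eq (by rw [← h1] at hle; exact hle) (hfin U)
  have h3 : U = ⊤ := by
    refine hobs U (fun x hx => ?_) (fun u => ?_)
    · rw [← h2] at hx
      have := Submodule.mem_comap.1 hx
      rw [← hφ]
      exact this
    · rw [h1]
      exact Submodule.mem_sup_right ⟨u, rfl⟩
  obtain ⟨b, hb⟩ : x ∈ U := h3 ▸ Submodule.mem_top
  exact ⟨b, by rintro _ ⟨n, rfl⟩; exact hb n⟩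

theorem exists_isRiccatiSolution (hC : Function.Injective Cᵀ.mulVec) (hS : S.PosDef)
    (hF : IsUnit F.det)
    (hobs : ∀ U : Submodule ℝ (ι → ℝ), (∀ x ∈ U, Fᵀ *ᵥ x ∈ U) → (∀ u, Cᵀ *ᵥ u ∈ U) → U = ⊤) :
    ∃ W, IsRiccatiSolution F C S W := by
  have hq : ∀ x : ι → ℝ, ∃ l, Tendsto (fun n => x ⬝ᵥ riccatiIter F C S n *ᵥ x) atTop (𝓝 l) :=
    fun x => ⟨_, tendsto_atTop_ciSup (monotone_riccatiIter hC hS x)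
      (bddAbove_riccatiIter hC hS hF hobs x)⟩
  choose q hq using hq
  have hsy : ∀ n, (riccatiIter F C S n)ᵀ = riccatiIter F C S n := fun n =>
    PosDef.transpose_eq (riccatiIter_posDef hC hS n)
  -- The limits of the forms determine the limit matrix by polarisation.
  let W : Matrix ι ι ℝ := of fun i j =>
    (q (Pi.single j 1 + Pi.single i 1) - q (Pi.single j 1) - q (Pi.single i 1)) / 2
  have hlim : Tendsto (riccatiIter F C S) atTop (𝓝 W) := by
    refine tendsto_pi_nhds.2 fun i => tendsto_pi_nhds.2 fun j => ?_
    refine ((((hq (Pi.single j 1 + Pi.single i 1)).sub (hq (Pi.single j 1))).sub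
      (hq (Pi.single i 1))).div_const 2).congr fun n => ?_
    rw [quadForm_add (hsy n)]
    simp
    ring
  have hquad : ∀ x : ι → ℝ, x ⬝ᵥ S *ᵥ x ≤ x ⬝ᵥ W *ᵥ x := by
    intro x
    have hc : Continuous fun X : Matrix ι ι ℝ => x ⬝ᵥ X *ᵥ x := by fun_prop
    exact ge_of_tendsto' ((hc.tendsto W).comp hlim) fun n =>
      monotone_riccatiIter hC hS x (Nat.zero_le n)
  have hWs : Wᵀ = W := by
    have hc : Continuous fun X : Matrix ι ι ℝ => Xᵀ := continuous_id.matrix_transpose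
    refine tendsto_nhds_unique ((hc.tendsto W).comp hlim) (hlim.congr fun n => (hsy n).symm)
  have hWp : W.PosDef :=
    posDef_real_iff.2 ⟨hWs, fun x hx => ((posDef_real_iff.1 hS).2 x hx).trans_le (hquad x)⟩
  have hV := PosDef.isUnit_det (posDef_mul_mul_transpose hC hWp)
  refine ⟨W, hWp.posSemidef, hV, ?_⟩
  have h1 : Tendsto (fun n => riccatiIter F C S (n + 1)) atTop (𝓝 W) :=
    hlim.comp (tendsto_add_atTop_nat 1)
  simp only [riccatiIter_succ] at h1
  exact tendsto_nhds_unique h1 ((continuousAt_riccatiMap hV).tendsto.comp hlim)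

end Riccati

end CointSSM

namespace CointSSM

open scoped Matrix.Norms.Operator

/-! ### Eigenvectors and unobservable subspaces -/

section Complexification

variable {α β γ : Type*} [Fintype α] [Fintype β] [Fintype γ]

theorem toComplex_mul (A : Matrix α β ℝ) (B : Matrix β γ ℝ) :
    toComplex (A * B) = toComplex A * toComplex B :=
  Matrix.map_mul (f := Complex.ofRealHom)

theorem toComplex_transpose (A : Matrix α β ℝ) : toComplex Aᵀ = (toComplex A)ᵀ := rfl

theorem toComplex_mulVec_re (A : Matrix α β ℝ) (z : β → ℂ) :
    (fun i => ((toComplex A *ᵥ z) i).re) = A *ᵥ fun j => (z j).re := by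
  ext i
  simp [toComplex, mulVec, dotProduct]

theorem toComplex_mulVec_im (A : Matrix α β ℝ) (z : β → ℂ) :
    (fun i => ((toComplex A *ᵥ z) i).im) = A *ᵥ fun j => (z j).im := by
  ext i
  simp [toComplex, mulVec, dotProduct]

theorem toComplex_mulVec_injective {A : Matrix α β ℝ} (hA : Function.Injective A.mulVec) :
    Function.Injective (toComplex A).mulVec := by
  intro z w h
  have h1 := toComplex_mulVec_re A z
  have h2 := toComplex_mulVec_im A z
  rw [show toComplex A *ᵥ z = toComplex A *ᵥ w from h] at h1 h2
  have h3 := hA (h1.symm.trans (toComplex_mulVec_re A w))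
  have h4 := hA (h2.symm.trans (toComplex_mulVec_im A w))
  ext i
  exact Complex.ext (congrFun h3 i) (congrFun h4 i)

variable [DecidableEq α]

theorem mem_spectrum_of_mulVec_eq {A : Matrix α α ℂ} {v : α → ℂ} (hv : v ≠ 0) {z : ℂ}
    (h : A *ᵥ v = z • v) : z ∈ spectrum ℂ A := by
  intro hu
  have h1 : (algebraMap ℂ (Matrix α α ℂ) z - A) *ᵥ v = 0 := by
    rw [sub_mulVec, h, Algebra.algebraMap_eq_smul_one, smul_mulVec, one_mulVec, sub_self]
  exact hv ((mulVec_injective_iff_isUnit.2 hu) (by simpa using h1))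

/-- A nonzero invariant subspace contains an eigenvector. -/
theorem exists_eigenvector_mem {A : Matrix α α ℂ} {U : Submodule ℂ (α → ℂ)} (hU : U ≠ ⊥)
    (h : ∀ x ∈ U, A *ᵥ x ∈ U) : ∃ z : ℂ, ∃ v ∈ U, v ≠ 0 ∧ A *ᵥ v = z • v := by
  have : Nontrivial U := Submodule.nontrivial_iff_ne_bot.2 hU
  let T : Module.End ℂ U := A.mulVecLin.restrict h
  obtain ⟨z, hz⟩ := Module.End.exists_eigenvalue T
  obtain ⟨v, hv⟩ := hz.exists_hasEigenvector
  refine ⟨z, v, v.2, fun h0 => hv.2 (Subtype.ext h0), ?_⟩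
  exact congrArg Subtype.val hv.apply_eq_smul

/-- The vectors whose real and imaginary parts lie in U form a complex invariant subspace, which has
an eigenvector. This is one half of the Hautus test. -/
theorem exists_unobservable_eigenvector {A : Matrix α α ℝ} {C : Matrix β α ℝ}
    {U : Submodule ℝ (α → ℝ)} (hU : U ≠ ⊥) (h : ∀ x ∈ U, A *ᵥ x ∈ U)
    (hC : ∀ x ∈ U, C *ᵥ x = 0) :
    ∃ z : ℂ, ∃ v : α → ℂ, v ≠ 0 ∧ toComplex A *ᵥ v = z • v ∧ toComplex C *ᵥ v = 0 := by
  let U' : Submodule ℂ (α → ℂ) :=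
    { carrier := {z | (fun i => (z i).re) ∈ U ∧ (fun i => (z i).im) ∈ U}
      zero_mem' := ⟨U.zero_mem, U.zero_mem⟩
      add_mem' := fun ha hb => ⟨U.add_mem ha.1 hb.1, U.add_mem ha.2 hb.2⟩
      smul_mem' := by
        rintro c z ⟨h1, h2⟩
        constructor
        · convert U.sub_mem (U.smul_mem c.re h1) (U.smul_mem c.im h2) using 1
          ext i; simp
        · convert U.add_mem (U.smul_mem c.re h2) (U.smul_mem c.im h1) using 1
          ext i; simp }
  obtain ⟨x, hx, hx0⟩ := U.exists_mem_ne_zero_of_ne_bot hU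
  have hU' : U' ≠ ⊥ := by
    refine (Submodule.ne_bot_iff _).2 ⟨fun i => (x i : ℂ), ⟨by simpa using hx, ?_⟩, fun h0 => hx0 ?_⟩
    · exact U.zero_mem
    · ext i
      simpa using congrFun h0 i
  obtain ⟨z, v, hv, hv0, he⟩ := exists_eigenvector_mem (A := toComplex A) hU' (by
    rintro z ⟨h1, h2⟩
    refine ⟨?_, ?_⟩
    · rw [toComplex_mulVec_re]; exact h _ h1
    · rw [toComplex_mulVec_im]; exact h _ h2)
  refine ⟨z, v, hv0, he, ?_⟩
  ext i
  have h1 := congrFun (toComplex_mulVec_re C v) i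
  have h2 := congrFun (toComplex_mulVec_im C v) i
  rw [hC _ hv.1] at h1
  rw [hC _ hv.2] at h2
  exact Complex.ext h1 h2

/-- The unobservable subspace. -/
def unobservable (A : Matrix α α ℝ) (C : Matrix β α ℝ) : Submodule ℝ (α → ℝ) :=
  ⨅ k : ℕ, LinearMap.ker (C * A ^ k).mulVecLin

theorem mem_unobservable {A : Matrix α α ℝ} {C : Matrix β α ℝ} {x : α → ℝ} :
    x ∈ unobservable A C ↔ ∀ k : ℕ, (C * A ^ k) *ᵥ x = 0 := by
  simp [unobservable, Submodule.mem_iInf]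

theorem mulVec_mem_unobservable {A : Matrix α α ℝ} {C : Matrix β α ℝ} {x : α → ℝ}
    (hx : x ∈ unobservable A C) : A *ᵥ x ∈ unobservable A C := by
  rw [mem_unobservable] at hx ⊢
  intro k
  rw [mulVec_mulVec, Matrix.mul_assoc, ← pow_succ]
  exact hx (k + 1)

/-- The converse half of the Hautus test: the real and imaginary parts of such an eigenvector are
unobservable, and they do not both vanish. -/
theorem unobservable_ne_bot {A : Matrix α α ℝ} {C : Matrix β α ℝ} {v : α → ℂ} (hv : v ≠ 0)
    {z : ℂ} (hA : toComplex A *ᵥ v = z • v) (hC : toComplex C *ᵥ v = 0) :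
    unobservable A C ≠ ⊥ := by
  have hk : ∀ k : ℕ, toComplex (C * A ^ k) *ᵥ v = 0 := by
    intro k
    have : toComplex (A ^ k) *ᵥ v = z ^ k • v := by
      induction k with
      | zero =>
        have : toComplex (1 : Matrix α α ℝ) = 1 := Matrix.map_one _ (by simp) (by simp)
        simp [this]
      | succ k ih => rw [pow_succ', toComplex_mul, ← mulVec_mulVec, ih, mulVec_smul, hA, smul_smul,
          pow_succ]
    rw [toComplex_mul, ← mulVec_mulVec, this, mulVec_smul, hC, smul_zero]
  have hre : (fun i => (v i).re) ∈ unobservable A C := mem_unobservable.2 fun k => by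
    rw [← toComplex_mulVec_re, hk]; rfl
  have him : (fun i => (v i).im) ∈ unobservable A C := mem_unobservable.2 fun k => by
    rw [← toComplex_mulVec_im, hk]; rfl
  intro hb
  rw [hb] at hre him
  refine hv (funext fun i => Complex.ext ?_ ?_)
  · exact congrFun ((Submodule.mem_bot ℝ).1 hre) i
  · exact congrFun ((Submodule.mem_bot ℝ).1 him) i

end Complexification

/-! ### Minimal realisations are observable, and dually controllable -/

section Minimality

variable {n m d : ℕ} {A : Matrix (Fin n) (Fin n) ℝ} {B : Matrix (Fin n) (Fin m) ℝ}
  {C : Matrix (Fin d) (Fin n) ℝ}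

theorem isUnit_smul_one_sub {q : ℕ} {A : Matrix (Fin q) (Fin q) ℂ} {z : ℂ}
    (hz : z ∉ spectrum ℂ A) : IsUnit (z • (1 : Matrix (Fin q) (Fin q) ℂ) - A).det := by
  rw [← isUnit_iff_isUnit_det, ← Algebra.algebraMap_eq_smul_one]
  exact spectrum.notMem_iff.1 hz

theorem transferFunction_eq_of_intertwining {q : ℕ} {A' : Matrix (Fin q) (Fin q) ℝ}
    {C' : Matrix (Fin d) (Fin q) ℝ} {T : Matrix (Fin q) (Fin n) ℝ} (hA : A' * T = T * A)
    (hC : C' * T = C) {z : ℂ} (hz : z ∉ spectrum ℂ (toComplex A))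
    (hz' : z ∉ spectrum ℂ (toComplex A')) :
    transferFunction A B C z = transferFunction A' (T * B) C' z := by
  have hu := isUnit_smul_one_sub hz
  have hu' := isUnit_smul_one_sub hz'
  have hA' : toComplex A' * toComplex T = toComplex T * toComplex A := by
    rw [← toComplex_mul, hA, toComplex_mul]
  have h1 : toComplex T * (z • (1 : Matrix (Fin n) (Fin n) ℂ) - toComplex A) =
      (z • (1 : Matrix (Fin q) (Fin q) ℂ) - toComplex A') * toComplex T := by
    rw [Matrix.mul_sub, Matrix.sub_mul, hA', Matrix.mul_smul, Matrix.smul_mul, Matrix.mul_one,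
      Matrix.one_mul]
  have h2 : (z • (1 : Matrix (Fin q) (Fin q) ℂ) - toComplex A')⁻¹ * toComplex T =
      toComplex T * (z • (1 : Matrix (Fin n) (Fin n) ℂ) - toComplex A)⁻¹ := by
    have h3 := congrArg (fun X => (z • (1 : Matrix (Fin q) (Fin q) ℂ) - toComplex A')⁻¹ *
      (X * (z • (1 : Matrix (Fin n) (Fin n) ℂ) - toComplex A)⁻¹)) h1
    simp only [Matrix.mul_assoc] at h3
    rw [mul_nonsing_inv _ hu, Matrix.mul_one] at h3
    rw [h3, ← Matrix.mul_assoc, nonsing_inv_mul _ hu', Matrix.one_mul]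
  unfold transferFunction
  rw [toComplex_mul, ← hC, toComplex_mul]
  simp only [Matrix.mul_assoc]
  rw [← Matrix.mul_assoc _ (toComplex T) (toComplex B), h2]
  simp only [Matrix.mul_assoc]

/-- The system descends to the quotient by the unobservable subspace with the same transfer
function, so a nonzero subspace would give a smaller realisation. -/
theorem IsMinimal.unobservable_eq_bot (h : IsMinimal A B C) : unobservable A C = ⊥ := by
  by_contra hU
  set U := unobservable A C with hUdef
  let q := Module.finrank ℝ ((Fin n → ℝ) ⧸ U)
  have hq : q < n := by
    have h1 := Submodule.finrank_quotient_add_finrank U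
    have h2 : Module.finrank ℝ U ≠ 0 := fun h0 => hU (Submodule.finrank_eq_zero.1 h0)
    rw [Module.finrank_fin_fun] at h1
    change q + _ = n at h1
    omega
  let e : ((Fin n → ℝ) ⧸ U) ≃ₗ[ℝ] (Fin q → ℝ) := LinearEquiv.ofFinrankEq _ _ (by simp [q])
  let π : (Fin n → ℝ) →ₗ[ℝ] (Fin q → ℝ) := e.toLinearMap ∘ₗ U.mkQ
  have hπs : Function.Surjective π := e.surjective.comp U.mkQ_surjective
  have hπU : ∀ x, π x = 0 ↔ x ∈ U := fun x => by simp [π]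
  obtain ⟨σ, hσ⟩ := π.exists_rightInverse_of_surjective (LinearMap.range_eq_top.2 hπs)
  have hσ' : ∀ y, π (σ y) = y := fun y => LinearMap.congr_fun hσ y
  -- The section σ picks representatives; any other choice differs by an element of U, which A
  -- preserves and C kills.
  have hdiff : ∀ x, σ (π x) - x ∈ U := fun x => by
    rw [← hπU, map_sub, hσ', sub_self]
  have hT : ∀ x, LinearMap.toMatrix' π *ᵥ x = π x := fun x => LinearMap.toMatrix'_mulVec π x
  have hR : ∀ x, LinearMap.toMatrix' σ *ᵥ x = σ x := fun x => LinearMap.toMatrix'_mulVec σ x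
  have hC0 : ∀ x ∈ U, C *ᵥ x = 0 := fun x hx => by simpa using mem_unobservable.1 hx 0
  have hAT : (LinearMap.toMatrix' π * A * LinearMap.toMatrix' σ) * LinearMap.toMatrix' π =
      LinearMap.toMatrix' π * A := by
    refine Matrix.ext_of_mulVec_single fun i => ?_
    simp only [← mulVec_mulVec, hT, hR]
    rw [← sub_eq_zero, ← map_sub, ← mulVec_sub, hπU]
    exact mulVec_mem_unobservable (hdiff _)
  have hCT : (C * LinearMap.toMatrix' σ) * LinearMap.toMatrix' π = C := by
    refine Matrix.ext_of_mulVec_single fun i => ?_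
    simp only [← mulVec_mulVec, hT, hR]
    rw [← sub_eq_zero, ← mulVec_sub]
    exact hC0 _ (hdiff _)
  exact absurd (h q _ _ _ fun z hz hz' => transferFunction_eq_of_intertwining hAT hCT hz hz')
    (not_le.2 hq)

theorem IsMinimal.eq_zero_of_eigenvector (h : IsMinimal A B C) {v : Fin n → ℂ} {z : ℂ}
    (hA : toComplex A *ᵥ v = z • v) (hC : toComplex C *ᵥ v = 0) : v = 0 := by
  by_contra hv
  exact unobservable_ne_bot hv hA hC h.unobservable_eq_bot

theorem spectrum_transpose {q : ℕ} (A : Matrix (Fin q) (Fin q) ℂ) :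
    spectrum ℂ Aᵀ = spectrum ℂ A := by
  ext z
  rw [← not_iff_not, spectrum.notMem_iff, spectrum.notMem_iff, Algebra.algebraMap_eq_smul_one,
    ← isUnit_transpose]
  simp

theorem transferFunction_transpose (z : ℂ) :
    transferFunction Aᵀ Cᵀ Bᵀ z = (transferFunction A B C z)ᵀ := by
  simp [transferFunction, transpose_mul, toComplex_transpose, transpose_nonsing_inv,
    Matrix.mul_assoc]

/-- Duality: observability of the transposed triple is controllability of the original one. -/
theorem IsMinimal.transpose (h : IsMinimal A B C) : IsMinimal Aᵀ Cᵀ Bᵀ := by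
  intro q A' B' C' h'
  refine h q A'ᵀ C'ᵀ B'ᵀ fun z hz hz' => ?_
  have h1 := h' z (by rwa [toComplex_transpose, spectrum_transpose])
    (by rwa [toComplex_transpose, spectrum_transpose] at hz')
  rw [transferFunction_transpose] at h1 ⊢
  rw [← h1, transpose_transpose]

end Minimality

section Blocks

variable {c p d : ℕ}

/-- The integrated block has only the eigenvalue 0, which is not an eigenvalue of A₂. For z ≠ 0 only
the A₂ component survives and observability kills it; for z = 0 only the integrated component
survives and injectivity of C₁ kills it. Applied to (A, C) and to (Aᵀ, Bᵀ). -/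
theorem eq_zero_of_block_eigenvector {A₂ : Matrix (Fin p) (Fin p) ℝ} {C₁ : Matrix (Fin d) (Fin c) ℝ}
    {C₂ : Matrix (Fin d) (Fin p) ℝ} (h0 : (0 : ℂ) ∉ spectrum ℂ (toComplex A₂))
    (hobs : ∀ (z : ℂ) (v : Fin p → ℂ), toComplex A₂ *ᵥ v = z • v → toComplex C₂ *ᵥ v = 0 → v = 0)
    (hC₁ : Function.Injective C₁.mulVec) {z : ℂ} {v : Fin c ⊕ Fin p → ℂ}
    (hA : toComplex (fromBlocks 0 0 0 A₂) *ᵥ v = z • v)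
    (hC : toComplex (fromCols C₁ C₂) *ᵥ v = 0) : v = 0 := by
  have eA : toComplex (fromBlocks (0 : Matrix (Fin c) (Fin c) ℝ) 0 0 A₂) =
      fromBlocks 0 0 0 (toComplex A₂) := by
    ext (i | i) (j | j) <;> simp [toComplex]
  have eC : toComplex (fromCols C₁ C₂) = fromCols (toComplex C₁) (toComplex C₂) := by
    ext i (j | j) <;> simp [toComplex]
  rw [eA, fromBlocks_mulVec] at hA
  rw [eC, fromCols_mulVec] at hC
  have h1 : ∀ i, z * v (Sum.inl i) = 0 := fun i => by
    simpa using (congrFun hA (Sum.inl i)).symm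
  have h2 : toComplex A₂ *ᵥ (v ∘ Sum.inr) = z • (v ∘ Sum.inr) := by
    ext i
    simpa using congrFun hA (Sum.inr i)
  have h3 : v ∘ Sum.inr = 0 ∧ v ∘ Sum.inl = 0 := by
    rcases eq_or_ne z 0 with rfl | hz
    · have hr : v ∘ Sum.inr = 0 := by
        by_contra hne
        exact h0 (mem_spectrum_of_mulVec_eq hne h2)
      refine ⟨hr, toComplex_mulVec_injective hC₁ ?_⟩
      simpa [hr] using hC
    · have hl : v ∘ Sum.inl = 0 := funext fun i => (mul_eq_zero.1 (h1 i)).resolve_left hz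
      exact ⟨hobs z _ h2 (by simpa [hl] using hC), hl⟩
  ext (i | i)
  · exact congrFun h3.2 i
  · exact congrFun h3.1 i

end Blocks

/-! ### Sampling does not create new eigenvectors -/

section KalmanBertram

variable {α : Type*} [Fintype α] [DecidableEq α]

theorem exp_mulVec_of_mulVec_mulVec_eq_zero {N : Matrix α α ℂ} {w : α → ℂ}
    (h : N *ᵥ (N *ᵥ w) = 0) : NormedSpace.exp N *ᵥ w = w + N *ᵥ w := by
  have h1 := NormedSpace.exp_series_hasSum_exp' (𝕂 := ℂ) N
  have hc : Continuous fun M : Matrix α α ℂ => M *ᵥ w := by fun_prop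
  have h2 := h1.map (AddMonoidHom.mk' (fun M : Matrix α α ℂ => M *ᵥ w)
    fun a b => add_mulVec a b w) hc
  refine h2.unique ?_
  have hz : ∀ k ∉ Finset.range 2, ((AddMonoidHom.mk' (fun M : Matrix α α ℂ => M *ᵥ w)
      fun a b => add_mulVec a b w) ∘ fun n : ℕ => ((n.factorial : ℂ)⁻¹ • N ^ n)) k = 0 := by
    intro k hk
    obtain ⟨j, rfl⟩ : ∃ j, k = j + 2 := ⟨k - 2, by simp at hk; omega⟩
    simp only [Function.comp_apply, AddMonoidHom.mk'_apply, smul_mulVec, pow_add, pow_two]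
    rw [← mulVec_mulVec, ← mulVec_mulVec, h, mulVec_zero, smul_zero]
  have h3 := hasSum_sum_of_ne_finset_zero (L := .unconditional ℕ) hz
  simpa [Finset.sum_range_succ] using h3

/-- Split tA into the commuting parts tz and t(A - z); the series of the second stops after the
linear term at w. -/
theorem exp_smul_mulVec {A : Matrix α α ℂ} {t z : ℂ} {w : α → ℂ}
    (h : (A - z • 1) *ᵥ ((A - z • 1) *ᵥ w) = 0) :
    NormedSpace.exp (t • A) *ᵥ w = Complex.exp (t * z) • (w + t • (A - z • 1) *ᵥ w) := by
  have e : t • A = (t * z) • (1 : Matrix α α ℂ) + t • (A - z • 1) := by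
    rw [smul_sub, smul_smul]; abel
  have hcomm : Commute ((t * z) • (1 : Matrix α α ℂ)) (t • (A - z • 1)) :=
    (Commute.one_left _).smul_left _
  rw [e, Matrix.exp_add_of_commute _ _ hcomm, ← mulVec_mulVec,
    exp_mulVec_of_mulVec_mulVec_eq_zero (N := t • (A - z • 1))
      (by simp only [smul_mulVec, mulVec_smul, h, smul_zero])]
  have : NormedSpace.exp ((t * z) • (1 : Matrix α α ℂ)) = Complex.exp (t * z) • 1 := by
    have h1 := NormedSpace.algebraMap_exp_comm (𝕂 := ℂ) (𝔸 := Matrix α α ℂ) (t * z)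
    rw [← Algebra.algebraMap_eq_smul_one, Complex.exp_eq_exp_ℂ, ← Algebra.algebraMap_eq_smul_one]
    exact h1.symm
  rw [this, smul_mulVec, one_mulVec, smul_mulVec]

/-- Under the Kalman-Bertram criterion the eigenvectors of `e^{hA}` are eigenvectors of `A`. -/
theorem exists_mulVec_eq_smul_of_exp {A : Matrix α α ℂ} {h : ℝ} (hh : h ≠ 0)
    (hKB : ∀ z ∈ spectrum ℂ A, ∀ z' ∈ spectrum ℂ A, ∀ k : ℤ, k ≠ 0 →
      z - z' ≠ 2 * Real.pi * Complex.I * k / h) {v : α → ℂ} (hv : v ≠ 0) {μ : ℂ}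
    (he : NormedSpace.exp ((h : ℂ) • A) *ᵥ v = μ • v) : ∃ z : ℂ, A *ᵥ v = z • v := by
  have hh' : (h : ℂ) ≠ 0 := by exact_mod_cast hh
  let U : Submodule ℂ (α → ℂ) :=
    { carrier := {w | NormedSpace.exp ((h : ℂ) • A) *ᵥ w = μ • w}
      zero_mem' := by simp
      add_mem' := fun {a b} ha hb => by
        simp only [Set.mem_ofPred_eq] at ha hb ⊢
        rw [mulVec_add, ha, hb, smul_add]
      smul_mem' := fun c a ha => by
        simp only [Set.mem_ofPred_eq] at ha ⊢
        rw [mulVec_smul, ha, smul_comm] }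
  have hcomm : Commute (NormedSpace.exp ((h : ℂ) • A)) A :=
    ((Commute.refl A).smul_left (h : ℂ)).exp_left
  have hAU : ∀ w ∈ U, A *ᵥ w ∈ U := fun w hw => by
    change NormedSpace.exp ((h : ℂ) • A) *ᵥ (A *ᵥ w) = μ • A *ᵥ w
    rw [mulVec_mulVec, hcomm.eq, ← mulVec_mulVec, show _ *ᵥ w = μ • w from hw, mulVec_smul]
  obtain ⟨z, w₀, hw₀U, hw₀, hz⟩ := exists_eigenvector_mem
    ((Submodule.ne_bot_iff U).2 ⟨v, he, hv⟩) hAU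
  have hexp : ∀ (a : ℂ) (w : α → ℂ), w ∈ U → w ≠ 0 → A *ᵥ w = a • w →
      Complex.exp (h * a) = μ := by
    intro a w hw hw0 ha
    have h0 : (A - a • 1) *ᵥ w = 0 := by rw [sub_mulVec, ha, smul_mulVec, one_mulVec, sub_self]
    have h1 := exp_smul_mulVec (t := (h : ℂ)) (A := A) (z := a) (w := w)
      (by rw [h0, mulVec_zero])
    rw [h0, smul_zero, add_zero, show _ *ᵥ w = μ • w from hw] at h1
    exact (smul_left_injective ℂ hw0 h1).symm
  -- All eigenvalues a of A on U satisfy e^{ha} = μ, so two of them differ by 2πik/h; the criterion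
  -- leaves k = 0.
  have huniq : ∀ (a : ℂ) (w : α → ℂ), w ∈ U → w ≠ 0 → A *ᵥ w = a • w → a = z := by
    intro a w hw hw0 ha
    obtain ⟨k, hk⟩ := Complex.exp_eq_exp_iff_exists_int.1
      ((hexp a w hw hw0 ha).trans (hexp z w₀ hw₀U hw₀ hz).symm)
    have hk' : a - z = 2 * Real.pi * Complex.I * k / h := by
      field_simp
      linear_combination hk
    rcases eq_or_ne k 0 with rfl | hk0
    · simpa [sub_eq_zero] using hk'
    · exact absurd hk' (hKB _ (mem_spectrum_of_mulVec_eq hw0 ha) _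
        (mem_spectrum_of_mulVec_eq hw₀ hz) k hk0)
  -- No Jordan block of size two: it would contribute the extra term μh(A - z)w to e^{hA}w, which
  -- equals μw on U.
  have hsq : ∀ w ∈ U, (A - z • 1) *ᵥ ((A - z • 1) *ᵥ w) = 0 → (A - z • 1) *ᵥ w = 0 := by
    intro w hw h0
    have h1 := exp_smul_mulVec (t := (h : ℂ)) h0
    rw [hexp z w₀ hw₀U hw₀ hz, show _ *ᵥ w = μ • w from hw, smul_add, left_eq_add] at h1
    have hμ : μ ≠ 0 := by
      rw [← hexp z w₀ hw₀U hw₀ hz]; exact Complex.exp_ne_zero _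
    exact (smul_eq_zero.1 ((smul_eq_zero.1 h1).resolve_left hμ)).resolve_left hh'
  have hsub : ∀ (a : ℂ), ∀ w ∈ U, (A - a • 1) *ᵥ w ∈ U := fun a w hw => by
    rw [sub_mulVec, smul_mulVec, one_mulVec]
    exact U.sub_mem (hAU w hw) (U.smul_mem a hw)
  -- Any split polynomial annihilating w reduces to A - z: factors with a ≠ z are injective on U,
  -- and repeated factors A - z collapse. It is applied to the characteristic polynomial.
  have hind : ∀ (s : Multiset ℂ), ∀ w ∈ U,
      (Polynomial.aeval A (s.map fun a => Polynomial.X - Polynomial.C a).prod) *ᵥ w = 0 →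
        (A - z • 1) *ᵥ w = 0 := by
    intro s
    induction s using Multiset.induction_on with
    | empty =>
      intro w _ h0
      have : w = 0 := by simpa using h0
      simp [this]
    | cons a s ih =>
      intro w hw h0
      rw [Multiset.map_cons, Multiset.prod_cons, mul_comm, map_mul, ← mulVec_mulVec] at h0
      have ea : Polynomial.aeval A (Polynomial.X - Polynomial.C a) = A - a • 1 := by
        simp [Algebra.algebraMap_eq_smul_one]
      rw [ea] at h0
      have h1 := ih _ (hsub a w hw) h0
      rcases eq_or_ne a z with rfl | haz
      · exact hsq w hw h1
      · by_contra hne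
        refine haz (huniq a _ (hsub z w hw) hne ?_)
        rw [← sub_eq_zero]
        have h2 : (A - a • 1) *ᵥ ((A - z • 1) *ᵥ w) = 0 := by
          rw [← h1, mulVec_mulVec, mulVec_mulVec]
          congr 1
          simp only [Matrix.sub_mul, Matrix.mul_sub, Matrix.smul_mul, Matrix.mul_smul,
            Matrix.one_mul, Matrix.mul_one, smul_sub, smul_smul, mul_comm z a]
          abel
        rwa [sub_mulVec A, smul_mulVec, one_mulVec] at h2
  refine ⟨z, ?_⟩
  have hsplit := (IsAlgClosed.splits A.charpoly).eq_prod_roots_of_monic A.charpoly_monic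
  have h1 := hind A.charpoly.roots v he (by
    rw [← hsplit, Matrix.aeval_self_charpoly, zero_mulVec])
  rwa [sub_mulVec, smul_mulVec, one_mulVec, sub_eq_zero] at h1

theorem toComplex_exp (t : ℝ) (A : Matrix α α ℝ) :
    toComplex (NormedSpace.exp (t • A)) = NormedSpace.exp ((t : ℂ) • toComplex A) := by
  have hc : Continuous (Complex.ofRealHom.mapMatrix : Matrix α α ℝ →+* Matrix α α ℂ) :=
    Continuous.matrix_map continuous_id Complex.continuous_ofReal
  have := NormedSpace.map_exp (Complex.ofRealHom.mapMatrix : Matrix α α ℝ →+* Matrix α α ℂ) hc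
    (t • A)
  refine this.trans (congrArg _ ?_)
  ext i j
  simp [toComplex]

end KalmanBertram

end CointSSM

namespace CointSSM

open scoped Matrix.Norms.Operator

/-! ### Controllability Gramian and spectrum of the exponential -/

section Gramian

variable {α β : Type*} [Fintype α] [DecidableEq α] [Fintype β] [DecidableEq β]

theorem mulVec_injective_of_rank_eq {A : Matrix α β ℝ} (h : A.rank = Fintype.card β) :
    Function.Injective A.mulVec := by
  have h1 := LinearMap.finrank_range_add_finrank_ker A.mulVecLin
  rw [Module.finrank_fintype_fun_eq_card, ← h] at h1
  have h2 : Module.finrank ℝ (LinearMap.ker A.mulVecLin) = 0 := by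
    unfold Matrix.rank at h1
    omega
  exact LinearMap.ker_eq_bot.1 (Submodule.finrank_eq_zero.1 h2)

theorem hasDerivAt_mul_exp_mulVec {A : Matrix α α ℝ} (D : Matrix β α ℝ) (x : α → ℝ) (u : ℝ) :
    HasDerivAt (fun u : ℝ => D *ᵥ (NormedSpace.exp (u • A) *ᵥ x))
      ((D * A) *ᵥ (NormedSpace.exp (u • A) *ᵥ x)) u := by
  have h1 : HasDerivAt (fun u : ℝ => NormedSpace.exp (u • A)) (A * NormedSpace.exp (u • A)) u :=
    hasDerivAt_exp_smul_const' A u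
  let T : Matrix α α ℝ →L[ℝ] (β → ℝ) := LinearMap.toContinuousLinearMap
    { toFun := fun M => D *ᵥ (M *ᵥ x)
      map_add' := fun a b => by rw [add_mulVec, mulVec_add]
      map_smul' := fun r a => by rw [smul_mulVec, mulVec_smul]; rfl }
  have h2 := T.hasFDerivAt.comp_hasDerivAt u h1
  have e : T (A * NormedSpace.exp (u • A)) = (D * A) *ᵥ (NormedSpace.exp (u • A) *ᵥ x) := by
    change D *ᵥ ((A * NormedSpace.exp (u • A)) *ᵥ x) = _
    simp only [mulVec_mulVec, Matrix.mul_assoc]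
  rw [← e]
  exact h2

/-- Each derivative of a function vanishing on an open set vanishes there, and differentiating
inserts a factor A. -/
theorem exp_mulVec_mem_unobservable {A : Matrix α α ℝ} {D : Matrix β α ℝ} {x : α → ℝ} {s : Set ℝ}
    (hs : IsOpen s) (h : ∀ u ∈ s, D *ᵥ (NormedSpace.exp (u • A) *ᵥ x) = 0) {u : ℝ} (hu : u ∈ s) :
    NormedSpace.exp (u • A) *ᵥ x ∈ unobservable A D := by
  refine mem_unobservable.2 fun k => ?_
  have : ∀ u ∈ s, (D * A ^ k) *ᵥ (NormedSpace.exp (u • A) *ᵥ x) = 0 := by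
    induction k with
    | zero => simpa using h
    | succ k ih =>
      intro u hu
      have h1 := hasDerivAt_mul_exp_mulVec (A := A) (D * A ^ k) x u
      have h2 : (fun u : ℝ => (D * A ^ k) *ᵥ (NormedSpace.exp (u • A) *ᵥ x)) =ᶠ[𝓝 u]
          fun _ => 0 := by
        filter_upwards [hs.mem_nhds hu] with w hw using ih w hw
      have h3 := (h1.congr_of_eventuallyEq h2.symm).unique (hasDerivAt_const u 0)
      rwa [Matrix.mul_assoc, ← pow_succ] at h3
  exact this u hu

theorem continuous_exp_smul (A : Matrix α α ℝ) : Continuous fun u : ℝ => NormedSpace.exp (u • A) :=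
  continuous_iff_continuousAt.2 fun u =>
    (hasDerivAt_exp_smul_const (𝕂 := ℝ) A u).continuousAt

/-- The controllability Gramian of a controllable pair is positive definite. -/
theorem posDef_gramian {A : Matrix α α ℝ} {B : Matrix α β ℝ} {Q : Matrix β β ℝ} {h : ℝ} (hh : 0 < h)
    (hQ : Q.PosDef) (hAB : unobservable Aᵀ Bᵀ = ⊥) :
    (Matrix.of fun i j => ∫ u in (0 : ℝ)..h,
      (NormedSpace.exp (u • A) * B * Q * Bᵀ * NormedSpace.exp (u • Aᵀ)) i j).PosDef := by
  set G : ℝ → Matrix α α ℝ := fun u =>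
    NormedSpace.exp (u • A) * B * Q * Bᵀ * NormedSpace.exp (u • Aᵀ) with hG
  have hexp : ∀ u : ℝ, NormedSpace.exp (u • Aᵀ) = (NormedSpace.exp (u • A))ᵀ := fun u => by
    rw [← transpose_smul, Matrix.exp_transpose]
  have hGc : Continuous G := by
    have h1 := continuous_exp_smul A
    have h2 := continuous_exp_smul Aᵀ
    fun_prop
  have hGs : ∀ u, (G u)ᵀ = G u := fun u => by
    simp only [hG, hexp, transpose_mul, transpose_transpose, PosDef.transpose_eq hQ,
      Matrix.mul_assoc]
  have hij : ∀ i j, IntervalIntegrable (fun u => G u i j) volume 0 h := fun i j =>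
    (hGc.matrix_elem i j).intervalIntegrable _ _
  have hquad : ∀ (x : α → ℝ) u, x ⬝ᵥ G u *ᵥ x =
      (Bᵀ *ᵥ (NormedSpace.exp (u • Aᵀ) *ᵥ x)) ⬝ᵥ Q *ᵥ (Bᵀ *ᵥ (NormedSpace.exp (u • Aᵀ) *ᵥ x)) := by
    intro x u
    have : G u = (NormedSpace.exp (u • A) * B) * Q * (NormedSpace.exp (u • A) * B)ᵀ := by
      simp only [hG, hexp, transpose_mul, Matrix.mul_assoc]
    rw [this, quadForm_mul_mul_transpose, transpose_mul, ← hexp, ← mulVec_mulVec]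
  refine posDef_real_iff.2 ⟨?_, fun x hx => ?_⟩
  · ext i j
    simp only [transpose_apply, of_apply]
    refine intervalIntegral.integral_congr fun u _ => ?_
    exact congrFun (congrFun (hGs u) i) j
  · have hint : x ⬝ᵥ (Matrix.of fun i j => ∫ u in (0 : ℝ)..h, G u i j) *ᵥ x =
        ∫ u in (0 : ℝ)..h, x ⬝ᵥ G u *ᵥ x := by
      simp only [dotProduct, mulVec, of_apply]
      rw [intervalIntegral.integral_finsetSum]
      · refine Finset.sum_congr rfl fun i _ => ?_
        rw [intervalIntegral.integral_const_mul, intervalIntegral.integral_finsetSum]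
        · simp only [intervalIntegral.integral_mul_const]
        · exact fun j _ => (hij i j).mul_const _
      · intro i _
        exact (Continuous.intervalIntegrable (by
          have := fun j => hGc.matrix_elem i j
          fun_prop) _ _)
    rw [hint]
    have hc : Continuous fun u => x ⬝ᵥ G u *ᵥ x := by fun_prop
    have hnn : ∀ u, 0 ≤ x ⬝ᵥ G u *ᵥ x := fun u => by
      rw [hquad]; exact (posSemidef_real_iff.1 hQ.posSemidef).2 _
    refine intervalIntegral.integral_pos hh hc.continuousOn (fun u _ => hnn u) ?_
    by_contra hcon
    push Not at hcon
    have h0 : ∀ u ∈ Set.Ioo (0 : ℝ) h, Bᵀ *ᵥ (NormedSpace.exp (u • Aᵀ) *ᵥ x) = 0 := by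
      intro u hu
      by_contra hne
      have h1 := (posDef_real_iff.1 hQ).2 _ hne
      rw [← hquad] at h1
      exact absurd (hcon u ⟨hu.1.le, hu.2.le⟩) (not_le.2 h1)
    -- Any interior time would do, since the exponential is invertible.
    have h1 := exp_mulVec_mem_unobservable isOpen_Ioo h0 (u := h / 2) ⟨by linarith, by linarith⟩
    rw [hAB, Submodule.mem_bot] at h1
    have h2 : Function.Injective (NormedSpace.exp ((h / 2) • Aᵀ)).mulVec :=
      mulVec_injective_iff_isUnit.2 (Matrix.isUnit_exp _)
    exact hx (h2 (by simpa using h1))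

theorem norm_toComplex (A : Matrix α β ℝ) : ‖toComplex A‖ = ‖A‖ := by
  simp [linfty_opNorm_def, toComplex]

theorem toComplex_pow (A : Matrix α α ℝ) (k : ℕ) : toComplex (A ^ k) = toComplex A ^ k :=
  map_pow (Complex.ofRealHom.mapMatrix : Matrix α α ℝ →+* Matrix α α ℂ) A k

/-- Gelfand's formula for the spectral radius of the complexified matrix. -/
theorem exists_norm_pow_lt_one {A : Matrix α α ℝ}
    (hA : ∀ z ∈ spectrum ℂ (toComplex A), ‖z‖ < 1) : ∃ k : ℕ, 0 < k ∧ ‖A ^ k‖ < 1 := by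
  have hr : spectralRadius ℂ (toComplex A) < 1 := by
    rcases (spectrum ℂ (toComplex A)).eq_empty_or_nonempty with h | h
    · simp [spectralRadius, h]
    · have := spectrum.spectralRadius_lt_of_forall_lt_of_nonempty h (r := 1) fun z hz => by
        exact_mod_cast hA z hz
      simpa using this
  have h1 := spectrum.pow_nnnorm_pow_one_div_tendsto_nhds_spectralRadius (toComplex A)
  obtain ⟨k, hk, hk0⟩ := ((h1.eventually (gt_mem_nhds hr)).and (eventually_gt_atTop 0)).exists
  refine ⟨k, hk0, ?_⟩
  rw [← norm_toComplex, toComplex_pow]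
  by_contra hcon
  push Not at hcon
  refine absurd hk (not_lt.2 ?_)
  have : (1 : ℝ≥0∞) ≤ (‖toComplex A ^ k‖₊ : ℝ≥0∞) := by exact_mod_cast hcon
  exact ENNReal.one_le_rpow this (by positivity)

/-- Spectral mapping: A preserves each eigenspace of e^{hA}, so it has an eigenvector there, with
some eigenvalue z, and μ = e^{hz}. -/
theorem norm_lt_one_of_mem_spectrum_exp {A : Matrix α α ℝ} {h : ℝ} (hh : 0 < h)
    (hA : ∀ z ∈ spectrum ℂ (toComplex A), z.re < 0) :
    ∀ μ ∈ spectrum ℂ (toComplex (NormedSpace.exp (h • A))), ‖μ‖ < 1 := by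
  intro μ hμ
  rw [toComplex_exp] at hμ
  set E := NormedSpace.exp ((h : ℂ) • toComplex A) with hE
  have hμ' : ¬ Function.Injective (algebraMap ℂ (Matrix α α ℂ) μ - E).mulVec := fun hinj =>
    hμ (mulVec_injective_iff_isUnit.1 hinj)
  have hcomm : Commute E (toComplex A) :=
    ((Commute.refl (toComplex A)).smul_left (h : ℂ)).exp_left
  let U : Submodule ℂ (α → ℂ) := LinearMap.ker (algebraMap ℂ (Matrix α α ℂ) μ - E).mulVecLin
  have hU : U ≠ ⊥ := fun h0 => hμ' (LinearMap.ker_eq_bot.1 h0)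
  have hmem : ∀ w, w ∈ U ↔ E *ᵥ w = μ • w := fun w => by
    rw [LinearMap.mem_ker, mulVecLin_apply, sub_mulVec, Algebra.algebraMap_eq_smul_one, smul_mulVec,
      one_mulVec, sub_eq_zero, eq_comm]
  obtain ⟨z, w, hw, hw0, hz⟩ := exists_eigenvector_mem (A := toComplex A) hU fun w hw => by
    rw [hmem] at hw ⊢
    rw [mulVec_mulVec, hcomm.eq, ← mulVec_mulVec, hw, mulVec_smul]
  have h0 : (toComplex A - z • 1) *ᵥ w = 0 := by
    rw [sub_mulVec, hz, smul_mulVec, one_mulVec, sub_self]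
  have h1 := exp_smul_mulVec (t := (h : ℂ)) (A := toComplex A) (z := z) (w := w)
    (by rw [h0, mulVec_zero])
  rw [h0, smul_zero, add_zero, ← hE, (hmem w).1 hw] at h1
  rw [smul_left_injective ℂ hw0 h1, Complex.norm_exp]
  have h2 : ((h : ℂ) * z).re = h * z.re := by simp
  rw [h2, Real.exp_lt_one_iff]
  exact mul_neg_of_pos_of_neg hh (hA z (mem_spectrum_of_mulVec_eq hw0 hz))

end Gramian

/-! ### The Riccati equation of the model -/

namespace Model

variable {Ω : Type*} {s₁ s₂ c p d m : ℕ} {M : Model Ω s₁ s₂ c p d m} [MeasurableSpace Ω]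
  {P : Measure Ω} {ϑ : Param s₁ s₂}

theorem AssumptionA.memLp_two (hA : M.AssumptionA P) [IsFiniteMeasure P] (hϑ : ϑ ∈ M.Theta) :
    MemLp (M.L ϑ.2 1) 2 P := by
  obtain ⟨δ, hδ, h⟩ := hA.levy_moment
  refine (h ϑ hϑ).mono_exponent ?_
  rw [show (2 : ℝ≥0∞) = ENNReal.ofReal 2 by simp]
  exact ENNReal.ofReal_le_ofReal (by linarith)

theorem sigmaL_transpose (η : Fin s₂ → ℝ) : (M.SigmaL P η)ᵀ = M.SigmaL P η := by
  ext i j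
  simp [SigmaL, mul_comm]

theorem AssumptionA.sigmaL_posDef (hA : M.AssumptionA P) [IsFiniteMeasure P] (hϑ : ϑ ∈ M.Theta) :
    (M.SigmaL P ϑ.2).PosDef := by
  have h2 := (hA.memLp_two hϑ).eval
  have hi : ∀ i j, Integrable (fun ω => M.L ϑ.2 1 ω i * M.L ϑ.2 1 ω j) P := fun i j =>
    (h2 i).integrable_mul (h2 j)
  have hp : (M.SigmaL P ϑ.2).PosSemidef := by
    refine posSemidef_real_iff.2 ⟨sigmaL_transpose _, fun x => ?_⟩
    have : x ⬝ᵥ M.SigmaL P ϑ.2 *ᵥ x = ∫ ω, (x ⬝ᵥ M.L ϑ.2 1 ω) ^ 2 ∂P := by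
      have e : ∀ ω, (x ⬝ᵥ M.L ϑ.2 1 ω) ^ 2 =
          ∑ i, ∑ j, x i * ((M.L ϑ.2 1 ω i * M.L ϑ.2 1 ω j) * x j) := fun ω => by
        rw [pow_two, dotProduct, Finset.sum_mul_sum]
        refine Finset.sum_congr rfl fun i _ => Finset.sum_congr rfl fun j _ => by ring
      simp only [e]
      rw [integral_finsetSum]
      · simp only [dotProduct, mulVec, SigmaL, of_apply, Finset.mul_sum]
        refine Finset.sum_congr rfl fun i _ => ?_
        rw [integral_finsetSum]
        · refine Finset.sum_congr rfl fun j _ => ?_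
          rw [integral_const_mul, integral_mul_const]
        · exact fun j _ => ((hi i j).mul_const _).const_mul _
      · exact fun i _ => integrable_finsetSum _ fun j _ => ((hi i j).mul_const _).const_mul _
    rw [this]
    exact integral_nonneg fun ω => sq_nonneg _
  exact hp.posDef_iff_isUnit.2 ((isUnit_iff_isUnit_det _).2 (hA.levy_cov ϑ hϑ))

theorem AssumptionA.zero_notMem_spectrum (hA : M.AssumptionA P) (hϑ : ϑ ∈ M.Theta) :
    (0 : ℂ) ∉ spectrum ℂ (toComplex (M.A2 ϑ.2)) := fun h => by
  simpa using hA.stable ϑ hϑ 0 h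

theorem AssumptionA.controllable (hA : M.AssumptionA P) (hϑ : ϑ ∈ M.Theta) :
    unobservable (M.A ϑ)ᵀ (M.B ϑ)ᵀ = ⊥ := by
  by_contra hU
  obtain ⟨z, v, hv, h1, h2⟩ := exists_unobservable_eigenvector hU
    (fun x hx => mulVec_mem_unobservable hx)
    (fun x hx => by simpa using mem_unobservable.1 hx 0)
  refine hv (eq_zero_of_block_eigenvector (A₂ := (M.A2 ϑ.2)ᵀ) (C₁ := (M.B1 ϑ.2)ᵀ)
    (C₂ := (M.B2 ϑ.2)ᵀ) (z := z) ?_ ?_ ?_ ?_ ?_)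
  · rw [toComplex_transpose, spectrum_transpose]
    exact hA.zero_notMem_spectrum hϑ
  · exact fun z v h1 h2 => (hA.minimal ϑ hϑ).transpose.eq_zero_of_eigenvector h1 h2
  · exact mulVec_injective_of_rank_eq (by simp [rank_transpose, hA.rank_B1 ϑ hϑ])
  · simpa [A, fromBlocks_transpose] using h1
  · simpa [B, transpose_fromRows] using h2

theorem AssumptionA.sigmaH_posDef (hA : M.AssumptionA P) [IsFiniteMeasure P] (hϑ : ϑ ∈ M.Theta) :
    (M.SigmaH P ϑ).PosDef :=
  posDef_gramian hA.h_pos (hA.sigmaL_posDef hϑ) (hA.controllable hϑ)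

theorem AssumptionA.injective_C_transpose (hA : M.AssumptionA P) (hϑ : ϑ ∈ M.Theta) :
    Function.Injective (M.C ϑ)ᵀ.mulVec :=
  mulVec_injective_of_rank_eq (by simp [rank_transpose, hA.rank_C ϑ hϑ])

theorem isUnit_det_expAh : IsUnit (M.expAh ϑ).det :=
  (isUnit_iff_isUnit_det _).1 (Matrix.isUnit_exp _)

/-- If U were proper, its orthogonal complement would be nonzero, invariant under e^{Ah} and killed
by C. It would yield an unobservable eigenvector of e^{Ah}, which is one of A by the Kalman-Bertram
criterion, against minimality and the rank of C₁. -/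
theorem AssumptionA.observable (hA : M.AssumptionA P) (hϑ : ϑ ∈ M.Theta)
    (U : Submodule ℝ (Fin c ⊕ Fin p → ℝ)) (h : ∀ x ∈ U, (M.expAh ϑ)ᵀ *ᵥ x ∈ U)
    (hC : ∀ u, (M.C ϑ)ᵀ *ᵥ u ∈ U) : U = ⊤ := by
  by_contra hU
  obtain ⟨f, hf0, hf⟩ := Submodule.exists_le_ker_of_lt_top U (lt_top_iff_ne_top.2 hU)
  let U' : Submodule ℝ (Fin c ⊕ Fin p → ℝ) :=
    { carrier := {w | ∀ x ∈ U, w ⬝ᵥ x = 0}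
      zero_mem' := fun x _ => zero_dotProduct x
      add_mem' := fun ha hb x hx => by rw [add_dotProduct, ha x hx, hb x hx, add_zero]
      smul_mem' := fun r a ha x hx => by rw [smul_dotProduct, ha x hx, smul_zero] }
  have hfw : ∀ x, (fun i => f (Pi.single i 1)) ⬝ᵥ x = f x := fun x => by
    conv_rhs => rw [LinearMap.pi_apply_eq_sum_univ f x]
    rw [dotProduct_comm]
    simp only [dotProduct, smul_eq_mul]
    refine Finset.sum_congr rfl fun i _ => ?_
    congr 2
    ext j
    simp [Pi.single_apply, eq_comm]
  have hU' : U' ≠ ⊥ := (Submodule.ne_bot_iff _).2 ⟨fun i => f (Pi.single i 1), fun x hx => by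
    rw [hfw]; exact hf hx, fun h0 => hf0 (LinearMap.ext fun x => by rw [← hfw, h0]; simp)⟩
  obtain ⟨μ, v, hv, h1, h2⟩ := exists_unobservable_eigenvector (A := M.expAh ϑ) (C := M.C ϑ) hU'
    (fun w hw x hx => by
      rw [dotProduct_comm, dotProduct_mulVec, ← mulVec_transpose, dotProduct_comm]
      exact hw _ (h x hx))
    (fun w hw => by
      -- Orthogonality of w to CᵀCw says that Cw has square norm zero.
      have h3 := hw _ (hC (M.C ϑ *ᵥ w))
      rw [dotProduct_mulVec, ← mulVec_transpose, transpose_transpose] at h3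
      exact dotProduct_self_eq_zero.1 h3)
  rw [expAh, toComplex_exp] at h1
  obtain ⟨z, hz⟩ := exists_mulVec_eq_smul_of_exp hA.h_pos.ne' (hA.kalman_bertram ϑ hϑ) hv h1
  exact hv (eq_zero_of_block_eigenvector (hA.zero_notMem_spectrum hϑ)
    (fun z v h1 h2 => (hA.minimal ϑ hϑ).eq_zero_of_eigenvector h1 h2)
    (mulVec_injective_of_rank_eq (by simp [hA.rank_C1 ϑ hϑ])) hz h2)

theorem AssumptionA.existsUnique_riccati (hA : M.AssumptionA P) [IsFiniteMeasure P]
    (hϑ : ϑ ∈ M.Theta) :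
    ∃! W, IsRiccatiSolution (M.expAh ϑ) (M.C ϑ) (M.SigmaH P ϑ) W := by
  obtain ⟨W, hW⟩ := exists_isRiccatiSolution (hA.injective_C_transpose hϑ) (hA.sigmaH_posDef hϑ)
    isUnit_det_expAh (hA.observable hϑ)
  exact ⟨W, hW, fun W' hW' => hW'.unique (hA.sigmaH_posDef hϑ) hW⟩

theorem isRiccatiSolution_omega (h : ∃ W, IsRiccatiSolution (M.expAh ϑ) (M.C ϑ) (M.SigmaH P ϑ) W) :
    IsRiccatiSolution (M.expAh ϑ) (M.C ϑ) (M.SigmaH P ϑ) (M.Omega P ϑ) := by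
  rw [Omega, riccati, dif_pos h]
  exact h.choose_spec

theorem AssumptionA.isRiccatiSolution_omega (hA : M.AssumptionA P) [IsFiniteMeasure P]
    (hϑ : ϑ ∈ M.Theta) :
    IsRiccatiSolution (M.expAh ϑ) (M.C ϑ) (M.SigmaH P ϑ) (M.Omega P ϑ) :=
  Model.isRiccatiSolution_omega (hA.existsUnique_riccati hϑ).exists

theorem AssumptionA.tendsto_closedLoop_pow (hA : M.AssumptionA P) [IsFiniteMeasure P]
    (hϑ : ϑ ∈ M.Theta) : Tendsto (fun n => M.closedLoop P ϑ ^ n) atTop (𝓝 0) :=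
  (hA.isRiccatiSolution_omega hϑ).tendsto_pow (hA.sigmaH_posDef hϑ)

end Model

end CointSSM

namespace CointSSM

open scoped Matrix.Norms.Operator ContDiff

/-! ### Smoothness of matrix-valued functions and the implicit function theorem -/

section FiniteDimensionalCalculus

variable {E X Y Z : Type*} [NormedAddCommGroup E] [NormedSpace ℝ E] [NormedAddCommGroup X]
  [NormedSpace ℝ X] [NormedAddCommGroup Y] [NormedSpace ℝ Y] [NormedAddCommGroup Z]
  [NormedSpace ℝ Z] {n : ℕ∞ω} {x : E}

theorem ContDiffAt.bilin (b : X →ₗ[ℝ] Y →ₗ[ℝ] Z) (hb : ∀ u v, ‖b u v‖ ≤ 1 * ‖u‖ * ‖v‖) {f : E → X}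
    {g : E → Y} (hf : ContDiffAt ℝ n f x) (hg : ContDiffAt ℝ n g x) :
    ContDiffAt ℝ n (fun y => b (f y) (g y)) x :=
  ((b.mkContinuous₂ 1 hb).contDiff.contDiffAt.comp x hf).clm_apply hg

theorem HasDerivAt.bilin (b : X →ₗ[ℝ] Y →ₗ[ℝ] Z) (hb : ∀ u v, ‖b u v‖ ≤ 1 * ‖u‖ * ‖v‖) {f : ℝ → X}
    {g : ℝ → Y} {f' g'} {t : ℝ} (hf : HasDerivAt f f' t) (hg : HasDerivAt g g' t) :
    HasDerivAt (fun y => b (f y) (g y)) (b f' (g t) + b (f t) g') t := by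
  have h1 : HasDerivAt (fun y => b.mkContinuous₂ 1 hb (f y)) (b.mkContinuous₂ 1 hb f') t :=
    (b.mkContinuous₂ 1 hb).hasFDerivAt.comp_hasDerivAt t hf
  exact h1.clm_apply hg

theorem ContDiffAt.linearMap_comp [FiniteDimensional ℝ X] {f : E → X} (hf : ContDiffAt ℝ n f x)
    (T : X →ₗ[ℝ] Y) : ContDiffAt ℝ n (fun y => T (f y)) x :=
  (LinearMap.toContinuousLinearMap T).contDiff.contDiffAt.comp x hf

theorem HasDerivAt.linearMap_comp [FiniteDimensional ℝ X] {f : ℝ → X} {f'} {t : ℝ}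
    (hf : HasDerivAt f f' t) (T : X →ₗ[ℝ] Y) : HasDerivAt (fun y => T (f y)) (T f') t :=
  (LinearMap.toContinuousLinearMap T).hasFDerivAt.comp_hasDerivAt t hf

theorem eq_of_hasDerivAt_zero {f : ℝ → X} (h : ∀ t, HasDerivAt f 0 t) (s t : ℝ) : f s = f t :=
  is_const_of_deriv_eq_zero (fun t => (h t).differentiableAt) (fun t => (h t).deriv) s t

theorem contDiffAt_comp_fst' {g : E → Y} (hg : ContDiffAt ℝ n g x) (w : X) :
    ContDiffAt ℝ n (fun v : E × X => g v.1) (x, w) :=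
  ContDiffAt.comp (x, w) (by exact hg) contDiffAt_fst

/-- The implicit function theorem, with the partial derivative given by its values. -/
theorem exists_implicitFunction [CompleteSpace E] [FiniteDimensional ℝ X] {f : E × X → X} {w : X}
    (hn : n ≠ 0) (hf : ContDiffAt ℝ n f (x, w)) (D : X → X) (hD : ∀ u, D u = 0 → u = 0)
    (hlim : ∀ u, Tendsto (fun t : ℝ => t⁻¹ • (f (x, w + t • u) - f (x, w))) (𝓝[≠] 0)
      (𝓝 (D u))) :
    ∃ ψ : E → X, ContDiffAt ℝ n ψ x ∧ ψ x = w ∧ (∀ᶠ y in 𝓝 x, f (y, ψ y) = f (x, w)) ∧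
      ∀ᶠ v in 𝓝 (x, w), f v = f (x, w) → ψ v.1 = v.2 := by
  have : CompleteSpace X := FiniteDimensional.complete ℝ X
  have hfd := (hf.differentiableAt hn).hasFDerivAt
  set D' := fderiv ℝ f (x, w) ∘L ContinuousLinearMap.inr ℝ E X with hD'
  have hDu : ∀ u, D' u = D u := by
    intro u
    have hl : HasDerivAt (fun t : ℝ => (x, w + t • u)) ((0 : E), u) 0 := by
      have : HasDerivAt (fun t : ℝ => w + t • u) ((1 : ℝ) • u) 0 :=
        ((hasDerivAt_id (0 : ℝ)).smul_const u).const_add w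
      rw [one_smul] at this
      exact (hasDerivAt_const (0 : ℝ) x).prodMk this
    have h1 : HasDerivAt (fun t : ℝ => f (x, w + t • u)) (D' u) 0 := by
      have h2 : HasFDerivAt f (fderiv ℝ f (x, w)) (x, w + (0 : ℝ) • u) := by
        rw [zero_smul, add_zero]; exact hfd
      exact h2.comp_hasDerivAt (0 : ℝ) hl
    refine tendsto_nhds_unique (hasDerivAt_iff_tendsto_slope.1 h1) ((hlim u).congr fun t => ?_)
    rw [slope_def_module, sub_zero, zero_smul, add_zero]
  have hinj : Function.Injective D' := by
    rw [injective_iff_map_eq_zero]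
    intro u hu
    exact hD u (by rw [← hDu, hu])
  have hinv : D'.IsInvertible := by
    refine ⟨(LinearEquiv.ofInjectiveEndo D'.toLinearMap hinj).toContinuousLinearEquiv, ?_⟩
    ext1 u
    rfl
  exact ⟨hf.implicitFunction hn hinv, hf.contDiffAt_implicitFunction hn hinv,
    hf.implicitFunction_apply_self hn hinv, hf.eventually_apply_implicitFunction hn hinv,
    (hf.eventually_apply_eq_iff_implicitFunction hn hinv).mono fun v hv => hv.1⟩

end FiniteDimensionalCalculus

section MatrixCalculus

variable {α β γ δ : Type*} [Fintype α] [DecidableEq α] [Fintype β] [DecidableEq β] [Fintype γ]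
  [DecidableEq γ] [Fintype δ] [DecidableEq δ]
  {E : Type*} [NormedAddCommGroup E] [NormedSpace ℝ E] {n : ℕ∞ω} {x : E}

/-- Matrix multiplication as a bilinear map. -/
def mulB (α β γ : Type*) [Fintype α] [Fintype β] [Fintype γ] :
    Matrix α β ℝ →ₗ[ℝ] Matrix β γ ℝ →ₗ[ℝ] Matrix α γ ℝ :=
  LinearMap.mk₂ ℝ (fun A B => A * B) (fun _ _ _ => Matrix.add_mul _ _ _)
    (fun _ _ _ => Matrix.smul_mul _ _ _) (fun _ _ _ => Matrix.mul_add _ _ _)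
    (fun _ _ _ => Matrix.mul_smul _ _ _)

theorem norm_mulB_le (A : Matrix α β ℝ) (B : Matrix β γ ℝ) :
    ‖mulB α β γ A B‖ ≤ 1 * ‖A‖ * ‖B‖ := by
  rw [one_mul]; exact linfty_opNorm_mul A B

/-- The product of a matrix and a vector as a bilinear map. -/
def mulVecB (α β : Type*) [Fintype α] [Fintype β] :
    Matrix α β ℝ →ₗ[ℝ] (β → ℝ) →ₗ[ℝ] (α → ℝ) :=
  LinearMap.mk₂ ℝ (fun A v => A *ᵥ v) (fun _ _ _ => add_mulVec _ _ _)
    (fun _ _ _ => smul_mulVec _ _ _) (fun _ _ _ => mulVec_add _ _ _)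
    (fun _ _ _ => mulVec_smul _ _ _)

theorem norm_mulVecB_le (A : Matrix α β ℝ) (v : β → ℝ) :
    ‖mulVecB α β A v‖ ≤ 1 * ‖A‖ * ‖v‖ := by
  rw [one_mul]; exact linfty_opNorm_mulVec A v

theorem ContDiffAt.matrix_mul {f : E → Matrix α β ℝ} {g : E → Matrix β γ ℝ}
    (hf : ContDiffAt ℝ n f x) (hg : ContDiffAt ℝ n g x) : ContDiffAt ℝ n (fun y => f y * g y) x :=
  ContDiffAt.bilin (mulB α β γ) norm_mulB_le hf hg

theorem HasDerivAt.matrix_mul {f : ℝ → Matrix α β ℝ} {g : ℝ → Matrix β γ ℝ} {f' g'} {t : ℝ}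
    (hf : HasDerivAt f f' t) (hg : HasDerivAt g g' t) :
    HasDerivAt (fun y => f y * g y) (f' * g t + f t * g') t :=
  HasDerivAt.bilin (mulB α β γ) norm_mulB_le hf hg

theorem contDiffAt_matrix {f : E → Matrix α β ℝ} :
    ContDiffAt ℝ n f x ↔ ∀ i j, ContDiffAt ℝ n (fun y => f y i j) x := by
  refine ⟨fun h i j => ContDiffAt.linearMap_comp h (Matrix.entryLinearMap ℝ ℝ i j), fun h => ?_⟩
  have e : f = fun y => ∑ i, ∑ j, f y i j • Matrix.single i j (1 : ℝ) := by
    ext1 y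
    conv_lhs => rw [matrix_eq_sum_single (f y)]
    simp [smul_single]
  rw [e]
  exact ContDiffAt.sum fun i _ => ContDiffAt.sum fun j _ => (h i j).smul contDiffAt_const

theorem ContDiffAt.matrix_transpose {f : E → Matrix α β ℝ} (hf : ContDiffAt ℝ n f x) :
    ContDiffAt ℝ n (fun y => (f y)ᵀ) x :=
  contDiffAt_matrix.2 fun i j => contDiffAt_matrix.1 hf j i

theorem ContDiffAt.matrix_inv {f : E → Matrix α α ℝ} (hf : ContDiffAt ℝ n f x)
    (h : IsUnit (f x).det) : ContDiffAt ℝ n (fun y => (f y)⁻¹) x := by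
  simp_rw [Matrix.nonsing_inv_eq_ringInverse]
  obtain ⟨u, hu⟩ := (isUnit_iff_isUnit_det _).2 h
  exact (hu ▸ contDiffAt_ringInverse ℝ u).comp x hf

theorem ContDiffAt.matrix_exp {f : E → Matrix α α ℝ} (hf : ContDiffAt ℝ n f x) :
    ContDiffAt ℝ n (fun y => NormedSpace.exp (f y)) x :=
  (NormedSpace.exp_analytic (𝕂 := ℝ) (f x)).contDiffAt.comp x hf

theorem ContDiffAt.matrix_det {f : E → Matrix α α ℝ} (hf : ContDiffAt ℝ n f x) :
    ContDiffAt ℝ n (fun y => (f y).det) x := by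
  simp_rw [det_apply']
  exact ContDiffAt.sum fun σ _ => contDiffAt_const.mul
    (contDiffAt_prod fun i _ => contDiffAt_matrix.1 hf _ _)

theorem ContDiffAt.fromBlocks {a : E → Matrix α γ ℝ} {b : E → Matrix α δ ℝ} {c : E → Matrix β γ ℝ}
    {d : E → Matrix β δ ℝ} (ha : ContDiffAt ℝ n a x) (hb : ContDiffAt ℝ n b x)
    (hc : ContDiffAt ℝ n c x) (hd : ContDiffAt ℝ n d x) :
    ContDiffAt ℝ n (fun y => Matrix.fromBlocks (a y) (b y) (c y) (d y)) x := by
  refine contDiffAt_matrix.2 ?_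
  rintro (i | i) (j | j)
  · exact contDiffAt_matrix.1 ha i j
  · exact contDiffAt_matrix.1 hb i j
  · exact contDiffAt_matrix.1 hc i j
  · exact contDiffAt_matrix.1 hd i j

theorem exp_smul_neg_mul_exp_smul (A : Matrix α α ℝ) (t : ℝ) :
    NormedSpace.exp (t • (-A)) * NormedSpace.exp (t • A) = 1 := by
  have h : t • (-A) + t • A = 0 := by ext i j; simp
  rw [← Matrix.exp_add_of_commute _ _ (((Commute.refl A).neg_left.smul_left t).smul_right t), h]
  exact NormedSpace.exp_zero

/-- Van Loan's formula: the controllability Gramian is a function of a matrix exponential. -/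
theorem gramian_eq_exp (A Q : Matrix α α ℝ) (h : ℝ) :
    (Matrix.of fun i j => ∫ u in (0 : ℝ)..h,
      (NormedSpace.exp (u • A) * Q * NormedSpace.exp (u • Aᵀ)) i j) =
      (NormedSpace.exp (h • Matrix.fromBlocks A Q 0 (-Aᵀ))).toBlocks₁₂ *
        NormedSpace.exp (h • Aᵀ) := by
  set N := Matrix.fromBlocks A Q 0 (-Aᵀ) with hN
  set X : ℝ → Matrix (α ⊕ α) (α ⊕ α) ℝ := fun t => NormedSpace.exp (t • N) with hX
  have hd : ∀ t, HasDerivAt X (X t * N) t := fun t => hasDerivAt_exp_smul_const N t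
  let T₁ : Matrix (α ⊕ α) (α ⊕ α) ℝ →ₗ[ℝ] Matrix α α ℝ :=
    { toFun := toBlocks₁₁, map_add' := fun _ _ => rfl, map_smul' := fun _ _ => rfl }
  let T₂ : Matrix (α ⊕ α) (α ⊕ α) ℝ →ₗ[ℝ] Matrix α α ℝ :=
    { toFun := toBlocks₁₂, map_add' := fun _ _ => rfl, map_smul' := fun _ _ => rfl }
  have hprod : ∀ t, X t * N = Matrix.fromBlocks ((X t).toBlocks₁₁ * A)
      ((X t).toBlocks₁₁ * Q + (X t).toBlocks₁₂ * (-Aᵀ)) ((X t).toBlocks₂₁ * A)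
      ((X t).toBlocks₂₁ * Q + (X t).toBlocks₂₂ * (-Aᵀ)) := fun t => by
    conv_lhs => rw [← fromBlocks_toBlocks (X t), hN, fromBlocks_multiply]
    simp
  have hd₁ : ∀ t, HasDerivAt (fun t => (X t).toBlocks₁₁) ((X t).toBlocks₁₁ * A) t := fun t => by
    have := HasDerivAt.linearMap_comp (hd t) T₁
    rw [hprod] at this
    exact this
  have hd₂ : ∀ t, HasDerivAt (fun t => (X t).toBlocks₁₂)
      ((X t).toBlocks₁₁ * Q + (X t).toBlocks₁₂ * (-Aᵀ)) t := fun t => by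
    have := HasDerivAt.linearMap_comp (hd t) T₂
    rw [hprod] at this
    exact this
  have hX0 : X 0 = 1 := by simp [hX, NormedSpace.exp_zero]
  have h11 : ∀ t, (X t).toBlocks₁₁ = NormedSpace.exp (t • A) := by
    have hc : ∀ t, HasDerivAt (fun t : ℝ => (X t).toBlocks₁₁ * NormedSpace.exp (t • (-A))) 0 t := by
      intro t
      have h1 : HasDerivAt (fun u : ℝ => NormedSpace.exp (u • (-A)))
        ((-A) * NormedSpace.exp (t • (-A))) t := hasDerivAt_exp_smul_const' (-A) t
      have h2 := HasDerivAt.matrix_mul (hd₁ t) h1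
      rwa [Matrix.neg_mul, Matrix.mul_neg, Matrix.mul_assoc, add_neg_cancel] at h2
    intro t
    have h2 := eq_of_hasDerivAt_zero hc t 0
    simp only [hX0, zero_smul, NormedSpace.exp_zero, Matrix.mul_one] at h2
    have h3 := exp_smul_neg_mul_exp_smul A t
    have h4 := congrArg (· * NormedSpace.exp (t • A)) h2
    simp only [Matrix.mul_assoc, h3, Matrix.mul_one] at h4
    rw [h4]
    have : toBlocks₁₁ (1 : Matrix (α ⊕ α) (α ⊕ α) ℝ) = 1 := by
      rw [← fromBlocks_one, toBlocks_fromBlocks₁₁]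
    rw [this, Matrix.one_mul]
  -- The factor e^{tAᵀ} cancels the -Aᵀ term in the derivative of the upper right block, leaving
  -- exactly the integrand.
  have hZ : ∀ t, HasDerivAt (fun t : ℝ => (X t).toBlocks₁₂ * NormedSpace.exp (t • Aᵀ))
      (NormedSpace.exp (t • A) * Q * NormedSpace.exp (t • Aᵀ)) t := fun t => by
    have h1 : HasDerivAt (fun u : ℝ => NormedSpace.exp (u • Aᵀ))
      (Aᵀ * NormedSpace.exp (t • Aᵀ)) t := hasDerivAt_exp_smul_const' Aᵀ t
    convert HasDerivAt.matrix_mul (hd₂ t) h1 using 1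
    rw [h11, Matrix.mul_neg, Matrix.add_mul, Matrix.neg_mul, Matrix.mul_assoc _ Aᵀ]
    abel
  ext i j
  have h1 : ∀ t, HasDerivAt (fun t : ℝ => ((X t).toBlocks₁₂ * NormedSpace.exp (t • Aᵀ)) i j)
      ((NormedSpace.exp (t • A) * Q * NormedSpace.exp (t • Aᵀ)) i j) t := fun t =>
    HasDerivAt.linearMap_comp (hZ t) (Matrix.entryLinearMap ℝ ℝ i j)
  have hcont : Continuous fun t : ℝ =>
      (NormedSpace.exp (t • A) * Q * NormedSpace.exp (t • Aᵀ)) i j := by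
    have h1 := continuous_exp_smul A
    have h2 := continuous_exp_smul Aᵀ
    have h3 : Continuous fun t : ℝ => NormedSpace.exp (t • A) * Q * NormedSpace.exp (t • Aᵀ) := by
      fun_prop
    exact h3.matrix_elem i j
  rw [of_apply, intervalIntegral.integral_eq_sub_of_hasDerivAt (fun t _ => h1 t)
    (hcont.intervalIntegrable _ _)]
  have : (X 0).toBlocks₁₂ = 0 := by
    rw [hX0, ← fromBlocks_one, toBlocks_fromBlocks₁₂]
  simp only [this, Matrix.zero_mul, Matrix.zero_apply, sub_zero]
  rfl

end MatrixCalculus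

/-! ### Smooth dependence of the Riccati solution on its coefficients -/

section RiccatiSmooth

variable {ι κ : Type*} [Fintype ι] [DecidableEq ι] [Fintype κ] [DecidableEq κ]
  {E : Type*} [NormedAddCommGroup E] [NormedSpace ℝ E] [CompleteSpace E] {n : ℕ∞ω} {x : E}

theorem riccatiMap_transpose {F S W : Matrix ι ι ℝ} {C : Matrix κ ι ℝ} (hS : Sᵀ = S) :
    riccatiMap F C S Wᵀ = (riccatiMap F C S W)ᵀ := by
  simp only [riccatiMap, transpose_add, transpose_sub, transpose_mul, transpose_transpose, hS,
    transpose_nonsing_inv, Matrix.mul_assoc]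

/-- An exact difference formula from crossed gains. It yields the derivative of the Riccati operator
from mere continuity of the gain. -/
theorem riccatiMap_sub_riccatiMap {F S W W' : Matrix ι ι ℝ} {C : Matrix κ ι ℝ}
    (hW : Wᵀ = W) (hS : Sᵀ = S)
    (hV : IsUnit (C * W * Cᵀ).det) (hV' : IsUnit (C * W' * Cᵀ).det) :
    riccatiMap F C S W' - riccatiMap F C S W =
      (F - gain F C W' * C) * (W' - W) * (F - gain F C W * C)ᵀ := by
  have e₁ := closedLoop_mul_mul_transpose (F := F) (S := S) hV' (gain F C W)
  have e₂ := closedLoop_mul_mul_transpose (F := F) (S := S) hV (gain F C W')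
  have e₃ := congrArg transpose e₂
  rw [transpose_mul, transpose_transpose, transpose_mul, transpose_sub (riccatiMap F C S W), hW,
    isSymm_riccatiMap hW hS, hS, ← Matrix.mul_assoc] at e₃
  rw [Matrix.mul_sub, Matrix.sub_mul, e₁, e₃]
  abel

theorem ContDiffAt.gain {F W : E → Matrix ι ι ℝ} {C : E → Matrix κ ι ℝ} (hF : ContDiffAt ℝ n F x)
    (hC : ContDiffAt ℝ n C x) (hW : ContDiffAt ℝ n W x)
    (hV : IsUnit (C x * W x * (C x)ᵀ).det) :
    ContDiffAt ℝ n (fun y => CointSSM.gain (F y) (C y) (W y)) x :=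
  ContDiffAt.matrix_mul
    (ContDiffAt.matrix_mul (ContDiffAt.matrix_mul hF hW) (ContDiffAt.matrix_transpose hC))
    (ContDiffAt.matrix_inv (ContDiffAt.matrix_mul (ContDiffAt.matrix_mul hC hW)
      (ContDiffAt.matrix_transpose hC)) hV)

theorem ContDiffAt.riccatiMap {F S W : E → Matrix ι ι ℝ} {C : E → Matrix κ ι ℝ}
    (hF : ContDiffAt ℝ n F x) (hC : ContDiffAt ℝ n C x) (hS : ContDiffAt ℝ n S x)
    (hW : ContDiffAt ℝ n W x) (hV : IsUnit (C x * W x * (C x)ᵀ).det) :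
    ContDiffAt ℝ n (fun y => CointSSM.riccatiMap (F y) (C y) (S y) (W y)) x := by
  have h1 := ContDiffAt.gain hF hC hW hV
  have h2 := ContDiffAt.matrix_transpose hF
  exact ((ContDiffAt.matrix_mul (ContDiffAt.matrix_mul hF hW) h2).sub (ContDiffAt.matrix_mul
    (ContDiffAt.matrix_mul (ContDiffAt.matrix_mul h1 hC) hW) h2)).add hS

/-- The solution of the Riccati equation depends smoothly on the coefficients. -/
theorem exists_contDiffAt_isRiccatiSolution {F S : E → Matrix ι ι ℝ} {C : E → Matrix κ ι ℝ}
    {W : Matrix ι ι ℝ} (hn : n ≠ 0) (hF : ContDiffAt ℝ n F x) (hC : ContDiffAt ℝ n C x)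
    (hS : ContDiffAt ℝ n S x) (hSs : ∀ y, (S y)ᵀ = S y) (hSp : (S x).PosDef)
    (hW : IsRiccatiSolution (F x) (C x) (S x) W) :
    ∃ ψ : E → Matrix ι ι ℝ, ContDiffAt ℝ n ψ x ∧ ψ x = W ∧
      ∀ᶠ y in 𝓝 x, IsRiccatiSolution (F y) (C y) (S y) (ψ y) := by
  have hWp : W.PosDef := hW.posDef hSp
  have hWs : Wᵀ = W := PosDef.transpose_eq hWp
  let f : E × Matrix ι ι ℝ → Matrix ι ι ℝ := fun v =>
    v.2 - CointSSM.riccatiMap (F v.1) (C v.1) (S v.1) v.2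
  have hf : ContDiffAt ℝ n f (x, W) :=
    contDiffAt_snd.sub (ContDiffAt.riccatiMap (contDiffAt_comp_fst' hF W) (contDiffAt_comp_fst' hC W)
      (contDiffAt_comp_fst' hS W) contDiffAt_snd hW.2.1)
  have hfx : f (x, W) = 0 := sub_eq_zero.2 hW.2.2
  set Φ := F x - CointSSM.gain (F x) (C x) W * C x with hΦ
  -- For t ≠ 0 close to 0 the quotient equals H - Φ_t H Φᵀ, with Φ_t the closed loop at W + tH.
  have hlim : ∀ H, Tendsto (fun t : ℝ => t⁻¹ • (f (x, W + t • H) - f (x, W))) (𝓝[≠] 0)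
      (𝓝 (H - Φ * H * Φᵀ)) := by
    intro H
    have hct : Tendsto (fun t : ℝ => W + t • H) (𝓝 0) (𝓝 W) := by
      have : Continuous fun t : ℝ => W + t • H := by fun_prop
      simpa using this.tendsto 0
    have hVc : ContinuousAt (fun X : Matrix ι ι ℝ => (C x * X * (C x)ᵀ).det) W := by fun_prop
    have hne : ∀ᶠ t : ℝ in 𝓝 0, IsUnit (C x * (W + t • H) * (C x)ᵀ).det :=
      (hct.eventually (hVc.eventually_ne hW.2.1.ne_zero)).mono fun t ht => isUnit_iff_ne_zero.2 ht
    have hgc : ContinuousAt (fun X : Matrix ι ι ℝ => CointSSM.gain (F x) (C x) X) W :=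
      (ContDiffAt.gain (n := 0) contDiffAt_const contDiffAt_const contDiffAt_id
        hW.2.1).continuousAt
    have h3 : Tendsto (fun t : ℝ => H - (F x - CointSSM.gain (F x) (C x) (W + t • H) * C x) * H * Φᵀ)
        (𝓝[≠] 0) (𝓝 (H - Φ * H * Φᵀ)) := by
      have h4 := (hgc.tendsto.comp hct)
      have h5 : Continuous fun G : Matrix ι κ ℝ => H - (F x - G * C x) * H * Φᵀ := by fun_prop
      exact ((h5.tendsto _).comp h4).mono_left nhdsWithin_le_nhds
    refine h3.congr' ?_
    filter_upwards [nhdsWithin_le_nhds hne, self_mem_nhdsWithin] with t ht ht0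
    have ht0' : t ≠ 0 := ht0
    have h6 := riccatiMap_sub_riccatiMap (F := F x) hWs (hSs x) hW.2.1 ht
    rw [add_sub_cancel_left, ← hΦ] at h6
    have h7 : f (x, W + t • H) - f (x, W) =
        t • (H - (F x - CointSSM.gain (F x) (C x) (W + t • H) * C x) * H * Φᵀ) := by
      simp only [f]
      rw [show ∀ a b c d : Matrix ι ι ℝ, a - b - (c - d) = (a - c) - (b - d) from
        fun a b c d => by abel, h6, smul_sub, add_sub_cancel_left, Matrix.mul_smul, Matrix.smul_mul]
    rw [h7, smul_smul, inv_mul_cancel₀ ht0', one_smul]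
  have hinj : ∀ H, H - Φ * H * Φᵀ = 0 → H = 0 := fun H hH =>
    eq_zero_of_eq_mul_mul (hW.tendsto_pow hSp) (tendsto_transpose_pow (hW.tendsto_pow hSp))
      (sub_eq_zero.1 hH)
  obtain ⟨ψ, hψ, hψx, hψ0, hψu⟩ := exists_implicitFunction hn hf _ hinj hlim
  rw [hfx] at hψ0 hψu
  -- The implicit function takes values in all matrices. Its transpose solves the same equation, so
  -- local uniqueness gives symmetry.
  have hψs : ∀ᶠ y in 𝓝 x, (ψ y)ᵀ = ψ y := by
    have h2 : Tendsto (fun y => (y, (ψ y)ᵀ)) (𝓝 x) (𝓝 (x, W)) := by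
      have h3 : Continuous fun X : Matrix ι ι ℝ => Xᵀ := continuous_id.matrix_transpose
      have h4 : Tendsto (fun y => (ψ y)ᵀ) (𝓝 x) (𝓝 (ψ x)ᵀ) :=
        (h3.tendsto _).comp hψ.continuousAt.tendsto
      rw [hψx, hWs] at h4
      exact tendsto_id.prodMk_nhds h4
    filter_upwards [h2.eventually hψu, hψ0] with y hy hy0
    refine (hy ?_).symm
    have h5 := congrArg transpose hy0
    simp only [f, transpose_sub, transpose_zero] at h5 ⊢
    rwa [riccatiMap_transpose (hSs y)]
  have hψp := eventually_posDef hψ.continuousAt hψs (by rw [hψx]; exact hWp)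
  have hVy : ∀ᶠ y in 𝓝 x, IsUnit (C y * ψ y * (C y)ᵀ).det := by
    have h1 : ContinuousAt (fun y => (C y * ψ y * (C y)ᵀ).det) x :=
      (ContDiffAt.matrix_det (ContDiffAt.matrix_mul (ContDiffAt.matrix_mul hC hψ)
        (ContDiffAt.matrix_transpose hC))).continuousAt
    refine (h1.eventually_ne ?_).mono fun y hy => isUnit_iff_ne_zero.2 hy
    rw [hψx]
    exact hW.2.1.ne_zero
  refine ⟨ψ, hψ, hψx, ?_⟩
  filter_upwards [hψp, hVy, hψ0] with y h1 h2 h3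
  exact ⟨h1.posSemidef, h2, sub_eq_zero.1 h3⟩

end RiccatiSmooth

/-! ### Smoothness of the filter matrices in the parameter -/

namespace Model

variable {Ω : Type*} {s₁ s₂ c p d m : ℕ} {M : Model Ω s₁ s₂ c p d m} [MeasurableSpace Ω]
  {P : Measure Ω} {ϑ : Param s₁ s₂}

theorem contDiffAt_comp_snd {F : Type*} [NormedAddCommGroup F] [NormedSpace ℝ F] {n : ℕ∞ω}
    {g : (Fin s₂ → ℝ) → F} (hg : ContDiffAt ℝ n g ϑ.2) :
    ContDiffAt ℝ n (fun y : Param s₁ s₂ => g y.2) ϑ :=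
  ContDiffAt.comp ϑ hg contDiffAt_snd

theorem contDiffAt_comp_fst {F : Type*} [NormedAddCommGroup F] [NormedSpace ℝ F] {n : ℕ∞ω}
    {g : (Fin s₁ → ℝ) → F} (hg : ContDiffAt ℝ n g ϑ.1) :
    ContDiffAt ℝ n (fun y : Param s₁ s₂ => g y.1) ϑ :=
  ContDiffAt.comp ϑ hg contDiffAt_fst

theorem AssumptionA.contDiffAt_A (hA : M.AssumptionA P) (hϑ : ϑ ∈ M.Theta) :
    ContDiffAt ℝ 3 M.A ϑ :=
  ContDiffAt.fromBlocks contDiffAt_const contDiffAt_const contDiffAt_const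
    (contDiffAt_comp_snd (contDiffAt_matrix.2 (hA.smooth_A2 ϑ hϑ)))

theorem AssumptionA.contDiffAt_B (hA : M.AssumptionA P) (hϑ : ϑ ∈ M.Theta) :
    ContDiffAt ℝ 3 M.B ϑ := by
  refine contDiffAt_matrix.2 ?_
  rintro (i | i) j
  · exact contDiffAt_comp_snd (hA.smooth_B1 ϑ hϑ i j)
  · exact contDiffAt_comp_snd (hA.smooth_B2 ϑ hϑ i j)

theorem AssumptionA.contDiffAt_C (hA : M.AssumptionA P) (hϑ : ϑ ∈ M.Theta) :
    ContDiffAt ℝ 3 M.C ϑ := by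
  refine contDiffAt_matrix.2 ?_
  rintro i (j | j)
  · exact contDiffAt_comp_fst (hA.smooth_C1 ϑ hϑ i j)
  · exact contDiffAt_comp_snd (hA.smooth_C2 ϑ hϑ i j)

theorem AssumptionA.contDiffAt_expAh (hA : M.AssumptionA P) (hϑ : ϑ ∈ M.Theta) :
    ContDiffAt ℝ 3 M.expAh ϑ :=
  ContDiffAt.matrix_exp ((hA.contDiffAt_A hϑ).const_smul M.h)

/-- Expresses the integral through matrix exponentials, so that smoothness needs no differentiation
under the integral. -/
theorem sigmaH_eq (η : Param s₁ s₂) : M.SigmaH P η =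
    (NormedSpace.exp (M.h • Matrix.fromBlocks (M.A η) (M.B η * M.SigmaL P η.2 * (M.B η)ᵀ) 0
      (-(M.A η)ᵀ))).toBlocks₁₂ * NormedSpace.exp (M.h • (M.A η)ᵀ) := by
  rw [← gramian_eq_exp]
  simp only [SigmaH, Matrix.mul_assoc]

theorem sigmaH_transpose (η : Param s₁ s₂) : (M.SigmaH P η)ᵀ = M.SigmaH P η := by
  ext i j
  simp only [SigmaH, transpose_apply, of_apply]
  refine intervalIntegral.integral_congr fun u _ => ?_
  have h : (NormedSpace.exp (u • M.A η) * M.B η * M.SigmaL P η.2 * (M.B η)ᵀ *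
      NormedSpace.exp (u • (M.A η)ᵀ))ᵀ = NormedSpace.exp (u • M.A η) * M.B η * M.SigmaL P η.2 *
      (M.B η)ᵀ * NormedSpace.exp (u • (M.A η)ᵀ) := by
    rw [← transpose_smul, Matrix.exp_transpose]
    simp only [transpose_mul, transpose_transpose, sigmaL_transpose, Matrix.mul_assoc]
  exact congrFun (congrFun h i) j

theorem AssumptionA.contDiffAt_sigmaH (hA : M.AssumptionA P) (hϑ : ϑ ∈ M.Theta) :
    ContDiffAt ℝ 3 (M.SigmaH P) ϑ := by
  rw [show M.SigmaH P = _ from funext sigmaH_eq]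
  have h1 := hA.contDiffAt_A hϑ
  have h2 := hA.contDiffAt_B hϑ
  have h3 : ContDiffAt ℝ 3 (fun y : Param s₁ s₂ => M.SigmaL P y.2) ϑ :=
    contDiffAt_comp_snd (contDiffAt_matrix.2 (hA.smooth_SigmaL ϑ hϑ))
  have h4 := ContDiffAt.matrix_transpose h1
  have h5 := ContDiffAt.matrix_exp ((ContDiffAt.fromBlocks h1
    (ContDiffAt.matrix_mul (ContDiffAt.matrix_mul h2 h3) (ContDiffAt.matrix_transpose h2))
    (contDiffAt_const (c := (0 : Matrix (Fin c ⊕ Fin p) (Fin c ⊕ Fin p) ℝ))) h4.neg).const_smul M.h)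
  refine ContDiffAt.matrix_mul ?_ (ContDiffAt.matrix_exp (h4.const_smul M.h))
  exact contDiffAt_matrix.2 fun i j => contDiffAt_matrix.1 h5 (Sum.inl i) (Sum.inr j)

/-- Near ϑ, also outside Θ, the noise covariance stays positive definite. The Riccati solution is
then unique, so the chosen one agrees with the smooth local branch. -/
theorem AssumptionA.contDiffAt_omega (hA : M.AssumptionA P) [IsFiniteMeasure P]
    (hϑ : ϑ ∈ M.Theta) : ContDiffAt ℝ 3 (M.Omega P) ϑ := by
  obtain ⟨ψ, h1, h2, h3⟩ := exists_contDiffAt_isRiccatiSolution (by norm_num)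
    (hA.contDiffAt_expAh hϑ) (hA.contDiffAt_C hϑ) (hA.contDiffAt_sigmaH hϑ)
    sigmaH_transpose (hA.sigmaH_posDef hϑ) (hA.isRiccatiSolution_omega hϑ)
  refine h1.congr_of_eventuallyEq ?_
  have h4 := eventually_posDef (hA.contDiffAt_sigmaH hϑ).continuousAt
    (Eventually.of_forall sigmaH_transpose) (hA.sigmaH_posDef hϑ)
  filter_upwards [h3, h4] with y h5 h6
  exact (Model.isRiccatiSolution_omega ⟨_, h5⟩).unique h6 h5

theorem AssumptionA.posDef_V (hA : M.AssumptionA P) [IsFiniteMeasure P] (hϑ : ϑ ∈ M.Theta) :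
    (M.V P ϑ).PosDef :=
  posDef_mul_mul_transpose (hA.injective_C_transpose hϑ)
    ((hA.isRiccatiSolution_omega hϑ).posDef (hA.sigmaH_posDef hϑ))

theorem AssumptionA.contDiffAt_V (hA : M.AssumptionA P) [IsFiniteMeasure P] (hϑ : ϑ ∈ M.Theta) :
    ContDiffAt ℝ 3 (M.V P) ϑ :=
  ContDiffAt.matrix_mul (ContDiffAt.matrix_mul (hA.contDiffAt_C hϑ) (hA.contDiffAt_omega hϑ))
    (ContDiffAt.matrix_transpose (hA.contDiffAt_C hϑ))

theorem AssumptionA.contDiffAt_V_inv (hA : M.AssumptionA P) [IsFiniteMeasure P]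
    (hϑ : ϑ ∈ M.Theta) : ContDiffAt ℝ 3 (fun η => (M.V P η)⁻¹) ϑ :=
  ContDiffAt.matrix_inv (hA.contDiffAt_V hϑ) (PosDef.isUnit_det (hA.posDef_V hϑ))

theorem AssumptionA.contDiffAt_K (hA : M.AssumptionA P) [IsFiniteMeasure P] (hϑ : ϑ ∈ M.Theta) :
    ContDiffAt ℝ 3 (M.K P) ϑ :=
  ContDiffAt.matrix_mul (ContDiffAt.matrix_mul (ContDiffAt.matrix_mul (hA.contDiffAt_expAh hϑ)
    (hA.contDiffAt_omega hϑ)) (ContDiffAt.matrix_transpose (hA.contDiffAt_C hϑ)))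
    (hA.contDiffAt_V_inv hϑ)

theorem AssumptionA.contDiffAt_closedLoop (hA : M.AssumptionA P) [IsFiniteMeasure P]
    (hϑ : ϑ ∈ M.Theta) : ContDiffAt ℝ 3 (M.closedLoop P) ϑ :=
  (hA.contDiffAt_expAh hϑ).sub (ContDiffAt.matrix_mul (hA.contDiffAt_K hϑ) (hA.contDiffAt_C hϑ))

theorem AssumptionA.contDiffAt_log_det_V (hA : M.AssumptionA P) [IsFiniteMeasure P]
    (hϑ : ϑ ∈ M.Theta) : ContDiffAt ℝ 3 (fun η => Real.log (M.V P η).det) ϑ :=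
  (ContDiffAt.matrix_det (hA.contDiffAt_V hϑ)).log
    (PosDef.isUnit_det (hA.posDef_V hϑ)).ne_zero

end Model

end CointSSM

namespace CointSSM

open scoped Matrix.Norms.Operator ContDiff

/-! ### Weighted second order jets and geometric decay -/

section Jet

variable {E X Y Z : Type*} [NormedAddCommGroup E] [NormedSpace ℝ E] [NormedAddCommGroup X]
  [NormedSpace ℝ X] [NormedAddCommGroup Y] [NormedSpace ℝ Y] [NormedAddCommGroup Z]
  [NormedSpace ℝ Z] {η : ℝ} {x : E}

/-- The weighted norm `‖f‖ + η ‖Df‖ + η² ‖D²f‖ / 2` of the second order jet of `f` at `x`. It is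
submultiplicative. -/
noncomputable def jet (η : ℝ) (f : E → X) (x : E) : ℝ :=
  ‖f x‖ + η * ‖fderiv ℝ f x‖ + η ^ 2 / 2 * ‖fderiv ℝ (fderiv ℝ f) x‖

theorem jet_nonneg (hη : 0 ≤ η) (f : E → X) (x : E) : 0 ≤ jet η f x := by
  unfold jet; positivity

theorem norm_le_jet (hη : 0 ≤ η) (f : E → X) (x : E) : ‖f x‖ ≤ jet η f x := by
  have h1 : 0 ≤ η * ‖fderiv ℝ f x‖ := by positivity
  have h2 : 0 ≤ η ^ 2 / 2 * ‖fderiv ℝ (fderiv ℝ f) x‖ := by positivity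
  unfold jet; linarith

theorem norm_fderiv_le_jet (hη : 0 ≤ η) (f : E → X) (x : E) : η * ‖fderiv ℝ f x‖ ≤ jet η f x := by
  have h2 : 0 ≤ η ^ 2 / 2 * ‖fderiv ℝ (fderiv ℝ f) x‖ := by positivity
  have h1 := norm_nonneg (f x)
  unfold jet; linarith

theorem norm_fderiv_fderiv_le_jet (hη : 0 ≤ η) (f : E → X) (x : E) :
    η ^ 2 / 2 * ‖fderiv ℝ (fderiv ℝ f) x‖ ≤ jet η f x := by
  have h1 : 0 ≤ η * ‖fderiv ℝ f x‖ := by positivity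
  have h2 := norm_nonneg (f x)
  unfold jet; linarith

theorem jet_const (η : ℝ) (v : X) (x : E) : jet η (fun _ : E => v) x = ‖v‖ := by
  have h : fderiv ℝ (fun _ : E => v) = fun _ => 0 := by ext1 y; simp
  rw [jet, h]
  have h0 : ‖fderiv ℝ (fun _ : E => (0 : E →L[ℝ] X)) x‖ = 0 := by
    rw [(hasFDerivAt_const (0 : E →L[ℝ] X) x).fderiv]; exact norm_zero (E := E →L[ℝ] E →L[ℝ] X)
  rw [h0]
  simp

theorem jet_congr {f g : E → X} (h : f =ᶠ[𝓝 x] g) : jet η f x = jet η g x := by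
  simp only [jet, h.eq_of_nhds, h.fderiv_eq, h.fderiv.fderiv_eq]

theorem jet_neg (f : E → X) : jet η (fun y => -f y) x = jet η f x := by
  have h : fderiv ℝ (fun y => -f y) = fun y => -fderiv ℝ f y := by ext1 y; simp
  have h2 : ‖fderiv ℝ (fun y => -fderiv ℝ f y) x‖ = ‖fderiv ℝ (fderiv ℝ f) x‖ := by
    rw [fderiv_fun_neg]; exact norm_neg (fderiv ℝ (fderiv ℝ f) x)
  rw [jet, h, h2, norm_neg, norm_neg, jet]

theorem eventually_differentiableAt {f : E → X} (hf : ContDiffAt ℝ 2 f x) :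
    ∀ᶠ y in 𝓝 x, DifferentiableAt ℝ f y :=
  (hf.eventually (by decide)).mono fun _ hy => hy.differentiableAt (by norm_num)

theorem differentiableAt_fderiv {f : E → X} (hf : ContDiffAt ℝ 2 f x) :
    DifferentiableAt ℝ (fderiv ℝ f) x :=
  (hf.fderiv_right (m := 1) (by norm_num)).differentiableAt (by norm_num)

theorem jet_add_le (hη : 0 ≤ η) {f g : E → X} (hf : ContDiffAt ℝ 2 f x) (hg : ContDiffAt ℝ 2 g x) :
    jet η (fun y => f y + g y) x ≤ jet η f x + jet η g x := by
  have h1 : fderiv ℝ (fun y => f y + g y) =ᶠ[𝓝 x] fun y => fderiv ℝ f y + fderiv ℝ g y := by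
    filter_upwards [eventually_differentiableAt hf, eventually_differentiableAt hg] with y h1 h2
    exact fderiv_fun_add h1 h2
  have h2 : fderiv ℝ (fderiv ℝ (fun y => f y + g y)) x =
      fderiv ℝ (fderiv ℝ f) x + fderiv ℝ (fderiv ℝ g) x := by
    rw [h1.fderiv_eq]
    exact fderiv_fun_add (differentiableAt_fderiv hf) (differentiableAt_fderiv hg)
  rw [jet, h2, h1.eq_of_nhds]
  have i1 := norm_add_le (f x) (g x)
  have i2 := mul_le_mul_of_nonneg_left (norm_add_le (fderiv ℝ f x) (fderiv ℝ g x)) hη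
  have i3 := mul_le_mul_of_nonneg_left (norm_add_le (fderiv ℝ (fderiv ℝ f) x)
    (fderiv ℝ (fderiv ℝ g) x)) (by positivity : 0 ≤ η ^ 2 / 2)
  unfold jet
  linarith

theorem jet_sub_le (hη : 0 ≤ η) {f g : E → X} (hf : ContDiffAt ℝ 2 f x) (hg : ContDiffAt ℝ 2 g x) :
    jet η (fun y => f y - g y) x ≤ jet η f x + jet η g x := by
  simp_rw [sub_eq_add_neg]
  refine (jet_add_le hη hf hg.neg).trans ?_
  rw [jet_neg]

theorem jet_sum_le (hη : 0 ≤ η) {ι : Type*} (s : Finset ι) {f : ι → E → X}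
    (hf : ∀ i ∈ s, ContDiffAt ℝ 2 (f i) x) :
    jet η (fun y => ∑ i ∈ s, f i y) x ≤ ∑ i ∈ s, jet η (f i) x := by
  classical
  induction s using Finset.induction_on with
  | empty => simp [jet_const]
  | insert a s ha ih =>
    simp only [Finset.sum_insert ha]
    refine (jet_add_le hη (hf a (Finset.mem_insert_self a s)) (ContDiffAt.sum fun i hi =>
      hf i (Finset.mem_insert_of_mem hi))).trans (add_le_add le_rfl
        (ih fun i hi => hf i (Finset.mem_insert_of_mem hi)))

theorem norm_iteratedFDeriv_two (f : E → X) (x : E) :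
    ‖iteratedFDeriv ℝ 2 f x‖ = ‖fderiv ℝ (fderiv ℝ f) x‖ := by
  rw [← norm_iteratedFDeriv_fderiv, norm_iteratedFDeriv_one]

/-- Leibniz rule: the weight η²/2 turns the mixed term 2‖Df‖‖Dg‖ of the second derivative into
(η‖Df‖)(η‖Dg‖). The terms of order η³ and η⁴ in the product are nonnegative surplus. -/
theorem jet_bilin_le (hη : 0 ≤ η) (b : X →ₗ[ℝ] Y →ₗ[ℝ] Z) (hb : ∀ u v, ‖b u v‖ ≤ 1 * ‖u‖ * ‖v‖)
    {f : E → X} {g : E → Y} (hf : ContDiffAt ℝ 2 f x) (hg : ContDiffAt ℝ 2 g x) :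
    jet η (fun y => b (f y) (g y)) x ≤ jet η f x * jet η g x := by
  obtain ⟨s, hs, hso, hxs⟩ := eventually_nhds_iff.1
    ((hf.eventually (by decide)).and (hg.eventually (by decide)))
  have key : ∀ n : ℕ, (n : ℕ∞ω) ≤ 2 → ‖iteratedFDeriv ℝ n (fun y => b (f y) (g y)) x‖ ≤
      ∑ i ∈ Finset.range (n + 1), (n.choose i : ℝ) * ‖iteratedFDeriv ℝ i f x‖ *
        ‖iteratedFDeriv ℝ (n - i) g x‖ := by
    intro n hn
    have := (b.mkContinuous₂ 1 hb).norm_iteratedFDerivWithin_le_of_bilinear_of_le_one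
      (fun y hy => (hs y hy).1.contDiffWithinAt) (fun y hy => (hs y hy).2.contDiffWithinAt)
      hso.uniqueDiffOn hxs hn (b.mkContinuous₂_norm_le zero_le_one hb)
    simp only [iteratedFDerivWithin_of_isOpen _ hso hxs] at this
    exact this
  have k0 := key 0 (by norm_num)
  have k1 := key 1 (by norm_num)
  have k2 := key 2 (by norm_num)
  simp only [Finset.sum_range_succ, Finset.range_zero, Finset.sum_empty, norm_iteratedFDeriv_zero,
    norm_iteratedFDeriv_one, norm_iteratedFDeriv_two, Nat.choose, zero_add, Nat.sub_zero,
    Nat.cast_one, one_mul, Nat.add_zero] at k0 k1 k2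
  norm_num at k1 k2
  have g0 : ‖iteratedFDeriv ℝ (1 - 1) g x‖ = ‖g x‖ := norm_iteratedFDeriv_zero
  have g1 : ‖iteratedFDeriv ℝ (2 - 1) g x‖ = ‖fderiv ℝ g x‖ := norm_iteratedFDeriv_one g
  have g2 : ‖iteratedFDeriv ℝ (2 - 2) g x‖ = ‖g x‖ := norm_iteratedFDeriv_zero
  rw [g0] at k1
  rw [g1, g2] at k2
  unfold jet
  have i1 := mul_le_mul_of_nonneg_left k1 hη
  have i2 := mul_le_mul_of_nonneg_left k2 (by positivity : 0 ≤ η ^ 2 / 2)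
  have p1 : 0 ≤ η ^ 3 * ‖fderiv ℝ f x‖ * ‖fderiv ℝ (fderiv ℝ g) x‖ := by positivity
  have p2 : 0 ≤ η ^ 3 * ‖fderiv ℝ (fderiv ℝ f) x‖ * ‖fderiv ℝ g x‖ := by positivity
  have p3 : 0 ≤ η ^ 4 * ‖fderiv ℝ (fderiv ℝ f) x‖ * ‖fderiv ℝ (fderiv ℝ g) x‖ := by positivity
  linarith

theorem continuousAt_jet (η : ℝ) {f : E → X} (hf : ContDiffAt ℝ 2 f x) :
    ContinuousAt (jet η f) x := by
  have h1 := hf.fderiv_right (m := 1) (by norm_num)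
  have h2 := h1.fderiv_right (m := 0) (by norm_num)
  exact (hf.continuousAt.norm.add (h1.continuousAt.norm.const_mul η)).add
    (h2.continuousAt.norm.const_mul _)

theorem jet_le_jet_one (hη : 0 ≤ η) (hη1 : η ≤ 1) (f : E → X) : jet η f x ≤ jet 1 f x := by
  unfold jet; gcongr

theorem jet_one_le (hη : 0 < η) (hη1 : η ≤ 1) (f : E → X) :
    jet 1 f x ≤ (η ^ 2)⁻¹ * jet η f x := by
  have h1 : 1 ≤ (η ^ 2)⁻¹ := (one_le_inv₀ (by positivity)).2 (pow_le_one₀ hη.le hη1)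
  have h2 : (η ^ 2)⁻¹ * η ^ 2 = 1 := inv_mul_cancel₀ (by positivity)
  have h3 : 1 ≤ (η ^ 2)⁻¹ * η := by
    rw [← h2]; refine mul_le_mul_of_nonneg_left ?_ (by positivity); nlinarith
  have e : (η ^ 2)⁻¹ * jet η f x = (η ^ 2)⁻¹ * ‖f x‖ + ((η ^ 2)⁻¹ * η) * ‖fderiv ℝ f x‖ +
      ((η ^ 2)⁻¹ * η ^ 2) / 2 * ‖fderiv ℝ (fderiv ℝ f) x‖ := by unfold jet; ring
  rw [e, h2, jet]
  have := mul_le_mul_of_nonneg_right h1 (norm_nonneg (f x))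
  have := mul_le_mul_of_nonneg_right h3 (norm_nonneg (fderiv ℝ f x))
  linarith

/-- A series of twice continuously differentiable functions with summable jets. -/
theorem tsum_of_jet_le [CompleteSpace X] (hη : 0 < η) {f : ℕ → E → X} {u : ℕ → ℝ}
    (hu : Summable u) (hf : ∀ᶠ y in 𝓝 x, ∀ i, ContDiffAt ℝ 2 (f i) y ∧ jet η (f i) y ≤ u i) :
    (Summable fun i => f i x) ∧ ContDiffAt ℝ 2 (fun y => ∑' i, f i y) x ∧
      jet η (fun y => ∑' i, f i y) x ≤ 3 * ∑' i, u i := by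
  obtain ⟨r, hr, hs⟩ := Metric.eventually_nhds_iff_ball.1 hf
  set s := Metric.ball x r
  have hso : IsOpen s := Metric.isOpen_ball
  have hsc : IsPreconnected s := (convex_ball x r).isPreconnected
  have hxs : x ∈ s := Metric.mem_ball_self hr
  have b0 : ∀ i, ∀ y ∈ s, ‖f i y‖ ≤ u i := fun i y hy =>
    (norm_le_jet hη.le _ _).trans (hs y hy i).2
  have b1 : ∀ i, ∀ y ∈ s, ‖fderiv ℝ (f i) y‖ ≤ η⁻¹ * u i := fun i y hy => by
    rw [← div_eq_inv_mul, le_div_iff₀ hη, mul_comm]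
    exact (norm_fderiv_le_jet hη.le _ _).trans (hs y hy i).2
  have b2 : ∀ i, ∀ y ∈ s, ‖fderiv ℝ (fderiv ℝ (f i)) y‖ ≤ (η ^ 2 / 2)⁻¹ * u i := fun i y hy => by
    rw [← div_eq_inv_mul, le_div_iff₀ (by positivity), mul_comm]
    exact (norm_fderiv_fderiv_le_jet hη.le _ _).trans (hs y hy i).2
  have hu1 := hu.mul_left η⁻¹
  have hu2 := hu.mul_left (η ^ 2 / 2)⁻¹
  have s0 : ∀ y ∈ s, Summable fun i => f i y := fun y hy => .of_norm_bounded hu fun i => b0 i y hy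
  have d1 : ∀ y ∈ s, HasFDerivAt (fun y => ∑' i, f i y) (∑' i, fderiv ℝ (f i) y) y :=
    fun y hy => hasFDerivAt_tsum_of_isPreconnected hu1 hso hsc
      (fun i z hz => ((hs z hz i).1.differentiableAt (by norm_num)).hasFDerivAt) b1 hxs
      (s0 x hxs) hy
  have d2 : ∀ y ∈ s, HasFDerivAt (fun y => ∑' i, fderiv ℝ (f i) y)
      (∑' i, fderiv ℝ (fderiv ℝ (f i)) y) y :=
    fun y hy => hasFDerivAt_tsum_of_isPreconnected hu2 hso hsc
      (fun i z hz => (differentiableAt_fderiv (hs z hz i).1).hasFDerivAt) b2 hxs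
      (.of_norm_bounded hu1 fun i => b1 i x hxs) hy
  have e1 : ∀ y ∈ s, fderiv ℝ (fun y => ∑' i, f i y) y = ∑' i, fderiv ℝ (f i) y :=
    fun y hy => (d1 y hy).fderiv
  have e1' : fderiv ℝ (fun y => ∑' i, f i y) =ᶠ[𝓝 x] fun y => ∑' i, fderiv ℝ (f i) y :=
    eventually_of_mem (hso.mem_nhds hxs) e1
  have e2 : fderiv ℝ (fderiv ℝ (fun y => ∑' i, f i y)) x = ∑' i, fderiv ℝ (fderiv ℝ (f i)) x := by
    rw [e1'.fderiv_eq]; exact (d2 x hxs).fderiv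
  have c2 : ContinuousOn (fun y => ∑' i, fderiv ℝ (fderiv ℝ (f i)) y) s :=
    continuousOn_tsum (fun i y hy => (((hs y hy i).1.fderiv_right (m := 1)
      (by norm_num)).fderiv_right (m := 0) (by norm_num)).continuousAt.continuousWithinAt) hu2 b2
  have cd1 : ContDiffOn ℝ 1 (fun y => ∑' i, fderiv ℝ (f i) y) s := by
    rw [show (1 : ℕ∞ω) = 0 + 1 by norm_num, contDiffOn_succ_iff_fderiv_of_isOpen hso]
    refine ⟨fun y hy => (d2 y hy).differentiableAt.differentiableWithinAt, by simp, ?_⟩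
    exact contDiffOn_zero.2 (c2.congr fun y hy => (d2 y hy).fderiv)
  have cd2 : ContDiffOn ℝ 2 (fun y => ∑' i, f i y) s := by
    rw [show (2 : ℕ∞ω) = 1 + 1 by norm_num, contDiffOn_succ_iff_fderiv_of_isOpen hso]
    exact ⟨fun y hy => (d1 y hy).differentiableAt.differentiableWithinAt, by simp, cd1.congr e1⟩
  refine ⟨s0 x hxs, cd2.contDiffAt (hso.mem_nhds hxs), ?_⟩
  have t0 : ‖∑' i, f i x‖ ≤ ∑' i, u i := tsum_of_norm_bounded hu.hasSum fun i => b0 i x hxs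
  have t1 : ‖∑' i, fderiv ℝ (f i) x‖ ≤ η⁻¹ * ∑' i, u i := by
    rw [← tsum_mul_left]; exact tsum_of_norm_bounded hu1.hasSum fun i => b1 i x hxs
  have t2 : ‖∑' i, fderiv ℝ (fderiv ℝ (f i)) x‖ ≤ (η ^ 2 / 2)⁻¹ * ∑' i, u i := by
    rw [← tsum_mul_left]; exact tsum_of_norm_bounded (f := fun i => fderiv ℝ (fderiv ℝ (f i)) x) hu2.hasSum
      fun i => b2 i x hxs
  rw [jet, e1 x hxs, e2]
  -- After cancelling weights each of the three terms of the jet is at most ∑ u, whence the factor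
  -- 3.
  have m1 := mul_le_mul_of_nonneg_left t1 hη.le
  have m2 := mul_le_mul_of_nonneg_left t2 (by positivity : 0 ≤ η ^ 2 / 2)
  rw [mul_inv_cancel_left₀ hη.ne'] at m1
  rw [mul_inv_cancel_left₀ (by positivity)] at m2
  linarith

end Jet

/-- A submultiplicative sequence with a term below one decays geometrically. -/
theorem exists_le_mul_pow_of_submultiplicative {q b : ℝ} {k : ℕ} (hk : 0 < k) (hq : 0 < q)
    (hq1 : q < 1) : ∃ c ρ : ℝ, 0 ≤ c ∧ 0 < ρ ∧ ρ < 1 ∧ ∀ a : ℕ → ℝ, (∀ n, 0 ≤ a n) →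
      (∀ i j, a (i + j) ≤ a i * a j) → a k ≤ q → (∀ j < k, a j ≤ b) → ∀ n, a n ≤ c * ρ ^ n := by
  -- With n divided by k, the bound is |b| q^(n/k) ≤ |b| ρ^(n-k). Both constants are fixed before
  -- the sequence, so they serve all nearby points at once.
  set ρ := q ^ ((k : ℝ)⁻¹) with hρ
  have hρ0 : 0 < ρ := Real.rpow_pos_of_pos hq _
  have hρ1 : ρ < 1 := Real.rpow_lt_one hq.le hq1 (by positivity)
  have hρk : ρ ^ k = q := Real.rpow_inv_natCast_pow hq.le hk.ne'
  refine ⟨|b| / ρ ^ k, ρ, by positivity, hρ0, hρ1, fun a ha hm hak hb n => ?_⟩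
  have h1 : ∀ j l, a (j * k + l) ≤ q ^ j * a l := by
    intro j l
    induction j with
    | zero => simp
    | succ j ih =>
      rw [show (j + 1) * k + l = k + (j * k + l) by ring, pow_succ', mul_assoc]
      exact (hm _ _).trans (mul_le_mul hak ih (ha _) hq.le)
  have h2 := h1 (n / k) (n % k)
  rw [Nat.div_add_mod'] at h2
  refine h2.trans ((mul_le_mul_of_nonneg_left ((hb _ (Nat.mod_lt _ hk)).trans (le_abs_self b))
    (by positivity)).trans ?_)
  rw [div_mul_eq_mul_div, le_div_iff₀ (by positivity), ← hρk, ← pow_mul, mul_right_comm, ← pow_add,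
    mul_comm |b|]
  refine mul_le_mul_of_nonneg_right ?_ (abs_nonneg b)
  refine pow_le_pow_of_le_one hρ0.le hρ1.le ?_
  have h3 := Nat.div_add_mod n k
  have h4 := Nat.mod_lt n hk
  have h5 : k * (n / k) + k = k + k * (n / k) := by ring
  omega

/-- Powers of a smooth matrix function whose powers vanish at a point decay geometrically,
together with their derivatives, uniformly in a neighbourhood. -/
theorem exists_jet_pow_le {E : Type*} [NormedAddCommGroup E] [NormedSpace ℝ E] {x : E} {ι : Type*}
    [Fintype ι] [DecidableEq ι] {F : E → Matrix ι ι ℝ} (hF : ContDiffAt ℝ 2 F x)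
    (h0 : Tendsto (fun n => F x ^ n) atTop (𝓝 0)) :
    ∃ η c ρ : ℝ, 0 < η ∧ η ≤ 1 ∧ 0 ≤ c ∧ 0 < ρ ∧ ρ < 1 ∧
      ∀ᶠ y in 𝓝 x, ∀ n, ContDiffAt ℝ 2 (fun z => F z ^ n) y ∧ jet η (fun z => F z ^ n) y ≤ c * ρ ^ n := by
  have hpow : ∀ y, ContDiffAt ℝ 2 F y → ∀ n, ContDiffAt ℝ 2 (fun z => F z ^ n) y := by
    intro y hy n
    induction n with
    | zero => simpa using contDiffAt_const
    | succ n ih => simp_rw [pow_succ]; exact ContDiffAt.matrix_mul ih hy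
  obtain ⟨k, hk, hk0⟩ : ∃ k, ‖F x ^ k‖ < 1 / 2 ∧ 0 < k :=
    ((h0.norm.eventually (gt_mem_nhds (by norm_num : ‖(0 : Matrix ι ι ℝ)‖ < 1 / 2))).and
      (eventually_gt_atTop 0)).exists
  -- With k fixed, the jet tends to ‖F(x)^k‖ < 1/2 as the weight η tends to 0.
  obtain ⟨η, hη, hη1, hηk⟩ : ∃ η : ℝ, 0 < η ∧ η ≤ 1 ∧ jet η (fun z => F z ^ k) x < 1 / 2 := by
    have h1 : Continuous fun η : ℝ => jet η (fun z => F z ^ k) x := by unfold jet; fun_prop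
    have h2 : Tendsto (fun η : ℝ => jet η (fun z => F z ^ k) x) (𝓝[>] 0) (𝓝 ‖F x ^ k‖) := by
      have := h1.tendsto 0
      simp only [jet, zero_mul, ne_eq, OfNat.ofNat_ne_zero, not_false_eq_true, zero_pow, zero_div,
        add_zero] at this
      exact this.mono_left nhdsWithin_le_nhds
    have h6 : ∀ᶠ η : ℝ in 𝓝[>] 0, η ∈ Set.Ioi (0 : ℝ) := self_mem_nhdsWithin
    have h7 : ∀ᶠ η : ℝ in 𝓝[>] 0, η ≤ 1 := nhdsWithin_le_nhds (Iic_mem_nhds one_pos)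
    obtain ⟨η, h3, h4, h5⟩ := ((h2.eventually (gt_mem_nhds hk)).and (h6.and h7)).exists
    exact ⟨η, h4, h5, h3⟩
  -- The added 1 leaves room for the jets of the first k powers to vary in a neighbourhood.
  set b := ∑ j ∈ Finset.range k, (jet η (fun z => F z ^ j) x + 1) with hb
  obtain ⟨c, ρ, hc, hρ, hρ1, hcρ⟩ := exists_le_mul_pow_of_submultiplicative (q := 1 / 2) (b := b)
    hk0 (by norm_num) (by norm_num)
  refine ⟨η, c, ρ, hη, hη1, hc, hρ, hρ1, ?_⟩
  have e1 : ∀ᶠ y in 𝓝 x, jet η (fun z => F z ^ k) y < 1 / 2 :=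
    (continuousAt_jet η (hpow x hF k)).eventually (gt_mem_nhds hηk)
  have e2 : ∀ᶠ y in 𝓝 x, ∀ j ∈ Finset.range k, jet η (fun z => F z ^ j) y <
      jet η (fun z => F z ^ j) x + 1 :=
    (Finset.eventually_all _).2 fun j _ => (continuousAt_jet η (hpow x hF j)).eventually
      (gt_mem_nhds (lt_add_one _))
  filter_upwards [e1, e2, hF.eventually (by decide)] with y h1 h2 h3 n
  refine ⟨hpow y h3 n, hcρ (fun n => jet η (fun z => F z ^ n) y) (fun n => jet_nonneg hη.le _ _)
    (fun i j => ?_) h1.le (fun j hj => ?_) n⟩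
  · simp_rw [pow_add]
    exact jet_bilin_le hη.le (mulB ι ι ι) norm_mulB_le (hpow y h3 i) (hpow y h3 j)
  · refine (h2 j (Finset.mem_range.2 hj)).le.trans ?_
    exact Finset.single_le_sum (f := fun j => jet η (fun z => F z ^ j) x + 1)
      (fun i _ => by have := jet_nonneg hη.le (fun z => F z ^ i) x; positivity)
      (Finset.mem_range.2 hj)

end CointSSM

namespace CointSSM

open scoped Matrix.Norms.Operator

/-! ### Jets of products -/

section Products

variable {E : Type*} [NormedAddCommGroup E] [NormedSpace ℝ E] {η : ℝ} {x : E}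
  {α β γ : Type*} [Fintype α] [DecidableEq α] [Fintype β] [DecidableEq β] [Fintype γ]
  [DecidableEq γ] {n : WithTop ℕ∞}

theorem ContDiffAt.matrix_mulVec {f : E → Matrix α β ℝ} {g : E → β → ℝ}
    (hf : ContDiffAt ℝ n f x) (hg : ContDiffAt ℝ n g x) :
    ContDiffAt ℝ n (fun y => f y *ᵥ g y) x :=
  ContDiffAt.bilin (mulVecB α β) norm_mulVecB_le hf hg

theorem ContDiffAt.dotProduct {f g : E → α → ℝ} (hf : ContDiffAt ℝ n f x)
    (hg : ContDiffAt ℝ n g x) : ContDiffAt ℝ n (fun y => f y ⬝ᵥ g y) x :=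
  ContDiffAt.sum fun i _ => (contDiffAt_pi.1 hf i).mul (contDiffAt_pi.1 hg i)

theorem jet_mul_le (hη : 0 ≤ η) {f : E → Matrix α β ℝ} {g : E → Matrix β γ ℝ}
    (hf : ContDiffAt ℝ 2 f x) (hg : ContDiffAt ℝ 2 g x) :
    jet η (fun y => f y * g y) x ≤ jet η f x * jet η g x :=
  jet_bilin_le hη (mulB α β γ) norm_mulB_le hf hg

theorem jet_mulVec_le (hη : 0 ≤ η) {f : E → Matrix α β ℝ} {g : E → β → ℝ}
    (hf : ContDiffAt ℝ 2 f x) (hg : ContDiffAt ℝ 2 g x) :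
    jet η (fun y => f y *ᵥ g y) x ≤ jet η f x * jet η g x :=
  jet_bilin_le hη (mulVecB α β) norm_mulVecB_le hf hg

theorem jet_const_mul_le (hη : 0 ≤ η) {f : E → ℝ} (hf : ContDiffAt ℝ 2 f x) (a : ℝ) :
    jet η (fun y => a * f y) x ≤ |a| * jet η f x := by
  have := jet_bilin_le hη (LinearMap.mul ℝ ℝ) (fun u v => by simp) (contDiffAt_const (c := a)) hf
  rwa [jet_const] at this

/-- The dot product, scaled to be a bilinear form of norm at most one for the maximum norm. -/
noncomputable def scaledDot (α : Type*) [Fintype α] : (α → ℝ) →ₗ[ℝ] (α → ℝ) →ₗ[ℝ] ℝ :=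
  LinearMap.mk₂ ℝ (fun u v => (Fintype.card α + 1 : ℝ)⁻¹ * (u ⬝ᵥ v))
    (fun _ _ _ => by rw [add_dotProduct, mul_add])
    (fun _ _ _ => by rw [smul_dotProduct, smul_eq_mul, smul_eq_mul, mul_left_comm])
    (fun _ _ _ => by rw [dotProduct_add, mul_add])
    (fun _ _ _ => by rw [dotProduct_smul, smul_eq_mul, smul_eq_mul, mul_left_comm])

theorem norm_scaledDot_le (u v : α → ℝ) : ‖scaledDot α u v‖ ≤ 1 * ‖u‖ * ‖v‖ := by
  have h : ‖u ⬝ᵥ v‖ ≤ (Fintype.card α + 1 : ℝ) * (‖u‖ * ‖v‖) := by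
    refine (norm_sum_le _ _).trans ((Finset.sum_le_card_nsmul _ _ (‖u‖ * ‖v‖) fun i _ => ?_).trans ?_)
    · rw [norm_mul]
      exact mul_le_mul (norm_le_pi_norm u i) (norm_le_pi_norm v i) (norm_nonneg _) (norm_nonneg _)
    · rw [nsmul_eq_mul, Finset.card_univ]
      have : 0 ≤ ‖u‖ * ‖v‖ := by positivity
      linarith
  have h0 : (0 : ℝ) < Fintype.card α + 1 := by positivity
  change ‖(Fintype.card α + 1 : ℝ)⁻¹ * (u ⬝ᵥ v)‖ ≤ _
  rw [norm_mul, norm_inv, Real.norm_of_nonneg h0.le, inv_mul_le_iff₀ h0, one_mul]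
  exact h

theorem jet_dotProduct_le (hη : 0 ≤ η) {f g : E → α → ℝ} (hf : ContDiffAt ℝ 2 f x)
    (hg : ContDiffAt ℝ 2 g x) :
    jet η (fun y => f y ⬝ᵥ g y) x ≤ (Fintype.card α + 1) * (jet η f x * jet η g x) := by
  have h0 : (0 : ℝ) < Fintype.card α + 1 := by positivity
  have e : (fun y => f y ⬝ᵥ g y) =
      fun y => (Fintype.card α + 1 : ℝ) * scaledDot α (f y) (g y) := by
    ext1 y
    exact (mul_inv_cancel_left₀ h0.ne' _).symm
  rw [e]
  refine (jet_const_mul_le hη (ContDiffAt.bilin (scaledDot α) norm_scaledDot_le hf hg) _).trans ?_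
  rw [abs_of_pos h0]
  exact mul_le_mul_of_nonneg_left (jet_bilin_le hη _ norm_scaledDot_le hf hg) h0.le

end Products

/-- The i-th term of a prediction involves an observation of cubic growth i + 1 steps back, against
the decay ρ^i of the filter. -/
theorem summable_add_two_pow_mul_geometric {ρ : ℝ} (h0 : 0 < ρ) (h1 : ρ < 1) :
    Summable fun i : ℕ => ((i : ℝ) + 2) ^ 3 * ρ ^ i := by
  have h := summable_pow_mul_geometric_of_norm_lt_one (R := ℝ) 3 (r := ρ)
    (by rwa [Real.norm_of_nonneg h0.le])
  have h2 := ((summable_nat_add_iff 2).2 h).mul_right (ρ ^ 2)⁻¹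
  refine h2.congr fun i => ?_
  rw [pow_add, ← mul_assoc, mul_inv_cancel_right₀ (by positivity)]
  push_cast
  rfl

/-! ### Comparing the two filters and the two likelihoods -/

namespace Model

variable {Ω : Type*} {s₁ s₂ c p d m : ℕ} {M : Model Ω s₁ s₂ c p d m} [MeasurableSpace Ω]
  {P : Measure Ω} {ϑ : Param s₁ s₂} {X1 : Param s₁ s₂ → Ω → (Fin c ⊕ Fin p → ℝ)}

variable (M P) in
/-- The terms of the one-step prediction of the state from the infinite past. -/
noncomputable def stateTerm (k : ℕ) (ω : Ω) (i : ℕ) (ϑ : Param s₁ s₂) : Fin c ⊕ Fin p → ℝ :=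
  (M.closedLoop P ϑ ^ i * M.K P ϑ) *ᵥ M.Yobs ((k : ℤ) - ((i : ℤ) + 1)) ω

variable (M P) in
/-- The one-step prediction of the state at time `k` from the infinite past. -/
noncomputable def statePrediction (k : ℕ) (ω : Ω) (ϑ : Param s₁ s₂) : Fin c ⊕ Fin p → ℝ :=
  ∑' i, M.stateTerm P k ω i ϑ

theorem hasSum_predictionTerm {k : ℕ} {ω : Ω} (h : Summable fun i => M.stateTerm P k ω i ϑ) :
    HasSum (M.predictionTerm P ϑ k ω) (M.C ϑ *ᵥ M.statePrediction P k ω ϑ) := by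
  have h1 := h.hasSum.map (mulVecLin (M.C ϑ)) (LinearMap.continuous_of_finiteDimensional _)
  convert h1 using 1
  · ext1 i
    simp [predictionTerm, stateTerm, Matrix.mul_assoc]
  · rfl

theorem innovation_eq {k : ℕ} {ω : Ω} (h : Summable fun i => M.stateTerm P k ω i ϑ) :
    M.innovation P k ϑ ω = M.Yobs k ω - M.C ϑ *ᵥ M.statePrediction P k ω ϑ := by
  rw [innovation, (hasSum_predictionTerm h).tsum_eq]

/-- The first term of the series at time k + 1 is the new observation; the remaining ones are the
series at time k after one more closed loop step. -/
theorem statePrediction_succ {k : ℕ} {ω : Ω} (h : Summable fun i => M.stateTerm P k ω i ϑ)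
    (h' : Summable fun i => M.stateTerm P (k + 1) ω i ϑ) :
    M.statePrediction P (k + 1) ω ϑ =
      M.closedLoop P ϑ *ᵥ M.statePrediction P k ω ϑ + M.K P ϑ *ᵥ M.Yobs k ω := by
  have h1 := h.hasSum.map (mulVecLin (M.closedLoop P ϑ))
    (LinearMap.continuous_of_finiteDimensional _)
  rw [statePrediction, h'.tsum_eq_zero_add, add_comm]
  congr 1
  · rw [statePrediction, ← mulVecLin_apply, ← h1.tsum_eq]
    refine tsum_congr fun i => ?_
    simp only [stateTerm, Function.comp, mulVecLin_apply, mulVec_mulVec, pow_succ', Matrix.mul_assoc]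
    congr 2
    push_cast
    ring
  · simp [stateTerm]

/-- Both sequences obey one affine recursion, so the observations cancel in the difference. -/
theorem statePrediction_sub_filterState {ω : Ω}
    (h : ∀ k, Summable fun i => M.stateTerm P k ω i ϑ) (k : ℕ) :
    M.statePrediction P (k + 1) ω ϑ - M.filterState P X1 ϑ ω (k + 1) =
      M.closedLoop P ϑ ^ k *ᵥ (M.statePrediction P 1 ω ϑ - X1 ϑ ω) := by
  induction k with
  | zero => simp [filterState]
  | succ k ih =>
    rw [statePrediction_succ (h _) (h _), filterState, pow_succ', ← mulVec_mulVec, ← ih, mulVec_sub]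
    push_cast
    abel

theorem approxInnovation_eq {ω : Ω} (h : ∀ k, Summable fun i => M.stateTerm P k ω i ϑ) (k : ℕ) :
    M.approxInnovation P X1 (k + 1) ϑ ω = M.innovation P (k + 1) ϑ ω +
      M.C ϑ *ᵥ (M.closedLoop P ϑ ^ k *ᵥ (M.statePrediction P 1 ω ϑ - X1 ϑ ω)) := by
  rw [innovation_eq (h _), ← statePrediction_sub_filterState h, approxInnovation, mulVec_sub]
  abel

variable (M P) in
/-- Smoothness of the coefficients of the filter at `ϑ`, with bounds on their jets. -/
structure FilterBounds (η c₀ ρ b : ℝ) (ϑ : Param s₁ s₂) : Prop where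
  pow : ∀ n, ContDiffAt ℝ 2 (fun z => M.closedLoop P z ^ n) ϑ ∧
    jet η (fun z => M.closedLoop P z ^ n) ϑ ≤ c₀ * ρ ^ n
  smooth_K : ContDiffAt ℝ 2 (M.K P) ϑ
  jet_K : jet η (M.K P) ϑ ≤ b
  smooth_C : ContDiffAt ℝ 2 M.C ϑ
  jet_C : jet η M.C ϑ ≤ b
  smooth_V_inv : ContDiffAt ℝ 2 (fun z => (M.V P z)⁻¹) ϑ
  jet_V_inv : jet η (fun z => (M.V P z)⁻¹) ϑ ≤ b
  smooth_log_det : ContDiffAt ℝ 2 (fun z => Real.log (M.V P z).det) ϑ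

/-- The bounds hold at all points near ϑ with common constants, ready for a compactness argument.
The log-determinant needs smoothness only, since it cancels in the difference of the likelihoods. -/
theorem AssumptionA.exists_filterBounds (hA : M.AssumptionA P) [IsFiniteMeasure P]
    (hϑ : ϑ ∈ M.Theta) : ∃ η c₀ ρ b : ℝ, 0 < η ∧ η ≤ 1 ∧ 0 ≤ c₀ ∧ 0 < ρ ∧ ρ < 1 ∧ 0 ≤ b ∧
      ∀ᶠ z in 𝓝 ϑ, M.FilterBounds P η c₀ ρ b z := by
  have hle : (2 : WithTop ℕ∞) ≤ 3 := by norm_num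
  obtain ⟨η, c₀, ρ, hη, hη1, hc, hρ, hρ1, hp⟩ := exists_jet_pow_le
    ((hA.contDiffAt_closedLoop hϑ).of_le hle) (hA.tendsto_closedLoop_pow hϑ)
  have hK := (hA.contDiffAt_K hϑ).of_le hle
  have hC := (hA.contDiffAt_C hϑ).of_le hle
  have hV := (hA.contDiffAt_V_inv hϑ).of_le hle
  have hl := (hA.contDiffAt_log_det_V hϑ).of_le hle
  have nK := jet_nonneg hη.le (M.K P) ϑ
  have nC := jet_nonneg hη.le M.C ϑ
  have nV := jet_nonneg hη.le (fun z => (M.V P z)⁻¹) ϑ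
  set b := jet η (M.K P) ϑ + jet η M.C ϑ + jet η (fun z => (M.V P z)⁻¹) ϑ + 1
  refine ⟨η, c₀, ρ, b, hη, hη1, hc, hρ, hρ1, by positivity, ?_⟩
  have bK := (continuousAt_jet η hK).eventually (gt_mem_nhds (by linarith : jet η (M.K P) ϑ < b))
  have bC := (continuousAt_jet η hC).eventually (gt_mem_nhds (by linarith : jet η M.C ϑ < b))
  have bV := (continuousAt_jet η hV).eventually
    (gt_mem_nhds (by linarith : jet η (fun z => (M.V P z)⁻¹) ϑ < b))
  filter_upwards [hp, bK, bC, bV, hK.eventually (by decide), hC.eventually (by decide),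
    hV.eventually (by decide), hl.eventually (by decide)] with z h1 h2 h3 h4 h5 h6 h7 h8
  exact ⟨h1, h5, h2.le, h6, h3.le, h7, h4.le, h8⟩

section Bounds

variable {η c₀ ρ b R T : ℝ} {ω : Ω}

theorem FilterBounds.jet_stateTerm (h : M.FilterBounds P η c₀ ρ b ϑ) (hη : 0 < η) (hc : 0 ≤ c₀)
    (hρ : 0 < ρ) (hb : 0 ≤ b) (hR : 0 ≤ R) (hY : ∀ k : ℤ, ‖M.Yobs k ω‖ ≤ R * (1 + |(k : ℝ)|) ^ 3)
    (k i : ℕ) : ContDiffAt ℝ 2 (M.stateTerm P k ω i) ϑ ∧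
      jet η (M.stateTerm P k ω i) ϑ ≤
        c₀ * b * R * (1 + (k : ℝ)) ^ 3 * (((i : ℝ) + 2) ^ 3 * ρ ^ i) := by
  have h1 := ContDiffAt.matrix_mul (h.pow i).1 h.smooth_K
  have h2 : ContDiffAt ℝ 2 (fun _ : Param s₁ s₂ => M.Yobs ((k : ℤ) - ((i : ℤ) + 1)) ω) ϑ :=
    contDiffAt_const
  refine ⟨ContDiffAt.matrix_mulVec h1 h2, (jet_mulVec_le hη.le h1 h2).trans ?_⟩
  rw [jet_const]
  have h3 : jet η (fun z => M.closedLoop P z ^ i * M.K P z) ϑ ≤ c₀ * ρ ^ i * b :=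
    (jet_mul_le hη.le (h.pow i).1 h.smooth_K).trans
      (mul_le_mul (h.pow i).2 h.jet_K (jet_nonneg hη.le _ _) (by positivity))
  -- The estimate 1 + k + (i + 1) ≤ (1 + k)(i + 2) separates the time k from the summation index.
  have h4 : ‖M.Yobs ((k : ℤ) - ((i : ℤ) + 1)) ω‖ ≤ R * ((1 + (k : ℝ)) * ((i : ℝ) + 2)) ^ 3 := by
    refine (hY _).trans (mul_le_mul_of_nonneg_left (pow_le_pow_left₀ (by positivity) ?_ 3) hR)
    have h5 : |(((k : ℤ) - ((i : ℤ) + 1) : ℤ) : ℝ)| ≤ k + (i + 1) := by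
      push_cast
      refine (abs_sub _ _).trans ?_
      rw [abs_of_nonneg (by positivity : (0 : ℝ) ≤ k),
        abs_of_nonneg (by positivity : (0 : ℝ) ≤ (i : ℝ) + 1)]
    have h6 : (0 : ℝ) ≤ k * i + k := by positivity
    linarith
  refine (mul_le_mul h3 h4 (norm_nonneg _) (by positivity)).trans (le_of_eq ?_)
  ring

/-- The constant in the bound on the prediction of the state. -/
noncomputable def stateConst (c₀ ρ b : ℝ) : ℝ :=
  3 * (c₀ * b * ∑' i : ℕ, ((i : ℝ) + 2) ^ 3 * ρ ^ i)

theorem stateConst_nonneg (hc : 0 ≤ c₀) (hρ : 0 < ρ) (hb : 0 ≤ b) : 0 ≤ stateConst c₀ ρ b := by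
  have : 0 ≤ ∑' i : ℕ, ((i : ℝ) + 2) ^ 3 * ρ ^ i := tsum_nonneg fun i => by positivity
  unfold stateConst; positivity

theorem FilterBounds.jet_statePrediction (h : ∀ᶠ z in 𝓝 ϑ, M.FilterBounds P η c₀ ρ b z)
    (hη : 0 < η) (hc : 0 ≤ c₀) (hρ : 0 < ρ) (hρ1 : ρ < 1) (hb : 0 ≤ b) (hR : 0 ≤ R)
    (hY : ∀ k : ℤ, ‖M.Yobs k ω‖ ≤ R * (1 + |(k : ℝ)|) ^ 3) (k : ℕ) :
    (Summable fun i => M.stateTerm P k ω i ϑ) ∧ ContDiffAt ℝ 2 (M.statePrediction P k ω) ϑ ∧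
      jet η (M.statePrediction P k ω) ϑ ≤ stateConst c₀ ρ b * R * (1 + (k : ℝ)) ^ 3 := by
  have hs := (summable_add_two_pow_mul_geometric hρ hρ1).mul_left
    (c₀ * b * R * (1 + (k : ℝ)) ^ 3)
  obtain ⟨h1, h2, h3⟩ := tsum_of_jet_le hη hs (h.mono fun z hz i =>
    hz.jet_stateTerm hη hc hρ hb hR hY k i)
  refine ⟨h1, h2, h3.trans (le_of_eq ?_)⟩
  rw [tsum_mul_left, stateConst]
  ring

theorem FilterBounds.jet_innovation (h : ∀ᶠ z in 𝓝 ϑ, M.FilterBounds P η c₀ ρ b z)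
    (hη : 0 < η) (hc : 0 ≤ c₀) (hρ : 0 < ρ) (hρ1 : ρ < 1) (hb : 0 ≤ b) (hR : 0 ≤ R)
    (hY : ∀ k : ℤ, ‖M.Yobs k ω‖ ≤ R * (1 + |(k : ℝ)|) ^ 3) (k : ℕ) :
    ContDiffAt ℝ 2 (fun z => M.innovation P k z ω) ϑ ∧
      jet η (fun z => M.innovation P k z ω) ϑ ≤
        (1 + b * stateConst c₀ ρ b) * R * (1 + (k : ℝ)) ^ 3 := by
  have hs := fun z hz => FilterBounds.jet_statePrediction (M := M) (P := P) (ϑ := z) hz hη hc hρ hρ1 hb hR hY k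
  -- Taking C out of the series requires convergence, which is known only near ϑ.
  have e : (fun z => M.innovation P k z ω) =ᶠ[𝓝 ϑ]
      fun z => M.Yobs k ω - M.C z *ᵥ M.statePrediction P k ω z :=
    h.eventually_nhds.mono fun z hz => innovation_eq (hs z hz).1
  have h1 := h.self_of_nhds
  obtain ⟨-, h2, h3⟩ := hs ϑ h
  have h4 : ContDiffAt ℝ 2 (fun _ : Param s₁ s₂ => M.Yobs k ω) ϑ := contDiffAt_const
  have h5 := ContDiffAt.matrix_mulVec h1.smooth_C h2
  refine ⟨(h4.sub h5).congr_of_eventuallyEq e, ?_⟩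
  rw [jet_congr e]
  refine (jet_sub_le hη.le h4 h5).trans ?_
  rw [jet_const]
  have h6 := (jet_mulVec_le hη.le h1.smooth_C h2).trans
    (mul_le_mul h1.jet_C h3 (jet_nonneg hη.le _ _) hb)
  have h7 := hY k
  rw [Int.cast_natCast, abs_of_nonneg (by positivity : (0 : ℝ) ≤ k)] at h7
  linarith

variable (M P X1) in
/-- The difference of the approximate innovation and the innovation at time `k + 1`. -/
noncomputable def innovationError (k : ℕ) (ω : Ω) (ϑ : Param s₁ s₂) : Fin d → ℝ :=
  M.C ϑ *ᵥ (M.closedLoop P ϑ ^ k *ᵥ (M.statePrediction P 1 ω ϑ - X1 ϑ ω))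

theorem FilterBounds.jet_innovationError (h : ∀ᶠ z in 𝓝 ϑ, M.FilterBounds P η c₀ ρ b z)
    (hη : 0 < η) (hc : 0 ≤ c₀) (hρ : 0 < ρ) (hρ1 : ρ < 1) (hb : 0 ≤ b) (hR : 0 ≤ R)
    (hY : ∀ k : ℤ, ‖M.Yobs k ω‖ ≤ R * (1 + |(k : ℝ)|) ^ 3)
    (hX : ContDiffAt ℝ 2 (fun z => X1 z ω) ϑ) (hT : jet η (fun z => X1 z ω) ϑ ≤ T) (k : ℕ) :
    ContDiffAt ℝ 2 (M.innovationError P X1 k ω) ϑ ∧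
      jet η (M.innovationError P X1 k ω) ϑ ≤
        b * c₀ * (8 * stateConst c₀ ρ b + 1) * (R + T) * ρ ^ k := by
  obtain ⟨-, h2, h3⟩ := FilterBounds.jet_statePrediction h hη hc hρ hρ1 hb hR hY 1
  have h1 := h.self_of_nhds
  have h4 := h2.sub hX
  have h5 := ContDiffAt.matrix_mulVec (h1.pow k).1 h4
  refine ⟨ContDiffAt.matrix_mulVec h1.smooth_C h5, (jet_mulVec_le hη.le h1.smooth_C h5).trans ?_⟩
  have hT0 : 0 ≤ T := (jet_nonneg hη.le _ _).trans hT
  have hs0 := stateConst_nonneg hc hρ hb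
  -- The 8 is (1 + k)^3 at the starting time k = 1.
  have h6 : jet η (fun z => M.statePrediction P 1 ω z - X1 z ω) ϑ ≤
      (8 * stateConst c₀ ρ b + 1) * (R + T) := by
    have := jet_sub_le hη.le h2 hX
    have h8 : 0 ≤ stateConst c₀ ρ b * T := by positivity
    norm_num at h3
    nlinarith
  have h7 : jet η (fun z => M.closedLoop P z ^ k *ᵥ (M.statePrediction P 1 ω z - X1 z ω)) ϑ ≤
      c₀ * ρ ^ k * ((8 * stateConst c₀ ρ b + 1) * (R + T)) :=
    (jet_mulVec_le hη.le (h1.pow k).1 h4).trans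
      (mul_le_mul (h1.pow k).2 h6 (jet_nonneg hη.le _ _) (by positivity))
  refine (mul_le_mul h1.jet_C h7 (jet_nonneg hη.le _ _) hb).trans (le_of_eq ?_)
  ring

theorem quadratic_add_sub (W : Matrix (Fin d) (Fin d) ℝ) (e δ : Fin d → ℝ) :
    (e + δ) ⬝ᵥ (W *ᵥ (e + δ)) - e ⬝ᵥ (W *ᵥ e) =
      δ ⬝ᵥ (W *ᵥ e) + e ⬝ᵥ (W *ᵥ δ) + δ ⬝ᵥ (W *ᵥ δ) := by
  simp only [mulVec_add, dotProduct_add, add_dotProduct]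
  ring

theorem jet_quadratic_le (hη : 0 ≤ η) {W : Param s₁ s₂ → Matrix (Fin d) (Fin d) ℝ}
    {f g : Param s₁ s₂ → Fin d → ℝ} {r r' : ℝ} (hW : ContDiffAt ℝ 2 W ϑ)
    (hf : ContDiffAt ℝ 2 f ϑ) (hg : ContDiffAt ℝ 2 g ϑ) (bW : jet η W ϑ ≤ b) (bf : jet η f ϑ ≤ r)
    (bg : jet η g ϑ ≤ r') : ContDiffAt ℝ 2 (fun z => f z ⬝ᵥ (W z *ᵥ g z)) ϑ ∧
      jet η (fun z => f z ⬝ᵥ (W z *ᵥ g z)) ϑ ≤ (d + 1) * b * (r * r') := by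
  have h1 := ContDiffAt.matrix_mulVec hW hg
  have nW := jet_nonneg hη W ϑ
  have nf := jet_nonneg hη f ϑ
  have ng := jet_nonneg hη g ϑ
  refine ⟨ContDiffAt.dotProduct hf h1, (jet_dotProduct_le hη hf h1).trans ?_⟩
  rw [Fintype.card_fin, mul_assoc]
  refine mul_le_mul_of_nonneg_left ?_ (by positivity)
  have h2 : jet η (fun z => W z *ᵥ g z) ϑ ≤ b * r' :=
    (jet_mulVec_le hη hW hg).trans (mul_le_mul bW bg ng (nW.trans bW))
  refine (mul_le_mul bf h2 (jet_nonneg hη _ _) (nf.trans bf)).trans (le_of_eq ?_)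
  ring

theorem sum_Icc_one_eq_sum_range (f : ℕ → ℝ) (n : ℕ) :
    ∑ k ∈ Finset.Icc 1 n, f k = ∑ k ∈ Finset.range n, f (k + 1) := by
  induction n with
  | zero => simp
  | succ n ih => rw [Finset.sum_Icc_succ_top (by omega), ih, Finset.sum_range_succ]

theorem approxLik_sub_lik (h : ∀ k, Summable fun i => M.stateTerm P k ω i ϑ) (n : ℕ) :
    M.approxLik P X1 n ω ϑ - M.lik P n ω ϑ = (1 / (n : ℝ)) * ∑ k ∈ Finset.range n,
      (M.innovationError P X1 k ω ϑ ⬝ᵥ ((M.V P ϑ)⁻¹ *ᵥ M.innovation P (k + 1) ϑ ω) +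
        M.innovation P (k + 1) ϑ ω ⬝ᵥ ((M.V P ϑ)⁻¹ *ᵥ M.innovationError P X1 k ω ϑ) +
        M.innovationError P X1 k ω ϑ ⬝ᵥ ((M.V P ϑ)⁻¹ *ᵥ M.innovationError P X1 k ω ϑ)) := by
  rw [approxLik, lik, gaussLik, gaussLik, ← mul_sub, sum_Icc_one_eq_sum_range,
    sum_Icc_one_eq_sum_range, ← Finset.sum_sub_distrib]
  congr 1
  refine Finset.sum_congr rfl fun k _ => ?_
  rw [← quadratic_add_sub, approxInnovation_eq h k, ← innovationError]
  ring

/-- The constant in the bound on the difference of the likelihoods. -/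
noncomputable def likConst (d : ℕ) (c₀ ρ b : ℝ) : ℝ :=
  let c₂ := 1 + b * stateConst c₀ ρ b
  let c₃ := b * c₀ * (8 * stateConst c₀ ρ b + 1)
  (d + 1) * b * (2 * (c₂ * c₃) + c₃ ^ 2) * ∑' i : ℕ, ((i : ℝ) + 2) ^ 3 * ρ ^ i

/-- Each summand of the difference has an innovation error as a factor, so its jet is of order (k +
2)^3 ρ^k. The sums are bounded in n and the prefactor 1/n remains. -/
theorem FilterBounds.lik_bounds (h : ∀ᶠ z in 𝓝 ϑ, M.FilterBounds P η c₀ ρ b z)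
    (hη : 0 < η) (hc : 0 ≤ c₀) (hρ : 0 < ρ) (hρ1 : ρ < 1) (hb : 0 ≤ b) (hR : 0 ≤ R)
    (hY : ∀ k : ℤ, ‖M.Yobs k ω‖ ≤ R * (1 + |(k : ℝ)|) ^ 3)
    (hX : ContDiffAt ℝ 2 (fun z => X1 z ω) ϑ) (hT : jet η (fun z => X1 z ω) ϑ ≤ T) (n : ℕ) :
    ContDiffAt ℝ 2 (M.lik P n ω) ϑ ∧ ContDiffAt ℝ 2 (M.approxLik P X1 n ω) ϑ ∧
      jet η (fun z => M.approxLik P X1 n ω z - M.lik P n ω z) ϑ ≤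
        1 / (n : ℝ) * (likConst d c₀ ρ b * (R + T) ^ 2) := by
  have h1 := h.self_of_nhds
  have hs : ∀ᶠ z in 𝓝 ϑ, ∀ k, Summable fun i => M.stateTerm P k ω i z :=
    h.eventually_nhds.mono fun z hz k =>
      (FilterBounds.jet_statePrediction hz hη hc hρ hρ1 hb hR hY k).1
  have he := FilterBounds.jet_innovation h hη hc hρ hρ1 hb hR hY
  have hδ := FilterBounds.jet_innovationError h hη hc hρ hρ1 hb hR hY hX hT
  have hT0 : 0 ≤ T := (jet_nonneg hη.le _ _).trans hT
  have hs0 := stateConst_nonneg hc hρ hb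
  set c₂ := 1 + b * stateConst c₀ ρ b with hc₂
  set c₃ := b * c₀ * (8 * stateConst c₀ ρ b + 1) with hc₃
  have hc₂0 : 0 ≤ c₂ := by positivity
  have hc₃0 : 0 ≤ c₃ := by positivity
  have e := hs.mono fun z hz => approxLik_sub_lik (X1 := X1) hz n
  have hterm : ∀ k : ℕ, ContDiffAt ℝ 2 (fun z =>
      M.innovationError P X1 k ω z ⬝ᵥ ((M.V P z)⁻¹ *ᵥ M.innovation P (k + 1) z ω) +
        M.innovation P (k + 1) z ω ⬝ᵥ ((M.V P z)⁻¹ *ᵥ M.innovationError P X1 k ω z) +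
        M.innovationError P X1 k ω z ⬝ᵥ ((M.V P z)⁻¹ *ᵥ M.innovationError P X1 k ω z)) ϑ ∧
      jet η (fun z =>
      M.innovationError P X1 k ω z ⬝ᵥ ((M.V P z)⁻¹ *ᵥ M.innovation P (k + 1) z ω) +
        M.innovation P (k + 1) z ω ⬝ᵥ ((M.V P z)⁻¹ *ᵥ M.innovationError P X1 k ω z) +
        M.innovationError P X1 k ω z ⬝ᵥ ((M.V P z)⁻¹ *ᵥ M.innovationError P X1 k ω z)) ϑ ≤
      (d + 1) * b * (2 * (c₂ * c₃) + c₃ ^ 2) * (R + T) ^ 2 * (((k : ℝ) + 2) ^ 3 * ρ ^ k) := by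
    intro k
    obtain ⟨e1, e2⟩ := he (k + 1)
    obtain ⟨d1, d2⟩ := hδ k
    have e2' : jet η (fun z => M.innovation P (k + 1) z ω) ϑ ≤ c₂ * (R + T) * ((k : ℝ) + 2) ^ 3 := by
      refine e2.trans ?_
      push_cast
      rw [show (1 : ℝ) + (k + 1) = k + 2 by ring]
      gcongr
      linarith
    obtain ⟨a1, b1⟩ := jet_quadratic_le hη.le h1.smooth_V_inv d1 e1 h1.jet_V_inv d2 e2'
    obtain ⟨a2, b2⟩ := jet_quadratic_le hη.le h1.smooth_V_inv e1 d1 h1.jet_V_inv e2' d2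
    obtain ⟨a3, b3⟩ := jet_quadratic_le hη.le h1.smooth_V_inv d1 d1 h1.jet_V_inv d2 d2
    refine ⟨(a1.add a2).add a3, (jet_add_le hη.le (a1.add a2) a3).trans
      ((add_le_add (jet_add_le hη.le a1 a2) le_rfl).trans
        ((add_le_add (add_le_add b1 b2) b3).trans ?_))⟩
    -- The term quadratic in the error is of order ρ^(2k) and is absorbed into the cross terms.
    have i1 : ρ ^ k ≤ ((k : ℝ) + 2) ^ 3 :=
      (pow_le_one₀ hρ.le hρ1.le).trans (one_le_pow₀ (by linarith [(Nat.cast_nonneg k : (0:ℝ) ≤ k)]))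
    have i2 : (d + 1) * b * c₃ ^ 2 * (R + T) ^ 2 * ρ ^ k * ρ ^ k ≤
        (d + 1) * b * c₃ ^ 2 * (R + T) ^ 2 * ρ ^ k * ((k : ℝ) + 2) ^ 3 :=
      mul_le_mul_of_nonneg_left i1 (by positivity)
    linarith
  have hS := ContDiffAt.sum (s := Finset.range n) fun k _ => (hterm k).1
  have hcn : ContDiffAt ℝ 2 (fun _ : Param s₁ s₂ => 1 / (n : ℝ)) ϑ := contDiffAt_const
  have hlik : ContDiffAt ℝ 2 (M.lik P n ω) ϑ := by
    refine hcn.mul (ContDiffAt.sum fun k _ => ((contDiffAt_const.add h1.smooth_log_det).add ?_))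
    exact ContDiffAt.dotProduct (he k).1 (ContDiffAt.matrix_mulVec h1.smooth_V_inv (he k).1)
  refine ⟨hlik, ?_, ?_⟩
  -- Near ϑ the approximate likelihood is the exact one plus the explicit smooth difference.
  · refine (hlik.add (hcn.mul hS)).congr_of_eventuallyEq (e.mono fun z hz => ?_)
    rw [← sub_eq_iff_eq_add']
    exact hz
  · rw [jet_congr e]
    refine (jet_const_mul_le hη.le hS _).trans ?_
    rw [abs_of_nonneg (by positivity : 0 ≤ 1 / (n : ℝ))]
    refine mul_le_mul_of_nonneg_left ?_ (by positivity)
    refine (jet_sum_le hη.le _ fun k _ => (hterm k).1).trans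
      ((Finset.sum_le_sum fun k _ => (hterm k).2).trans ?_)
    rw [← Finset.mul_sum]
    refine (mul_le_mul_of_nonneg_left ((summable_add_two_pow_mul_geometric hρ hρ1).sum_le_tsum
      (Finset.range n) fun i _ => by positivity) (by positivity)).trans (le_of_eq ?_)
    rw [likConst]
    ring

end Bounds

/-- On the parameter space the difference of the two likelihoods is of order `1 / n` together with
its first two derivatives, for observations of polynomial growth. -/
theorem AssumptionA.exists_lik_bound (hA : M.AssumptionA P) [IsFiniteMeasure P] :
    ∃ c₁ : ℝ, ∀ ϑ ∈ M.Theta, ∀ (X1 : Param s₁ s₂ → Ω → (Fin c ⊕ Fin p → ℝ)) (ω : Ω) (R T : ℝ),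
      0 ≤ R → (∀ k : ℤ, ‖M.Yobs k ω‖ ≤ R * (1 + |(k : ℝ)|) ^ 3) →
      ContDiffAt ℝ 2 (fun z => X1 z ω) ϑ → jet 1 (fun z => X1 z ω) ϑ ≤ T →
      (∀ k, Summable (M.predictionTerm P ϑ k ω)) ∧
      ∀ n, ContDiffAt ℝ 2 (M.lik P n ω) ϑ ∧ ContDiffAt ℝ 2 (M.approxLik P X1 n ω) ϑ ∧
        jet 1 (fun z => M.approxLik P X1 n ω z - M.lik P n ω z) ϑ ≤
          1 / (n : ℝ) * (c₁ * (R + T) ^ 2) := by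
  -- The constant precedes the sample point, the bounds R, T and the starting value, hence is
  -- deterministic. Local constants are combined by a maximum.
  refine hA.compact.induction_on (p := fun s => ∃ c₁ : ℝ, ∀ ϑ ∈ s,
    ∀ (X1 : Param s₁ s₂ → Ω → (Fin c ⊕ Fin p → ℝ)) (ω : Ω) (R T : ℝ),
      0 ≤ R → (∀ k : ℤ, ‖M.Yobs k ω‖ ≤ R * (1 + |(k : ℝ)|) ^ 3) →
      ContDiffAt ℝ 2 (fun z => X1 z ω) ϑ → jet 1 (fun z => X1 z ω) ϑ ≤ T →
      (∀ k, Summable (M.predictionTerm P ϑ k ω)) ∧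
      ∀ n, ContDiffAt ℝ 2 (M.lik P n ω) ϑ ∧ ContDiffAt ℝ 2 (M.approxLik P X1 n ω) ϑ ∧
        jet 1 (fun z => M.approxLik P X1 n ω z - M.lik P n ω z) ϑ ≤
          1 / (n : ℝ) * (c₁ * (R + T) ^ 2)) ?_ ?_ ?_ ?_
  · exact ⟨0, fun ϑ h => absurd h (Set.notMem_empty ϑ)⟩
  · rintro s t hst ⟨c₁, h⟩
    exact ⟨c₁, fun ϑ hϑ => h ϑ (hst hϑ)⟩
  · have mono : ∀ {n : ℕ} {a b r x : ℝ}, a ≤ b → x ≤ 1 / (n : ℝ) * (a * r ^ 2) →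
        x ≤ 1 / (n : ℝ) * (b * r ^ 2) := fun hab hx => hx.trans (by gcongr)
    rintro s t ⟨a, ha⟩ ⟨b, hb⟩
    refine ⟨max a b, fun ϑ hϑ X1 ω R T h1 h2 h3 h4 => ?_⟩
    rcases hϑ with hϑ | hϑ
    · obtain ⟨h5, h6⟩ := ha ϑ hϑ X1 ω R T h1 h2 h3 h4
      exact ⟨h5, fun n => ⟨(h6 n).1, (h6 n).2.1, mono (le_max_left _ _) (h6 n).2.2⟩⟩
    · obtain ⟨h5, h6⟩ := hb ϑ hϑ X1 ω R T h1 h2 h3 h4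
      exact ⟨h5, fun n => ⟨(h6 n).1, (h6 n).2.1, mono (le_max_right _ _) (h6 n).2.2⟩⟩
  · intro ϑ hϑ
    obtain ⟨η, c₀, ρ, b, hη, hη1, hc, hρ, hρ1, hb, h⟩ := hA.exists_filterBounds hϑ
    -- The weight η depends on the neighbourhood; passing to weight 1 at the cost (η²)⁻¹ makes the
    -- local bounds comparable.
    refine ⟨{z | ∀ᶠ z in 𝓝 z, M.FilterBounds P η c₀ ρ b z},
      nhdsWithin_le_nhds h.eventually_nhds, (η ^ 2)⁻¹ * likConst d c₀ ρ b, ?_⟩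
    intro z hz X1 ω R T h1 h2 h3 h4
    have hz' : ∀ᶠ z in 𝓝 z, M.FilterBounds P η c₀ ρ b z := hz
    refine ⟨fun k => (hasSum_predictionTerm (FilterBounds.jet_statePrediction hz' hη hc hρ hρ1 hb h1
      h2 k).1).summable, fun n => ?_⟩
    obtain ⟨l1, l2, l3⟩ := FilterBounds.lik_bounds hz' hη hc hρ hρ1 hb h1 h2 h3
      ((jet_le_jet_one hη.le hη1 _).trans h4) n
    refine ⟨l1, l2, (jet_one_le hη hη1 _).trans ((mul_le_mul_of_nonneg_left l3
      (by positivity)).trans (le_of_eq ?_))⟩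
    ring

end Model

end CointSSM

namespace CointSSM

/-! ### Partial derivatives versus jets -/

section PartialDerivatives

variable {s₁ s₂ : ℕ} {X : Type*} [NormedAddCommGroup X] [NormedSpace ℝ X]
  {f g : Param s₁ s₂ → X} {x : Param s₁ s₂}

theorem partialDeriv_eq_fderiv (hf : DifferentiableAt ℝ f x) (u : Fin s₁ ⊕ Fin s₂) :
    partialDeriv u f x = fderiv ℝ f x (coordVec u) :=
  hf.lineDeriv_eq_fderiv

theorem partialDeriv_eventuallyEq (hf : ContDiffAt ℝ 2 f x) (v : Fin s₁ ⊕ Fin s₂) :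
    partialDeriv v f =ᶠ[𝓝 x] fun y => fderiv ℝ f y (coordVec v) :=
  (eventually_differentiableAt hf).mono fun _ hy => partialDeriv_eq_fderiv hy v

theorem contDiffAt_partialDeriv (hf : ContDiffAt ℝ 2 f x) (v : Fin s₁ ⊕ Fin s₂) :
    ContDiffAt ℝ 1 (partialDeriv v f) x :=
  ((hf.fderiv_right (m := 1) (by norm_num)).clm_apply contDiffAt_const).congr_of_eventuallyEq
    (partialDeriv_eventuallyEq hf v)

theorem partialDeriv_partialDeriv_eq (hf : ContDiffAt ℝ 2 f x) (u v : Fin s₁ ⊕ Fin s₂) :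
    partialDeriv u (partialDeriv v f) x = fderiv ℝ (fderiv ℝ f) x (coordVec u) (coordVec v) := by
  have h1 : HasFDerivAt (fun y => fderiv ℝ f y (coordVec v))
      ((fderiv ℝ (fderiv ℝ f) x).flip (coordVec v)) x :=
    (ContinuousLinearMap.apply ℝ X (coordVec v)).hasFDerivAt.comp x
      (differentiableAt_fderiv hf).hasFDerivAt
  rw [partialDeriv_eq_fderiv ((contDiffAt_partialDeriv hf v).differentiableAt (by norm_num)),
    (partialDeriv_eventuallyEq hf v).fderiv_eq, h1.fderiv]
  rfl

theorem partialDeriv_sub (hf : DifferentiableAt ℝ f x) (hg : DifferentiableAt ℝ g x)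
    (u : Fin s₁ ⊕ Fin s₂) :
    partialDeriv u (fun y => f y - g y) x = partialDeriv u f x - partialDeriv u g x := by
  rw [partialDeriv_eq_fderiv (hf.fun_sub hg), partialDeriv_eq_fderiv hf, partialDeriv_eq_fderiv hg,
    fderiv_fun_sub hf hg]
  rfl

theorem partialDeriv_partialDeriv_sub (hf : ContDiffAt ℝ 2 f x) (hg : ContDiffAt ℝ 2 g x)
    (u v : Fin s₁ ⊕ Fin s₂) :
    partialDeriv u (partialDeriv v fun y => f y - g y) x =
      partialDeriv u (partialDeriv v f) x - partialDeriv u (partialDeriv v g) x := by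
  have e : partialDeriv v (fun y => f y - g y) =ᶠ[𝓝 x]
      fun y => partialDeriv v f y - partialDeriv v g y := by
    filter_upwards [eventually_differentiableAt hf, eventually_differentiableAt hg] with y h1 h2
    exact partialDeriv_sub h1 h2 v
  rw [← partialDeriv_sub ((contDiffAt_partialDeriv hf v).differentiableAt (by norm_num))
    ((contDiffAt_partialDeriv hg v).differentiableAt (by norm_num))]
  exact e.lineDeriv_eq

theorem norm_pi_single_one_le {n : ℕ} (i : Fin n) : ‖(Pi.single i 1 : Fin n → ℝ)‖ ≤ 1 :=
  (pi_norm_le_iff_of_nonneg zero_le_one).2 fun k => by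
    rw [Pi.single_apply]; split_ifs <;> simp

theorem norm_coordVec_le (u : Fin s₁ ⊕ Fin s₂) : ‖(coordVec u : Param s₁ s₂)‖ ≤ 1 := by
  rcases u with i | j
  · simpa [coordVec, Prod.norm_def] using norm_pi_single_one_le i
  · simpa [coordVec, Prod.norm_def] using norm_pi_single_one_le j

theorem norm_le_sum_coordVec (T : Param s₁ s₂ →L[ℝ] X) : ‖T‖ ≤ ∑ u, ‖T (coordVec u)‖ := by
  refine T.opNorm_le_bound (by positivity) fun y => ?_
  have hy : y = ∑ u : Fin s₁ ⊕ Fin s₂, Sum.elim y.1 y.2 u • coordVec u := by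
    rw [Fintype.sum_sum_type]
    refine Prod.ext ?_ ?_
    · ext i
      simp [coordVec, Prod.fst_sum, Pi.single_apply]
    · ext i
      simp [coordVec, Prod.snd_sum, Pi.single_apply]
  have h1 : ∀ u : Fin s₁ ⊕ Fin s₂, ‖Sum.elim y.1 y.2 u‖ ≤ ‖y‖ := by
    rintro (i | j)
    · exact (norm_le_pi_norm y.1 i).trans (norm_fst_le y)
    · exact (norm_le_pi_norm y.2 j).trans (norm_snd_le y)
  conv_lhs => rw [hy]
  rw [map_sum, Finset.sum_mul]
  refine norm_sum_le_of_le _ fun u _ => ?_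
  rw [map_smul, norm_smul, mul_comm]
  exact mul_le_mul_of_nonneg_left (h1 u) (norm_nonneg _)

theorem norm_partialDeriv_le_jet (hf : DifferentiableAt ℝ f x) (u : Fin s₁ ⊕ Fin s₂) :
    ‖partialDeriv u f x‖ ≤ jet 1 f x := by
  rw [partialDeriv_eq_fderiv hf]
  have h1 := norm_fderiv_le_jet zero_le_one f x
  rw [one_mul] at h1
  refine ((fderiv ℝ f x).le_opNorm _).trans (le_trans ?_ h1)
  exact mul_le_of_le_one_right (norm_nonneg _) (norm_coordVec_le u)

theorem norm_partialDeriv_partialDeriv_le_jet (hf : ContDiffAt ℝ 2 f x) (u v : Fin s₁ ⊕ Fin s₂) :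
    ‖partialDeriv u (partialDeriv v f) x‖ ≤ 2 * jet 1 f x := by
  rw [partialDeriv_partialDeriv_eq hf]
  have h1 := norm_fderiv_fderiv_le_jet zero_le_one f x
  have h2 : ‖fderiv ℝ (fderiv ℝ f) x (coordVec u) (coordVec v)‖ ≤ ‖fderiv ℝ (fderiv ℝ f) x‖ := by
    refine ((fderiv ℝ (fderiv ℝ f) x (coordVec u)).le_opNorm _).trans ?_
    refine (mul_le_of_le_one_right (norm_nonneg _) (norm_coordVec_le v)).trans ?_
    refine ((fderiv ℝ (fderiv ℝ f) x).le_opNorm _).trans ?_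
    exact mul_le_of_le_one_right (norm_nonneg _) (norm_coordVec_le u)
  linarith

/-- The sum of the norms of the partial derivatives of order at most two. -/
noncomputable def partialJet (f : Param s₁ s₂ → X) (x : Param s₁ s₂) : ℝ :=
  ‖f x‖ + ∑ u, ‖partialDeriv u f x‖ + ∑ u, ∑ v, ‖partialDeriv u (partialDeriv v f) x‖

theorem jet_le_partialJet (hf : ContDiffAt ℝ 2 f x) : jet 1 f x ≤ partialJet f x := by
  have h1 : ‖fderiv ℝ f x‖ ≤ ∑ u, ‖partialDeriv u f x‖ := by
    simp_rw [partialDeriv_eq_fderiv (hf.differentiableAt (by norm_num))]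
    exact norm_le_sum_coordVec _
  have h2 : ‖fderiv ℝ (fderiv ℝ f) x‖ ≤ ∑ u, ∑ v, ‖partialDeriv u (partialDeriv v f) x‖ := by
    simp_rw [partialDeriv_partialDeriv_eq hf]
    exact (norm_le_sum_coordVec (fderiv ℝ (fderiv ℝ f) x)).trans
      (Finset.sum_le_sum fun u _ => norm_le_sum_coordVec _)
  have h3 := norm_nonneg (fderiv ℝ (fderiv ℝ f) x)
  unfold jet partialJet
  linarith

theorem continuousAt_partialJet (hf : ContDiffAt ℝ 2 f x) : ContinuousAt (partialJet f) x := by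
  refine (hf.continuousAt.norm.add (tendsto_finsetSum _ fun u _ => ?_)).add
    (tendsto_finsetSum _ fun u _ => tendsto_finsetSum _ fun v _ => ?_)
  · exact (contDiffAt_partialDeriv hf u).continuousAt.norm
  · have h1 : ContinuousAt (fun y => fderiv ℝ (partialDeriv v f) y (coordVec u)) x :=
      (((contDiffAt_partialDeriv hf v).fderiv_right (m := 0) (by norm_num)).clm_apply
        contDiffAt_const).continuousAt
    refine (h1.congr ?_).norm
    filter_upwards [(contDiffAt_partialDeriv hf v).eventually (by decide)] with y hy
    exact (partialDeriv_eq_fderiv (hy.differentiableAt (by norm_num)) u).symm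

/-- The difference quotients of `f` in direction `u` at `x` with steps `1 / (n + 1)`. -/
noncomputable def differenceQuotient (u : Fin s₁ ⊕ Fin s₂) (f : Param s₁ s₂ → X)
    (x : Param s₁ s₂) (n : ℕ) : X :=
  (1 / ((n : ℝ) + 1))⁻¹ • (f (x + (1 / ((n : ℝ) + 1)) • coordVec u) - f x)

theorem tendsto_differenceQuotient (hf : DifferentiableAt ℝ f x) (u : Fin s₁ ⊕ Fin s₂) :
    Tendsto (differenceQuotient u f x) atTop (𝓝 (partialDeriv u f x)) := by
  have h1 := (hf.lineDifferentiableAt (v := coordVec u)).hasLineDerivAt.tendsto_slope_zero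
  refine h1.comp (tendsto_nhdsWithin_iff.2 ⟨tendsto_one_div_add_atTop_nhds_zero_nat, ?_⟩)
  exact Eventually.of_forall fun n => (by positivity : (1 : ℝ) / ((n : ℝ) + 1) ≠ 0)

theorem tendsto_add_smul_coordVec (x : Param s₁ s₂) (u : Fin s₁ ⊕ Fin s₂) :
    Tendsto (fun n : ℕ => x + (1 / ((n : ℝ) + 1)) • (coordVec u : Param s₁ s₂)) atTop (𝓝 x) := by
  have h1 := (tendsto_one_div_add_atTop_nhds_zero_nat (𝕜 := ℝ)).smul_const
    (coordVec u : Param s₁ s₂)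
  simpa using tendsto_const_nhds.add h1

end PartialDerivatives

/-! ### Measurable bounds for random functions -/

section RandomFunctions

variable {Ω : Type*} [MeasurableSpace Ω] {P : Measure Ω} {s₁ s₂ : ℕ} {X : Type*}
  [NormedAddCommGroup X] [NormedSpace ℝ X] [FiniteDimensional ℝ X] [MeasurableSpace X]
  [BorelSpace X] {ξ : Param s₁ s₂ → Ω → X}

/-- A measurable version of the partial derivative of a random function. -/
noncomputable def randomPartialDeriv (u : Fin s₁ ⊕ Fin s₂) (ξ : Param s₁ s₂ → Ω → X)
    (x : Param s₁ s₂) (ω : Ω) : X :=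
  limUnder atTop fun n => differenceQuotient u (fun y => ξ y ω) x n

/-- A limit along a fixed sequence of steps is measurable in ω, including where the derivative fails
to exist. -/
theorem measurable_randomPartialDeriv (hξ : ∀ x, Measurable (ξ x)) (u : Fin s₁ ⊕ Fin s₂)
    (x : Param s₁ s₂) : Measurable (randomPartialDeriv u ξ x) := by
  have : CompleteSpace X := FiniteDimensional.complete ℝ X
  have : ProperSpace X := FiniteDimensional.proper ℝ X
  exact (StronglyMeasurable.limUnder (l := atTop) (f := fun n ω => differenceQuotient u (fun y => ξ y ω) x n) fun n =>
    ((((hξ _).sub (hξ x)).const_smul _).stronglyMeasurable)).measurable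

theorem randomPartialDeriv_eq {x : Param s₁ s₂} {ω : Ω}
    (h : DifferentiableAt ℝ (fun y => ξ y ω) x) (u : Fin s₁ ⊕ Fin s₂) :
    randomPartialDeriv u ξ x ω = partialDeriv u (fun y => ξ y ω) x :=
  (tendsto_differenceQuotient h u).limUnder_eq

/-- The inner derivative is the true one at all points near x, hence at the points used by the outer
quotient once the step is small. -/
theorem randomPartialDeriv_randomPartialDeriv_eq {x : Param s₁ s₂} {ω : Ω}
    (h : ContDiffAt ℝ 2 (fun y => ξ y ω) x) (u v : Fin s₁ ⊕ Fin s₂) :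
    randomPartialDeriv u (randomPartialDeriv v ξ) x ω =
      partialDeriv u (partialDeriv v fun y => ξ y ω) x := by
  have h1 : ∀ᶠ y in 𝓝 x, randomPartialDeriv v ξ y ω = partialDeriv v (fun y => ξ y ω) y :=
    (eventually_differentiableAt h).mono fun y hy => randomPartialDeriv_eq hy v
  have h2 := tendsto_differenceQuotient
    ((contDiffAt_partialDeriv h v).differentiableAt (by norm_num)) u
  refine (h2.congr' ?_).limUnder_eq
  filter_upwards [(tendsto_add_smul_coordVec x u).eventually h1] with n hn
  rw [differenceQuotient, differenceQuotient, hn, h1.self_of_nhds]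

/-- The jets of a smooth random function are bounded on a compact set by a random variable. -/
theorem exists_measurable_jet_bound {K : Set (Param s₁ s₂)} (hK : IsCompact K)
    (hξ : ∀ x, Measurable (ξ x))
    (hs : ∀ᵐ ω ∂P, ∀ x ∈ K, ContDiffAt ℝ 2 (fun y => ξ y ω) x) :
    ∃ T : Ω → ℝ, Measurable T ∧ ∀ᵐ ω ∂P, ∀ x ∈ K, jet 1 (fun y => ξ y ω) x ≤ T ω := by
  -- The supremum over a countable dense subset is measurable, and continuity of the partial
  -- derivatives extends the bound to K.
  obtain ⟨D, hDK, hDc, hDd⟩ :=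
    (TopologicalSpace.IsSeparable.of_separableSpace K).exists_countable_dense_subset
  let J : Param s₁ s₂ → Ω → ℝ := fun x ω => ‖ξ x ω‖ + ∑ u, ‖randomPartialDeriv u ξ x ω‖ +
    ∑ u, ∑ v, ‖randomPartialDeriv u (randomPartialDeriv v ξ) x ω‖
  have hJm : ∀ x, Measurable (J x) := fun x =>
    ((hξ x).norm.add (Finset.measurable_fun_sum _ fun u _ =>
      (measurable_randomPartialDeriv hξ u x).norm)).add
      (Finset.measurable_fun_sum _ fun u _ => Finset.measurable_fun_sum _ fun v _ =>
        (measurable_randomPartialDeriv (measurable_randomPartialDeriv hξ v) u x).norm)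
  refine ⟨fun ω => (⨆ x ∈ D, ENNReal.ofReal (J x ω)).toReal,
    (Measurable.biSup D hDc fun x _ => (hJm x).ennreal_ofReal).ennreal_toReal, ?_⟩
  filter_upwards [hs] with ω hω
  have hJ : ∀ x ∈ K, J x ω = partialJet (fun y => ξ y ω) x := fun x hx => by
    simp only [J, partialJet, randomPartialDeriv_randomPartialDeriv_eq (hω x hx),
      randomPartialDeriv_eq ((hω x hx).differentiableAt (by norm_num))]
  obtain ⟨c, hc⟩ := hK.exists_bound_of_continuousOn (f := partialJet fun y => ξ y ω) fun x hx =>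
    (continuousAt_partialJet (hω x hx)).continuousWithinAt
  -- Needed since `toReal` sends ∞ to 0; finiteness comes from compactness of K.
  have hfin : ⨆ x ∈ D, ENNReal.ofReal (J x ω) ≠ ∞ := by
    refine ne_top_of_le_ne_top (b := ENNReal.ofReal c) ENNReal.ofReal_ne_top
      (iSup₂_le fun x hx => ENNReal.ofReal_le_ofReal ?_)
    rw [hJ x (hDK hx)]
    exact (le_abs_self _).trans (hc x (hDK hx))
  intro x hx
  refine (jet_le_partialJet (hω x hx)).trans ?_
  have : (𝓝[D] x).NeBot := mem_closure_iff_nhdsWithin_neBot.1 (hDd hx)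
  have hlim : Tendsto (partialJet fun y => ξ y ω) (𝓝[D] x) (𝓝 (partialJet (fun y => ξ y ω) x)) :=
    (continuousAt_partialJet (hω x hx)).continuousWithinAt
  refine le_of_tendsto hlim (eventually_of_mem self_mem_nhdsWithin fun y hy => ?_)
  rw [← hJ y (hDK hy), ← ENNReal.toReal_ofReal (r := J y ω) (by positivity)]
  exact ENNReal.toReal_mono hfin (le_iSup₂ (f := fun x _ => ENNReal.ofReal (J x ω)) y hy)

end RandomFunctions

/-- A sequence of random functions dominated by `B / n`, for a random variable `B`. -/
theorem negligibleAtRate_of_le {Ω E : Type*} [MeasurableSpace Ω] {P : Measure Ω}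
    [IsFiniteMeasure P] {S : Set E} {γ : ℝ} (hγ : γ < 1) {f : ℕ → E → Ω → ℝ} {B : Ω → ℝ}
    (hB : Measurable B) (h : ∀ᵐ ω ∂P, ∀ n : ℕ, ∀ x ∈ S, ‖f n x ω‖ ≤ 1 / (n : ℝ) * B ω) :
    NegligibleAtRate P S γ f := by
  intro ε hε
  have hlim : Tendsto (fun n : ℕ => (n : ℝ) ^ (γ - 1)) atTop (𝓝 0) := by
    have := (tendsto_rpow_neg_atTop (sub_pos.2 hγ)).comp tendsto_natCast_atTop_atTop
    simpa [Function.comp_def] using this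
  have h1 : TendstoInMeasure P (fun (n : ℕ) ω => (n : ℝ) ^ (γ - 1) * B ω) atTop (fun _ => (0 : ℝ)) :=
    tendstoInMeasure_of_tendsto_ae (fun n => (hB.const_mul _).aestronglyMeasurable)
      (Eventually.of_forall fun ω => by simpa using hlim.mul_const (B ω))
  refine tendsto_of_tendsto_of_tendsto_of_le_of_le' tendsto_const_nhds (h1 ε hε)
    (Eventually.of_forall fun _ => zero_le) ?_
  filter_upwards [eventually_gt_atTop 0] with n hn
  have hn' : (0 : ℝ) < n := by exact_mod_cast hn
  -- The event with the supremum over S need not be measurable; monotonicity of the outer measure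
  -- suffices.
  refine measure_mono_ae ?_
  filter_upwards [h] with ω hω hε'
  refine le_trans hε' ?_
  rw [edist_zero_right]
  calc _ ≤ ENNReal.ofReal ((n : ℝ) ^ γ) * ENNReal.ofReal (1 / (n : ℝ) * B ω) := by
        gcongr
        refine iSup₂_le fun x hx => ?_
        rw [← ofReal_norm]
        exact ENNReal.ofReal_le_ofReal (hω n x hx)
    _ = ENNReal.ofReal ((n : ℝ) ^ (γ - 1) * B ω) := by
        rw [← ENNReal.ofReal_mul (by positivity), Real.rpow_sub hn', Real.rpow_one]
        congr 1
        ring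
    _ ≤ _ := by
        rw [← ofReal_norm]
        exact ENNReal.ofReal_le_ofReal (le_abs_self _)

end CointSSM

namespace CointSSM

/-! ### A pathwise estimate for linear integral equations -/

section LinearIntegralEquation

variable {V : Type*} [NormedAddCommGroup V] [NormedSpace ℝ V] [CompleteSpace V]

/-- Gronwall's inequality in integral form. -/
theorem le_mul_exp_of_le_add_integral {g : ℝ → ℝ} {a D τ : ℝ} (hg : Continuous g)
    (ha : 0 ≤ a) (hτ : 0 ≤ τ) (h : ∀ t ∈ Set.Icc 0 τ, g t ≤ D + a * ∫ u in (0 : ℝ)..t, g u) :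
    g τ ≤ D * Real.exp (a * τ) := by
  set φ : ℝ → ℝ := fun t => D + a * ∫ u in (0 : ℝ)..t, g u with hφ
  have hd : ∀ t, HasDerivAt φ (a * g t) t := fun t =>
    ((hg.integral_hasStrictDerivAt 0 t).hasDerivAt.const_mul a).const_add D
  have hd2 : ∀ t, HasDerivAt (fun t => Real.exp (-(a * t)) * φ t)
      (Real.exp (-(a * t)) * (-(a * 1)) * φ t + Real.exp (-(a * t)) * (a * g t)) t := fun t =>
    (((hasDerivAt_id t).const_mul a).neg.exp).mul (hd t)
  have hanti : AntitoneOn (fun t => Real.exp (-(a * t)) * φ t) (Set.Icc 0 τ) := by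
    refine antitoneOn_of_deriv_nonpos (convex_Icc 0 τ)
      (fun t _ => (hd2 t).continuousAt.continuousWithinAt)
      (fun t _ => (hd2 t).differentiableAt.differentiableWithinAt) fun t ht => ?_
    rw [(hd2 t).deriv]
    have h1 := h t (interior_subset ht)
    have h2 : 0 ≤ Real.exp (-(a * t)) * a * (φ t - g t) :=
      mul_nonneg (mul_nonneg (Real.exp_pos _).le ha) (sub_nonneg.2 h1)
    linarith
  have h3 := hanti (Set.left_mem_Icc.2 hτ) (Set.right_mem_Icc.2 hτ) hτ
  have h4 : φ 0 = D := by simp [hφ]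
  simp only [mul_zero, neg_zero, Real.exp_zero, one_mul, h4] at h3
  have h5 := mul_le_mul_of_nonneg_left h3 (Real.exp_pos (a * τ)).le
  rw [← mul_assoc, ← Real.exp_add, add_neg_cancel, Real.exp_zero, one_mul, mul_comm] at h5
  exact (h τ (Set.right_mem_Icc.2 hτ)).trans h5

/-- The solution of `X t = X 0 + ∫₀ᵗ T X + ℓ t` stays close to that of the homogeneous equation. -/
theorem enorm_sub_le_of_integral_equation (T : V →L[ℝ] V) {X e ℓ : ℝ → V} {τ : ℝ} (hτ : 0 ≤ τ)
    (hX : ∀ s t, IntervalIntegrable X volume s t)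
    (heq : ∀ t, 0 ≤ t → X t - X 0 = (∫ u in (0 : ℝ)..t, T (X u)) + ℓ t)
    (he : ∀ t, HasDerivAt e (T (e t)) t) (he0 : e 0 = X 0) :
    ‖X τ - e τ‖ₑ ≤ ‖ℓ τ‖ₑ + ENNReal.ofReal (‖T‖ * Real.exp (‖T‖ * τ)) *
      ∫⁻ s in Set.Ioc 0 τ, ‖ℓ s‖ₑ := by
  have hec : Continuous e := continuous_iff_continuousAt.2 fun t => (he t).continuousAt
  set W : ℝ → V := fun t => X t - e t with hW
  have hWi : ∀ s t, IntervalIntegrable W volume s t := fun s t =>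
    (hX s t).sub (hec.intervalIntegrable s t)
  have hTi : ∀ {f : ℝ → V} (s t : ℝ), IntervalIntegrable f volume s t →
      IntervalIntegrable (fun u => T (f u)) volume s t := fun s t hf =>
    ⟨T.integrable_comp hf.1, T.integrable_comp hf.2⟩
  -- Unlike X, which may jump with ℓ, the integral v is continuous, so Gronwall's inequality is
  -- applied to it; W = v + ℓ.
  set v : ℝ → V := fun t => ∫ u in (0 : ℝ)..t, T (W u) with hv
  have hvc : Continuous v := intervalIntegral.continuous_primitive (fun s t => hTi s t (hWi s t)) 0
  have hWv : ∀ t, 0 ≤ t → W t = v t + ℓ t := by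
    intro t ht
    have h1 : ∫ u in (0 : ℝ)..t, T (e u) = e t - e 0 :=
      intervalIntegral.integral_eq_sub_of_hasDerivAt (fun u _ => he u)
        (hTi 0 t (hec.intervalIntegrable 0 t))
    have h2 : v t = (∫ u in (0 : ℝ)..t, T (X u)) - ∫ u in (0 : ℝ)..t, T (e u) := by
      rw [← intervalIntegral.integral_sub (hTi 0 t (hX 0 t))
        (hTi 0 t (hec.intervalIntegrable 0 t))]
      simp only [hv, hW, map_sub]
    rw [h2, h1, he0, sub_add_eq_add_sub, ← heq t ht, hW]
    simp only
    abel
  have hℓi : IntegrableOn ℓ (Set.Ioc 0 τ) := by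
    have h1 := (hWi 0 τ).sub (hvc.intervalIntegrable 0 τ)
    rw [intervalIntegrable_iff_integrableOn_Ioc_of_le hτ] at h1
    refine h1.congr_fun (fun t ht => ?_) measurableSet_Ioc
    simp [hWv t ht.1.le]
  have hℓn : IntervalIntegrable (fun u => ‖ℓ u‖) volume 0 τ :=
    (intervalIntegrable_iff_integrableOn_Ioc_of_le hτ).2 hℓi.norm
  have hbound : ∀ t ∈ Set.Icc 0 τ, ‖v t‖ ≤
      ‖T‖ * (∫ u in (0 : ℝ)..τ, ‖ℓ u‖) + ‖T‖ * ∫ u in (0 : ℝ)..t, ‖v u‖ := by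
    intro t ht
    have hsub : Set.uIcc 0 t ⊆ Set.uIcc 0 τ := by
      rw [Set.uIcc_of_le ht.1, Set.uIcc_of_le hτ]; exact Set.Icc_subset_Icc_right ht.2
    have i1 : IntervalIntegrable (fun u => ‖T‖ * ‖ℓ u‖) volume 0 t :=
      (hℓn.mono_set hsub).const_mul _
    have i2 : IntervalIntegrable (fun u => ‖T‖ * ‖v u‖) volume 0 t :=
      (hvc.norm.intervalIntegrable 0 t).const_mul _
    calc ‖v t‖ ≤ ∫ u in (0 : ℝ)..t, ‖T (W u)‖ :=
          intervalIntegral.norm_integral_le_integral_norm ht.1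
      _ ≤ ∫ u in (0 : ℝ)..t, (‖T‖ * ‖ℓ u‖ + ‖T‖ * ‖v u‖) := by
          refine intervalIntegral.integral_mono_on ht.1 (hTi 0 t (hWi 0 t)).norm (i1.add i2)
            fun u hu => ?_
          rw [← mul_add]
          refine (T.le_opNorm _).trans (mul_le_mul_of_nonneg_left ?_ (norm_nonneg _))
          rw [hWv u hu.1, add_comm]
          exact norm_add_le _ _
      _ = ‖T‖ * (∫ u in (0 : ℝ)..t, ‖ℓ u‖) + ‖T‖ * ∫ u in (0 : ℝ)..t, ‖v u‖ := by
          rw [intervalIntegral.integral_add i1 i2, intervalIntegral.integral_const_mul,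
            intervalIntegral.integral_const_mul]
      _ ≤ _ := by
          gcongr
          exact intervalIntegral.integral_mono_interval le_rfl ht.1 ht.2
            (Eventually.of_forall fun _ => norm_nonneg _) hℓn
  have hfin := le_mul_exp_of_le_add_integral hvc.norm (norm_nonneg T) hτ hbound
  have hD : ENNReal.ofReal (∫ u in (0 : ℝ)..τ, ‖ℓ u‖) = ∫⁻ s in Set.Ioc 0 τ, ‖ℓ s‖ₑ := by
    rw [intervalIntegral.integral_of_le hτ, ofReal_integral_norm_eq_lintegral_enorm hℓi]
  rw [← hD, ← ENNReal.ofReal_mul (by positivity), add_comm]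
  have h6 : X τ - e τ = v τ + ℓ τ := hWv τ hτ
  rw [h6]
  refine (enorm_add_le _ _).trans (add_le_add ?_ le_rfl)
  rw [← ofReal_norm]
  refine ENNReal.ofReal_le_ofReal (hfin.trans (le_of_eq ?_))
  ring

end LinearIntegralEquation

/-! ### Tail bounds and polynomial growth -/

section BorelCantelli

variable {Ω : Type*} [MeasurableSpace Ω] {P : Measure Ω} {F : Type*} [NormedAddCommGroup F]

theorem summable_inv_one_add_abs_sq : Summable fun k : ℤ => ((1 + |(k : ℝ)|) ^ 2)⁻¹ := by
  have h : Summable fun n : ℕ => ((1 + (n : ℝ)) ^ 2)⁻¹ := by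
    have h1 := (summable_nat_add_iff 1).2 (Real.summable_nat_pow_inv.2 (by norm_num : 1 < 2))
    refine h1.congr fun n => ?_
    push_cast
    rw [add_comm]
  refine Summable.of_nat_of_neg ?_ ?_
  · simpa using h
  · simpa using h

/-- Random variables indexed by the integers whose tails are of order `(1 + |k|) / t` grow
polynomially. -/
theorem ae_exists_growth_bound {ξ : ℤ → Ω → F} {b : ℝ≥0∞} (hb : b ≠ ∞)
    (h : ∀ (k : ℤ) (t : ℝ), 0 < t → P {ω | ENNReal.ofReal t ≤ ‖ξ k ω‖ₑ} ≤
      b * ENNReal.ofReal ((1 + |(k : ℝ)|) / t)) :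
    ∀ᵐ ω ∂P, ∃ R : ℝ, 0 ≤ R ∧ ∀ k : ℤ, ‖ξ k ω‖ ≤ R * (1 + |(k : ℝ)|) ^ 3 := by
  have hpos : ∀ k : ℤ, (0 : ℝ) < 1 + |(k : ℝ)| := fun k => by positivity
  -- The cubic threshold turns the tail (1 + |k|) / t into the summable (1 + |k|)^(-2). Almost
  -- surely only finitely many k exceed it, and their norms are added to R.
  have hsum : ∑' k : ℤ, P {ω | ENNReal.ofReal ((1 + |(k : ℝ)|) ^ 3) ≤ ‖ξ k ω‖ₑ} ≠ ∞ := by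
    refine ne_top_of_le_ne_top (b := ∑' k : ℤ, b * ENNReal.ofReal ((1 + |(k : ℝ)|) ^ 2)⁻¹) ?_
      (ENNReal.tsum_le_tsum fun k => ?_)
    · rw [ENNReal.tsum_mul_left]
      exact ENNReal.mul_ne_top hb (summable_inv_one_add_abs_sq.tsum_ofReal_ne_top)
    · refine (h k _ (by have := hpos k; positivity)).trans (le_of_eq ?_)
      congr 2
      have := (hpos k).ne'
      field_simp
  filter_upwards [ae_finite_setOfPred_mem hsum] with ω hω
  set S := {k : ℤ | ω ∈ {ω | ENNReal.ofReal ((1 + |(k : ℝ)|) ^ 3) ≤ ‖ξ k ω‖ₑ}}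
  have hS : S.Finite := hω
  refine ⟨1 + ∑ k ∈ hS.toFinset, ‖ξ k ω‖, by positivity, fun k => ?_⟩
  have h1 : 1 ≤ (1 + |(k : ℝ)|) ^ 3 := one_le_pow₀ (by linarith [abs_nonneg (k : ℝ)])
  have h2 : 0 ≤ ∑ k ∈ hS.toFinset, ‖ξ k ω‖ := by positivity
  by_cases hk : k ∈ S
  · have h3 : ‖ξ k ω‖ ≤ ∑ k ∈ hS.toFinset, ‖ξ k ω‖ :=
      Finset.single_le_sum (f := fun k => ‖ξ k ω‖) (fun _ _ => norm_nonneg _)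
        (hS.mem_toFinset.2 hk)
    nlinarith
  · have h3 : ¬ ENNReal.ofReal ((1 + |(k : ℝ)|) ^ 3) ≤ ‖ξ k ω‖ₑ := hk
    rw [← ofReal_norm, ENNReal.ofReal_le_ofReal_iff (norm_nonneg _), not_le] at h3
    nlinarith

/-- A contraction with an integrable perturbation has a weak first moment in equilibrium. -/
theorem measure_le_of_contraction [IsFiniteMeasure P] {U U' : Ω → F} {N : Ω → ℝ≥0∞} {r : ℝ} {b : ℝ≥0∞}
    (hr0 : 0 ≤ r) (hr : r < 1) (hb : b ≠ ∞) (hU : AEStronglyMeasurable U P)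
    (hN : ∀ t : ℝ, 0 < t → P {ω | ENNReal.ofReal t ≤ N ω} ≤ b * ENNReal.ofReal t⁻¹)
    (hle : ∀ᵐ ω ∂P, ‖U' ω‖ₑ ≤ ENNReal.ofReal r * ‖U ω‖ₑ + N ω)
    (hid : ∀ t : ℝ, P {ω | ENNReal.ofReal t ≤ ‖U' ω‖ₑ} = P {ω | ENNReal.ofReal t ≤ ‖U ω‖ₑ}) :
    ∃ c : ℝ≥0∞, c ≠ ∞ ∧ ∀ t : ℝ, 0 < t →
      P {ω | ENNReal.ofReal t ≤ ‖U ω‖ₑ} ≤ c * ENNReal.ofReal t⁻¹ := by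
  -- Expectations cannot be compared, as U is not known to be integrable; tails are. This choice of
  -- a gives both a > 1 and ra < 1.
  set a := 2 / (1 + r) with ha
  have ha1 : 1 < a := by rw [ha, lt_div_iff₀ (by linarith)]; linarith
  have hra : r * a < 1 := by rw [ha, ← mul_div_assoc, div_lt_one (by linarith)]; linarith
  have ha0 : 0 < a := by linarith
  set f : ℝ → ℝ≥0∞ := fun t => P {ω | ENNReal.ofReal t ≤ ‖U ω‖ₑ} with hf
  set κ := b * ENNReal.ofReal (1 - r * a)⁻¹ with hκ
  -- If ‖U‖ < at and N < (1 - ra)t, then ‖U'‖ < t. As U' has the tails of U, this is a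
  -- self-improving bound, to be iterated along t, at, a²t, ….
  have step : ∀ t, 0 < t → f t ≤ f (a * t) + κ * ENNReal.ofReal t⁻¹ := by
    intro t ht
    have h1 : f t ≤ P ({ω | ENNReal.ofReal (a * t) ≤ ‖U ω‖ₑ} ∪
        {ω | ENNReal.ofReal ((1 - r * a) * t) ≤ N ω}) := by
      rw [hf]
      simp only
      rw [← hid t]
      refine measure_mono_ae ?_
      filter_upwards [hle] with ω hω h2
      by_contra h3
      have h4 : ¬ (ENNReal.ofReal (a * t) ≤ ‖U ω‖ₑ ∨ ENNReal.ofReal ((1 - r * a) * t) ≤ N ω) := h3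
      push Not at h4
      have h5 : ENNReal.ofReal t ≤ ‖U' ω‖ₑ := h2
      refine absurd (h5.trans hω) (not_le.2 ?_)
      calc _ ≤ ENNReal.ofReal r * ENNReal.ofReal (a * t) + N ω := by gcongr; exact h4.1.le
        _ < ENNReal.ofReal r * ENNReal.ofReal (a * t) + ENNReal.ofReal ((1 - r * a) * t) := by
            refine ENNReal.add_lt_add_left ?_ h4.2
            exact ENNReal.mul_ne_top ENNReal.ofReal_ne_top ENNReal.ofReal_ne_top
        _ = ENNReal.ofReal t := by
            have h6 : 0 ≤ (1 - r * a) * t := mul_nonneg (by linarith) ht.le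
            rw [← ENNReal.ofReal_mul hr0, ← ENNReal.ofReal_add (by positivity) h6]
            congr 1
            ring
    refine h1.trans ((measure_union_le _ _).trans (add_le_add le_rfl
      ((hN _ (mul_pos (by linarith) ht)).trans (le_of_eq ?_))))
    rw [hκ, mul_assoc, ← ENNReal.ofReal_mul (by have : 0 < 1 - r * a := by linarith
                                                positivity), mul_inv]
  have iter : ∀ (n : ℕ) (t : ℝ), 0 < t → f t ≤ f (a ^ n * t) +
      κ * ENNReal.ofReal ((∑ j ∈ Finset.range n, a⁻¹ ^ j) * t⁻¹) := by
    intro n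
    induction n with
    | zero => intro t _; simp
    | succ n ih =>
      intro t ht
      refine (ih t ht).trans ((add_le_add (step _ (by positivity)) le_rfl).trans (le_of_eq ?_))
      rw [← mul_assoc, ← pow_succ', add_assoc, ← mul_add, ← ENNReal.ofReal_add (by positivity)
        (by positivity), Finset.sum_range_succ, mul_inv, inv_pow]
      congr 3
      ring
  refine ⟨κ * ENNReal.ofReal (1 - a⁻¹)⁻¹, ENNReal.mul_ne_top (ENNReal.mul_ne_top hb
    ENNReal.ofReal_ne_top) ENNReal.ofReal_ne_top, fun t ht => ?_⟩
  -- Only finiteness of U is used here.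
  have hlim : Tendsto (fun n : ℕ => f (a ^ n * t)) atTop (𝓝 0) := by
    have h1 : TendstoInMeasure P (fun (n : ℕ) ω => a⁻¹ ^ n * ‖U ω‖) atTop (fun _ => (0 : ℝ)) :=
      tendstoInMeasure_of_tendsto_ae (fun n => hU.norm.const_mul _)
        (Eventually.of_forall fun ω => by
          simpa using (tendsto_pow_atTop_nhds_zero_of_lt_one (inv_nonneg.2 ha0.le)
            (inv_lt_one_of_one_lt₀ ha1)).mul_const ‖U ω‖)
    refine (h1 (ENNReal.ofReal t) (ENNReal.ofReal_pos.2 ht)).congr fun n => ?_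
    congr 1
    ext ω
    have e1 : edist (a⁻¹ ^ n * ‖U ω‖) 0 = ENNReal.ofReal (a⁻¹ ^ n * ‖U ω‖) := by
      rw [edist_zero_right, ← ofReal_norm, Real.norm_of_nonneg (by positivity)]
    simp only [Set.mem_ofPred_eq, e1]
    rw [← ofReal_norm, ENNReal.ofReal_le_ofReal_iff (by positivity),
      ENNReal.ofReal_le_ofReal_iff (norm_nonneg _), inv_pow, inv_mul_eq_div,
      le_div_iff₀ (by positivity), mul_comm]
  refine ge_of_tendsto' (x := atTop) (f := fun n : ℕ => f (a ^ n * t) +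
    κ * ENNReal.ofReal (1 - a⁻¹)⁻¹ * ENNReal.ofReal t⁻¹) (by simpa using hlim.add_const _)
    fun n => (iter n t ht).trans (add_le_add le_rfl ?_)
  rw [mul_assoc κ, ← ENNReal.ofReal_mul (by
    have : a⁻¹ < 1 := inv_lt_one_of_one_lt₀ ha1
    exact inv_nonneg.2 (by linarith))]
  gcongr
  rw [← tsum_geometric_of_lt_one (inv_nonneg.2 ha0.le) (inv_lt_one_of_one_lt₀ ha1)]
  exact (summable_geometric_of_lt_one (inv_nonneg.2 ha0.le)
    (inv_lt_one_of_one_lt₀ ha1)).sum_le_tsum _ fun i _ => by positivity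

end BorelCantelli

end CointSSM

namespace CointSSM

/-! ### Sums of independent vectors -/

section Independence

variable {Ω : Type*} [MeasurableSpace Ω] {P : Measure Ω} [IsProbabilityMeasure P] {F : Type*}
  [NormedAddCommGroup F] [NormedSpace ℝ F] [SecondCountableTopology F] [MeasurableSpace F]
  [BorelSpace F] {X Y : Ω → F}

theorem lintegral_enorm_add_eq (hX : Measurable X) (hY : Measurable Y) (h : IndepFun X Y P) :
    ∫⁻ ω, ‖X ω + Y ω‖ₑ ∂P = ∫⁻ x, ∫⁻ y, ‖x + y‖ₑ ∂(P.map Y) ∂(P.map X) := by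
  have hm : Measurable fun z : F × F => ‖z.1 + z.2‖ₑ := by fun_prop
  have := Measure.isProbabilityMeasure_map (μ := P) hX.aemeasurable
  have := Measure.isProbabilityMeasure_map (μ := P) hY.aemeasurable
  rw [← lintegral_prod (fun z : F × F => ‖z.1 + z.2‖ₑ) hm.aemeasurable,
    ← (indepFun_iff_map_prod_eq_prod_map_map hX.aemeasurable hY.aemeasurable).1 h,
    lintegral_map hm (hX.prodMk hY)]

/-- By Fubini x + Y is integrable for some fixed x, and so is Y. -/
theorem IndepFun.integrable_right_of_add (hX : Measurable X) (hY : Measurable Y)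
    (h : IndepFun X Y P) (hi : Integrable (fun ω => X ω + Y ω) P) : Integrable Y P := by
  have := Measure.isProbabilityMeasure_map (μ := P) hX.aemeasurable
  have := Measure.isProbabilityMeasure_map (μ := P) hY.aemeasurable
  have h1 : ∫⁻ x, ∫⁻ y, ‖x + y‖ₑ ∂(P.map Y) ∂(P.map X) ≠ ∞ := by
    rw [← lintegral_enorm_add_eq hX hY h]
    exact hi.2.ne
  have hm : Measurable fun z : F × F => ‖z.1 + z.2‖ₑ := by fun_prop
  obtain ⟨x, hx⟩ := (ae_lt_top hm.lintegral_prod_right' h1).exists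
  have h2 : Integrable (fun y : F => x + y) (P.map Y) :=
    ⟨(measurable_const_add x).aestronglyMeasurable, hx⟩
  have h3 : Integrable (fun y : F => y) (P.map Y) := by
    have h4 := h2.sub (integrable_const x)
    simpa only [Pi.sub_def, add_sub_cancel_left] using h4
  exact (integrable_map_measure h3.1 hY.aemeasurable).1 h3

/-- For fixed x, x is the mean of x + Y; take norms inside and integrate over the law of X. -/
theorem lintegral_enorm_le_of_indepFun [CompleteSpace F] (hX : Measurable X) (hY : Measurable Y)
    (h : IndepFun X Y P) (hi : Integrable Y P) (h0 : ∫ ω, Y ω ∂P = 0) :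
    ∫⁻ ω, ‖X ω‖ₑ ∂P ≤ ∫⁻ ω, ‖X ω + Y ω‖ₑ ∂P := by
  have := Measure.isProbabilityMeasure_map (μ := P) hY.aemeasurable
  have h1 : Integrable (fun y : F => y) (P.map Y) :=
    (integrable_map_measure measurable_id.aestronglyMeasurable hY.aemeasurable).2 hi
  have h2 : ∫ y, y ∂(P.map Y) = 0 := by
    rw [integral_map hY.aemeasurable h1.1, h0]
  rw [lintegral_enorm_add_eq hX hY h, ← lintegral_map (f := fun x : F => ‖x‖ₑ)
    measurable_enorm hX]
  refine lintegral_mono fun x => ?_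
  have h3 : ∫ y, (x + y) ∂(P.map Y) = x := by
    rw [integral_add (integrable_const x) h1, h2, integral_const]
    simp
  calc ‖x‖ₑ = ‖∫ y, (x + y) ∂(P.map Y)‖ₑ := by rw [h3]
    _ ≤ _ := enorm_integral_le_lintegral_enorm _

end Independence

/-! ### First moments and paths of Lévy processes -/

section Levy

variable {Ω : Type*} [MeasurableSpace Ω] {P : Measure Ω} [IsProbabilityMeasure P] {m : ℕ}
  {L : ℝ → Ω → (Fin m → ℝ)}

/-- A martingale argument from integrability at time 1 alone. Integrability of L(s) and of the
increment is established first, because a vanishing Bochner integral says nothing without it. -/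
theorem IsTwoSidedLevy.lintegral_enorm_le (hL : IsTwoSidedLevy P L)
    (hmean : ∀ t, ∫ ω, L t ω ∂P = 0) (h1 : Integrable (L 1) P) {s : ℝ} (hs : 0 ≤ s) (hs1 : s ≤ 1) :
    ∫⁻ ω, ‖L s ω‖ₑ ∂P ≤ ∫⁻ ω, ‖L 1 ω‖ₑ ∂P := by
  have hind : IndepFun (L s) (L 1 - L s) P := hL.indep.indepFun_eval_sub hs hs1 hL.zero
  have hm := (hL.measurable 1).sub (hL.measurable s)
  have e : (fun ω => L s ω + (L 1 - L s) ω) = L 1 := by ext1 ω; simp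
  have i1 : Integrable (L 1 - L s) P :=
    IndepFun.integrable_right_of_add (hL.measurable s) hm hind (by rw [e]; exact h1)
  have i2 : Integrable (L s) P := by simpa using h1.sub i1
  have h0 : ∫ ω, (L 1 - L s) ω ∂P = 0 := by
    simp only [Pi.sub_apply]
    rw [integral_sub h1 i2, hmean, hmean, sub_zero]
  have := lintegral_enorm_le_of_indepFun (hL.measurable s) hm hind i1 h0
  simpa using this

/-- Cut the interval into n pieces of length at most 1 and use stationarity of increments on each.
-/
theorem IsTwoSidedLevy.lintegral_enorm_sub_le (hL : IsTwoSidedLevy P L)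
    (hmean : ∀ t, ∫ ω, L t ω ∂P = 0) (h1 : Integrable (L 1) P) (n : ℕ) :
    ∀ s t : ℝ, s ≤ t → t ≤ s + n →
      ∫⁻ ω, ‖L t ω - L s ω‖ₑ ∂P ≤ n * ∫⁻ ω, ‖L 1 ω‖ₑ ∂P := by
  induction n with
  | zero =>
    intro s t h2 h3
    have : s = t := le_antisymm h2 (by simpa using h3)
    simp [this]
  | succ n ih =>
    intro s t h2 h3
    push_cast at h3 ⊢
    have h4 : s ≤ min t (s + 1) := le_min h2 (by linarith)
    have h5 : min t (s + 1) ≤ t := min_le_left _ _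
    have h6 : t ≤ min t (s + 1) + n := by
      rcases le_total t (s + 1) with h | h
      · rw [min_eq_left h]; linarith [(Nat.cast_nonneg n : (0 : ℝ) ≤ n)]
      · rw [min_eq_right h]; linarith
    have h7 : ∫⁻ ω, ‖L (min t (s + 1)) ω - L s ω‖ₑ ∂P ≤ ∫⁻ ω, ‖L 1 ω‖ₑ ∂P := by
      have h8 := ((hL.stationary s _ h4).comp (measurable_enorm (ε := Fin m → ℝ))).lintegral_eq
      simp only [Function.comp_def] at h8
      rw [h8]
      exact hL.lintegral_enorm_le hmean h1 (by linarith)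
        (by linarith [min_le_right t (s + 1)])
    have hms : ∀ a b, Measurable fun ω => ‖L a ω - L b ω‖ₑ := fun a b =>
      ((hL.measurable a).sub (hL.measurable b)).enorm
    calc ∫⁻ ω, ‖L t ω - L s ω‖ₑ ∂P
        ≤ ∫⁻ ω, (‖L t ω - L (min t (s + 1)) ω‖ₑ + ‖L (min t (s + 1)) ω - L s ω‖ₑ) ∂P := by
          refine lintegral_mono fun ω => ?_
          rw [← sub_add_sub_cancel (L t ω) (L (min t (s + 1)) ω)]
          exact enorm_add_le _ _
      _ = ∫⁻ ω, ‖L t ω - L (min t (s + 1)) ω‖ₑ ∂P + ∫⁻ ω, ‖L (min t (s + 1)) ω - L s ω‖ₑ ∂P :=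
          lintegral_add_left (hms _ _) _
      _ ≤ n * ∫⁻ ω, ‖L 1 ω‖ₑ ∂P + ∫⁻ ω, ‖L 1 ω‖ₑ ∂P := add_le_add (ih _ _ h5 h6) h7
      _ = _ := by rw [add_mul, one_mul]

/-- Markov's inequality in the form used for tails. -/
theorem measure_ofReal_le_le {f : Ω → ℝ≥0∞} (hf : AEMeasurable f P) {t : ℝ} (ht : 0 < t) :
    P {ω | ENNReal.ofReal t ≤ f ω} ≤ (∫⁻ ω, f ω ∂P) * ENNReal.ofReal t⁻¹ := by
  rw [ENNReal.ofReal_inv_of_pos ht, ← div_eq_mul_inv]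
  exact meas_ge_le_lintegral_div hf (ENNReal.ofReal_pos.2 ht).ne' ENNReal.ofReal_ne_top

theorem IsTwoSidedLevy.ae_growth_bound (hL : IsTwoSidedLevy P L)
    (hmean : ∀ t, ∫ ω, L t ω ∂P = 0) (h1 : Integrable (L 1) P) {h : ℝ} (hh : 0 < h) :
    ∀ᵐ ω ∂P, ∃ R : ℝ, 0 ≤ R ∧ ∀ k : ℤ, ‖L (k * h) ω‖ ≤ R * (1 + |(k : ℝ)|) ^ 3 := by
  refine ae_exists_growth_bound (b := (⌈h⌉₊ : ℝ≥0∞) * ∫⁻ ω, ‖L 1 ω‖ₑ ∂P)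
    (ENNReal.mul_ne_top (ENNReal.natCast_ne_top _) h1.2.ne) fun k t ht => ?_
  refine (measure_ofReal_le_le (hL.measurable _).enorm.aemeasurable ht).trans ?_
  have h2 : ∫⁻ ω, ‖L (k * h) ω‖ₑ ∂P = ∫⁻ ω, ‖L (k * h) ω - L 0 ω‖ₑ ∂P := by
    refine lintegral_congr_ae ?_
    filter_upwards [hL.zero] with ω hω
    rw [hω, sub_zero]
  have hceil : h ≤ ⌈h⌉₊ := Nat.le_ceil h
  have h3 : ∫⁻ ω, ‖L (k * h) ω - L 0 ω‖ₑ ∂P ≤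
      ((k.natAbs * ⌈h⌉₊ : ℕ) : ℝ≥0∞) * ∫⁻ ω, ‖L 1 ω‖ₑ ∂P := by
    have habs : ((k.natAbs : ℕ) : ℝ) = |(k : ℝ)| := by
      rw [Nat.cast_natAbs]; push_cast; rfl
    rcases le_total 0 k with hk | hk
    · have hk' : (0 : ℝ) ≤ k := by exact_mod_cast hk
      refine hL.lintegral_enorm_sub_le hmean h1 _ _ _ (by positivity) ?_
      push_cast [habs]
      rw [abs_of_nonneg hk', zero_add]
      gcongr
    · have hk' : (k : ℝ) ≤ 0 := by exact_mod_cast hk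
      simp_rw [enorm_sub_rev (L (k * h) _)]
      refine hL.lintegral_enorm_sub_le hmean h1 _ _ _ (mul_nonpos_of_nonpos_of_nonneg hk' hh.le) ?_
      push_cast [habs]
      rw [abs_of_nonpos hk']
      nlinarith
  rw [h2]
  refine (mul_le_mul_left h3 _).trans ?_
  have h4 : ENNReal.ofReal ((1 + |(k : ℝ)|) / t) =
      ENNReal.ofReal (1 + |(k : ℝ)|) * ENNReal.ofReal t⁻¹ := by
    rw [div_eq_mul_inv, ENNReal.ofReal_mul (by positivity)]
  rw [h4, ← mul_assoc]
  refine mul_le_mul_left ?_ _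
  rw [mul_comm ((⌈h⌉₊ : ℝ≥0∞) * _), ← mul_assoc]
  refine mul_le_mul_left ?_ _
  push_cast
  refine mul_le_mul_left ?_ _
  rw [← ENNReal.ofReal_natCast, Nat.cast_natAbs]
  refine ENNReal.ofReal_le_ofReal ?_
  push_cast
  linarith

/-- The time integral of the norm of a Lévy process has finite mean. -/
theorem IsTwoSidedLevy.exists_lintegral_path (hL : IsTwoSidedLevy P L)
    (hmean : ∀ t, ∫ ω, L t ω ∂P = 0) (h1 : Integrable (L 1) P) (τ : ℝ) :
    ∃ G : Ω → ℝ≥0∞, Measurable G ∧ ∫⁻ ω, G ω ∂P ≠ ∞ ∧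
      ∀ᵐ ω ∂P, ∫⁻ s in Set.Ioc 0 τ, ‖L s ω - L 0 ω‖ₑ = G ω := by
  -- Joint measurability in time and ω is not assumed. Sampling at grid points just to the right of
  -- s is jointly measurable, and right-continuity recovers the path; the liminf is measurable even
  -- off the good paths.
  let r : ℕ → ℤ → ℝ := fun n k => ((k : ℝ) + 1) / ((n : ℝ) + 1)
  let q : ℕ → ℝ → ℝ := fun n s => r n ⌊s * (n + 1)⌋
  let G : ℕ → ℤ × Ω → ℝ≥0∞ := fun n z => ‖L (r n z.1) z.2 - L 0 z.2‖ₑ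
  have hG : ∀ n, Measurable (G n) := fun n => measurable_from_prod_countable_right fun k =>
    ((hL.measurable (r n k)).sub (hL.measurable 0)).enorm
  let g : ℕ → ℝ × Ω → ℝ≥0∞ := fun n z => G n (⌊z.1 * (n + 1)⌋, z.2)
  have hg : ∀ n, Measurable (g n) := fun n =>
    (hG n).comp ((Int.measurable_floor.comp (measurable_fst.mul_const _)).prodMk measurable_snd)
  let ℓ : ℝ × Ω → ℝ≥0∞ := fun z => liminf (fun n => g n z) atTop
  have hℓ : Measurable ℓ := Measurable.liminf hg
  have hq : ∀ s, Tendsto (fun n => q n s) atTop (𝓝[Set.Ici s] s) := by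
    intro s
    have hn : ∀ n : ℕ, (0 : ℝ) < (n : ℝ) + 1 := fun n => by positivity
    have lo : ∀ n, s ≤ q n s := fun n => by
      rw [le_div_iff₀ (hn n)]; exact (Int.lt_floor_add_one _).le
    have hi : ∀ n, q n s ≤ s + 1 / ((n : ℝ) + 1) := fun n => by
      rw [div_le_iff₀ (hn n), add_mul, one_div_mul_cancel (hn n).ne']
      gcongr
      exact Int.floor_le _
    refine tendsto_nhdsWithin_iff.2 ⟨?_, Eventually.of_forall lo⟩
    refine tendsto_of_tendsto_of_tendsto_of_le_of_le tendsto_const_nhds ?_ lo hi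
    simpa using (tendsto_const_nhds (x := s)).add (tendsto_one_div_add_atTop_nhds_zero_nat (𝕜 := ℝ))
  have hae : ∀ᵐ ω ∂P, ∀ s, ℓ (s, ω) = ‖L s ω - L 0 ω‖ₑ := by
    filter_upwards [hL.cadlag] with ω hω s
    have h2 : Tendsto (fun n => L (q n s) ω) atTop (𝓝 (L s ω)) := (hω s).1.tendsto.comp (hq s)
    exact (h2.sub_const (L 0 ω)).enorm.liminf_eq
  refine ⟨fun ω => ∫⁻ s in Set.Ioc 0 τ, ℓ (s, ω), hℓ.lintegral_prod_left', ?_, ?_⟩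
  · have h2 : ∫⁻ ω, (∫⁻ s in Set.Ioc 0 τ, ℓ (s, ω)) ∂P =
        ∫⁻ s in Set.Ioc 0 τ, (∫⁻ ω, ℓ (s, ω) ∂P) :=
      lintegral_lintegral_swap (f := fun (ω : Ω) (s : ℝ) => ℓ (s, ω))
        (hℓ.comp measurable_swap).aemeasurable
    rw [h2]
    refine ne_top_of_le_ne_top (b := ∫⁻ s in Set.Ioc 0 τ, (⌈τ⌉₊ : ℝ≥0∞) * ∫⁻ ω, ‖L 1 ω‖ₑ ∂P) ?_
      (setLIntegral_mono' measurableSet_Ioc fun s hs => ?_)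
    · rw [setLIntegral_const, Real.volume_Ioc]
      exact ENNReal.mul_ne_top (ENNReal.mul_ne_top (ENNReal.natCast_ne_top _) h1.2.ne)
        ENNReal.ofReal_ne_top
    · rw [lintegral_congr_ae (hae.mono fun ω hω => hω s)]
      exact hL.lintegral_enorm_sub_le hmean h1 _ _ _ hs.1.le
        (by rw [zero_add]; exact hs.2.trans (Nat.le_ceil τ))
  · filter_upwards [hae] with ω hω
    simp_rw [hω]

end Levy

end CointSSM

namespace CointSSM

open scoped Matrix.Norms.Operator

/-! ### Growth of the stationary solution -/

section StationarySolution

variable {Ω : Type*} [MeasurableSpace Ω] {P : Measure Ω} [IsProbabilityMeasure P] {p m : ℕ}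
  {A : Matrix (Fin p) (Fin p) ℝ} {B : Matrix (Fin p) (Fin m) ℝ} {L : ℝ → Ω → (Fin m → ℝ)}
  {X : ℝ → Ω → (Fin p → ℝ)}

theorem exists_norm_exp_smul_lt_one {A : Matrix (Fin p) (Fin p) ℝ}
    (hA : ∀ z ∈ spectrum ℂ (toComplex A), z.re < 0) :
    ∃ τ : ℝ, 0 < τ ∧ ‖NormedSpace.exp (τ • A)‖ < 1 := by
  obtain ⟨k, hk, h⟩ := exists_norm_pow_lt_one (norm_lt_one_of_mem_spectrum_exp one_pos hA)
  refine ⟨k, by exact_mod_cast hk, ?_⟩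
  rwa [← Matrix.exp_nsmul, one_smul, ← Nat.cast_smul_eq_nsmul ℝ] at h

theorem IsStationarySolution.identDistrib (hX : IsStationarySolution P A B L X) (t : ℝ) :
    IdentDistrib (X t) (X 0) P P := by
  have h1 := (hX.stationary t).comp (measurable_pi_apply (0 : ℝ))
  simpa [Function.comp_def] using h1

theorem IsStationarySolution.measure_le_eq (hX : IsStationarySolution P A B L X) (s t : ℝ) :
    P {ω | ENNReal.ofReal t ≤ ‖X s ω‖ₑ} = P {ω | ENNReal.ofReal t ≤ ‖X 0 ω‖ₑ} :=
  (hX.identDistrib s).measure_mem_eq (s := {x | ENNReal.ofReal t ≤ ‖x‖ₑ})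
    (measurableSet_le measurable_const measurable_enorm)

/-- Replaces the variation of constants formula: over [0, τ] the path follows e^{τA}X(0) up to an
error controlled by the path of L, with no stochastic integral. -/
theorem IsStationarySolution.ae_enorm_le (hX : IsStationarySolution P A B L X) {τ : ℝ}
    (hτ : 0 < τ) : ∃ b : ℝ, ∀ᵐ ω ∂P, ‖X τ ω‖ₑ ≤
      ENNReal.ofReal ‖NormedSpace.exp (τ • A)‖ * ‖X 0 ω‖ₑ +
        ENNReal.ofReal b * (‖L τ ω - L 0 ω‖ₑ + ∫⁻ s in Set.Ioc 0 τ, ‖L s ω - L 0 ω‖ₑ) := by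
  set T := LinearMap.toContinuousLinearMap (mulVecLin A) with hT
  set a := ‖T‖ * Real.exp (‖T‖ * τ) with ha
  have ha0 : 0 ≤ a := by positivity
  have hmul : ∀ {q r : ℕ} (M : Matrix (Fin q) (Fin r) ℝ) (v : Fin r → ℝ),
      ‖M *ᵥ v‖ₑ ≤ ENNReal.ofReal ‖M‖ * ‖v‖ₑ := by
    intro q r M v
    rw [← ofReal_norm, ← ofReal_norm, ← ENNReal.ofReal_mul (norm_nonneg M)]
    exact ENNReal.ofReal_le_ofReal (linfty_opNorm_mulVec M v)
  refine ⟨(1 + a) * ‖B‖, ?_⟩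
  filter_upwards [hX.equation] with ω hω
  have hint : ∀ s t, IntervalIntegrable (fun u => X u ω) volume s t := fun s t => by
    rcases le_total s t with h | h
    · exact (hω s t h).1
    · exact (hω t s h).1.symm
  have he : ∀ t : ℝ, HasDerivAt (fun t : ℝ => NormedSpace.exp (t • A) *ᵥ X 0 ω)
      (T (NormedSpace.exp (t • A) *ᵥ X 0 ω)) t := fun t => by
    have := hasDerivAt_mul_exp_mulVec (1 : Matrix (Fin p) (Fin p) ℝ) (A := A) (X 0 ω) t
    simp only [one_mulVec, Matrix.one_mul] at this
    exact this
  have h1 := enorm_sub_le_of_integral_equation T (ℓ := fun t => B *ᵥ (L t ω - L 0 ω)) hτ.le hint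
    (fun t ht => (hω 0 t ht).2) he (by simp [NormedSpace.exp_zero])
  rw [← ha] at h1
  set D := ∫⁻ s in Set.Ioc 0 τ, ‖L s ω - L 0 ω‖ₑ
  have h2 : ∫⁻ s in Set.Ioc 0 τ, ‖B *ᵥ (L s ω - L 0 ω)‖ₑ ≤ ENNReal.ofReal ‖B‖ * D := by
    rw [← lintegral_const_mul' _ _ ENNReal.ofReal_ne_top]
    exact lintegral_mono fun s => hmul B _
  have h3 : ‖X τ ω‖ₑ ≤ ‖X τ ω - NormedSpace.exp (τ • A) *ᵥ X 0 ω‖ₑ +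
      ‖NormedSpace.exp (τ • A) *ᵥ X 0 ω‖ₑ := by
    conv_lhs => rw [← sub_add_cancel (X τ ω) (NormedSpace.exp (τ • A) *ᵥ X 0 ω)]
    exact enorm_add_le _ _
  refine h3.trans ?_
  rw [add_comm]
  refine add_le_add (hmul _ _) (h1.trans ?_)
  rw [ENNReal.ofReal_mul (p := 1 + a) (by positivity), ENNReal.ofReal_add zero_le_one ha0, ENNReal.ofReal_one]
  set E := ENNReal.ofReal ‖B‖
  set c := ENNReal.ofReal a
  set l := ‖L τ ω - L 0 ω‖ₑ
  calc _ ≤ E * l + c * (E * D) := add_le_add (hmul _ _) (mul_le_mul_right h2 _)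
    -- The missing cross terms are added so that the bound factors as E (1 + c)(l + D).
    _ ≤ E * l + c * (E * D) + (E * D + c * (E * l)) := le_self_add
    _ = _ := by ring

/-- Choose τ with ‖e^{τA}‖ < 1 and compare X(τ) with X(0), which has the same law. The resulting
tail bound holds at all times by stationarity. -/
theorem IsStationarySolution.ae_growth_bound (hX : IsStationarySolution P A B L X)
    (hL : IsTwoSidedLevy P L) (hmean : ∀ t, ∫ ω, L t ω ∂P = 0) (h1 : Integrable (L 1) P)
    (hA : ∀ z ∈ spectrum ℂ (toComplex A), z.re < 0) (h : ℝ) :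
    ∀ᵐ ω ∂P, ∃ R : ℝ, 0 ≤ R ∧ ∀ k : ℤ, ‖X (k * h) ω‖ ≤ R * (1 + |(k : ℝ)|) ^ 3 := by
  obtain ⟨τ, hτ, hr⟩ := exists_norm_exp_smul_lt_one hA
  obtain ⟨b, hb⟩ := hX.ae_enorm_le hτ
  obtain ⟨G, hG, hGi, hGe⟩ := hL.exists_lintegral_path hmean h1 τ
  set N : Ω → ℝ≥0∞ := fun ω => ENNReal.ofReal b * (‖L τ ω - L 0 ω‖ₑ + G ω) with hN
  have hlm : Measurable fun ω => ‖L τ ω - L 0 ω‖ₑ := ((hL.measurable _).sub (hL.measurable _)).enorm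
  have hadd : Measurable fun ω => ‖L τ ω - L 0 ω‖ₑ + G ω := hlm.add hG
  have hNm : Measurable N := hadd.const_mul _
  have hNi : ∫⁻ ω, N ω ∂P ≠ ∞ := by
    rw [lintegral_const_mul _ hadd, lintegral_add_left hlm]
    refine ENNReal.mul_ne_top ENNReal.ofReal_ne_top (ENNReal.add_ne_top.2 ⟨?_, hGi⟩)
    exact ne_top_of_le_ne_top (ENNReal.mul_ne_top (ENNReal.natCast_ne_top _) h1.2.ne)
      (hL.lintegral_enorm_sub_le hmean h1 _ _ _ hτ.le (by rw [zero_add]; exact Nat.le_ceil τ))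
  obtain ⟨c, hc, hct⟩ := measure_le_of_contraction (U := X 0) (U' := X τ) (norm_nonneg _) hr hNi
    (hX.measurable 0).aestronglyMeasurable
    (fun t ht => measure_ofReal_le_le hNm.aemeasurable ht)
    (by filter_upwards [hb, hGe] with ω h2 h3; rwa [h3] at h2) (hX.measure_le_eq τ)
  refine ae_exists_growth_bound hc fun k t ht => ?_
  rw [hX.measure_le_eq]
  refine (hct t ht).trans (mul_le_mul_right (ENNReal.ofReal_le_ofReal ?_) _)
  rw [inv_eq_one_div]
  gcongr
  linarith [abs_nonneg (k : ℝ)]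

end StationarySolution

/-! ### Growth of the observations -/

namespace Model

variable {Ω : Type*} {s₁ s₂ c p d m : ℕ} {M : Model Ω s₁ s₂ c p d m} [MeasurableSpace Ω]
  {P : Measure Ω} [IsProbabilityMeasure P]

theorem AssumptionA.theta0_mem (hA : M.AssumptionA P) : M.theta0 ∈ M.Theta :=
  interior_subset hA.interior

theorem AssumptionA.measurable_Yobs (hA : M.AssumptionA P) (k : ℤ) : Measurable (M.Yobs k) := by
  have hm : ∀ {q r : ℕ} (D : Matrix (Fin q) (Fin r) ℝ), Measurable fun v : Fin r → ℝ => D *ᵥ v :=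
    fun D => (LinearMap.continuous_of_finiteDimensional (mulVecLin D)).measurable
  exact (((hm _).comp hA.start_measurable).add
    ((hm _).comp ((hA.levy _ hA.theta0_mem).measurable _))).add
    ((hm _).comp ((hA.stationary_solution _ hA.theta0_mem).measurable _))

/-- The observations grow at most polynomially, almost surely. -/
theorem AssumptionA.exists_growth_bound (hA : M.AssumptionA P) :
    ∃ R : Ω → ℝ, Measurable R ∧ (∀ ω, 0 ≤ R ω) ∧
      ∀ᵐ ω ∂P, ∀ k : ℤ, ‖M.Yobs k ω‖ ≤ R ω * (1 + |(k : ℝ)|) ^ 3 := by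
  have hϑ := hA.theta0_mem
  have hL := hA.levy _ hϑ
  have hi : Integrable (M.L M.theta0.2 1) P := (hA.memLp_two hϑ).integrable (by norm_num)
  have hY : ∀ᵐ ω ∂P, ∃ R : ℝ, 0 ≤ R ∧ ∀ k : ℤ, ‖M.Yobs k ω‖ ≤ R * (1 + |(k : ℝ)|) ^ 3 := by
    filter_upwards [hL.ae_growth_bound (hA.levy_mean _ hϑ) hi hA.h_pos,
      (hA.stationary_solution _ hϑ).ae_growth_bound hL (hA.levy_mean _ hϑ) hi (hA.stable _ hϑ) M.h]
      with ω ⟨R₁, hR₁, h₁⟩ ⟨R₂, hR₂, h₂⟩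
    set C₁ := M.C1 M.theta0.1
    set D₁ := C₁ * M.B1 M.theta0.2
    set C₂ := M.C2 M.theta0.2
    refine ⟨‖C₁ *ᵥ M.Z ω‖ + ‖D₁‖ * R₁ + ‖C₂‖ * R₂, by positivity, fun k => ?_⟩
    have h3 : 1 ≤ (1 + |(k : ℝ)|) ^ 3 := one_le_pow₀ (by linarith [abs_nonneg (k : ℝ)])
    have e1 := le_mul_of_one_le_right (norm_nonneg (C₁ *ᵥ M.Z ω)) h3
    have e2 := (linfty_opNorm_mulVec D₁ (M.L M.theta0.2 (k * M.h) ω)).trans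
      (mul_le_mul_of_nonneg_left (h₁ k) (norm_nonneg D₁))
    have e3 := (linfty_opNorm_mulVec C₂ (M.Xst M.theta0.2 (k * M.h) ω)).trans
      (mul_le_mul_of_nonneg_left (h₂ k) (norm_nonneg C₂))
    have e4 : ‖M.Yobs k ω‖ ≤ ‖C₁ *ᵥ M.Z ω‖ + ‖D₁ *ᵥ M.L M.theta0.2 (k * M.h) ω‖ +
        ‖C₂ *ᵥ M.Xst M.theta0.2 (k * M.h) ω‖ := norm_add₃_le
    linarith
  -- The smallest admissible R is a countable supremum, hence a measurable choice.
  let f : ℤ → Ω → ℝ := fun k ω => ‖M.Yobs k ω‖ / (1 + |(k : ℝ)|) ^ 3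
  have hf : ∀ k, Measurable (f k) := fun k => (hA.measurable_Yobs k).norm.div_const _
  refine ⟨fun ω => (⨆ k, ENNReal.ofReal (f k ω)).toReal,
    (Measurable.iSup fun k => (hf k).ennreal_ofReal).ennreal_toReal,
    fun ω => ENNReal.toReal_nonneg, ?_⟩
  filter_upwards [hY] with ω ⟨R, hR, h⟩ k
  have hfin : ⨆ k, ENNReal.ofReal (f k ω) ≠ ∞ :=
    ne_top_of_le_ne_top ENNReal.ofReal_ne_top (iSup_le fun k => ENNReal.ofReal_le_ofReal
      ((div_le_iff₀ (by positivity)).2 (h k)))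
  rw [← div_le_iff₀ (by positivity)]
  change f k ω ≤ _
  rw [← ENNReal.toReal_ofReal (r := f k ω) (by positivity)]
  exact ENNReal.toReal_mono hfin (le_iSup (fun k => ENNReal.ofReal (f k ω)) k)

end Model

end CointSSM

/-! ### The proposition -/

theorem proposition2p4 {Ω : Type*} [MeasurableSpace Ω] (P : Measure Ω) [IsProbabilityMeasure P]
    {s₁ s₂ c p d m : ℕ} (M : CointSSM.Model Ω s₁ s₂ c p d m) (hA : M.AssumptionA P)
    (X1 : CointSSM.Param s₁ s₂ → Ω → (Fin c ⊕ Fin p → ℝ)) (hB : M.AssumptionB P X1) :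
    -- the quantities in the claim are well defined
    (∀ ϑ ∈ M.Theta, ∃! W, CointSSM.IsRiccatiSolution (M.expAh ϑ) (M.C ϑ) (M.SigmaH P ϑ) W) ∧
    (∀ᵐ ω ∂P, ∀ ϑ ∈ M.Theta, ∀ k : ℕ, 1 ≤ k → Summable (M.predictionTerm P ϑ k ω)) ∧
    (∀ᵐ ω ∂P, ∀ n : ℕ, ∀ ϑ ∈ M.Theta,
      ContDiffAt ℝ 2 (M.lik P n ω) ϑ ∧ ContDiffAt ℝ 2 (M.approxLik P X1 n ω) ϑ) ∧
    -- the differences vanish at every rate `n ^ γ` with `γ < 1`, uniformly on `Θ`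
    ∀ γ : ℝ, γ < 1 →
      CointSSM.NegligibleAtRate P M.Theta γ
        (fun n ϑ ω => M.approxLik P X1 n ω ϑ - M.lik P n ω ϑ) ∧
      (∀ u, CointSSM.NegligibleAtRate P M.Theta γ
        (fun n ϑ ω => CointSSM.partialDeriv u (M.approxLik P X1 n ω) ϑ -
          CointSSM.partialDeriv u (M.lik P n ω) ϑ)) ∧
      (∀ u v, CointSSM.NegligibleAtRate P M.Theta γ
        (fun n ϑ ω =>
          CointSSM.partialDeriv u (CointSSM.partialDeriv v (M.approxLik P X1 n ω)) ϑ -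
          CointSSM.partialDeriv u (CointSSM.partialDeriv v (M.lik P n ω)) ϑ)) := by
  obtain ⟨R, hR, hR0, hY⟩ := hA.exists_growth_bound
  obtain ⟨T, hT, hX⟩ := CointSSM.exists_measurable_jet_bound hA.compact hB.measurable hB.smooth
  obtain ⟨c₁, hc₁⟩ := hA.exists_lik_bound
  have key : ∀ᵐ ω ∂P, ∀ ϑ ∈ M.Theta, (∀ k, Summable (M.predictionTerm P ϑ k ω)) ∧
      ∀ n, ContDiffAt ℝ 2 (M.lik P n ω) ϑ ∧ ContDiffAt ℝ 2 (M.approxLik P X1 n ω) ϑ ∧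
        CointSSM.jet 1 (fun z => M.approxLik P X1 n ω z - M.lik P n ω z) ϑ ≤
          1 / (n : ℝ) * (c₁ * (R ω + T ω) ^ 2) := by
    filter_upwards [hY, hX, hB.smooth] with ω h1 h2 h3 ϑ hϑ
    exact hc₁ ϑ hϑ X1 ω (R ω) (T ω) (hR0 ω) h1 (h3 ϑ hϑ) (h2 ϑ hϑ)
  have hBm : Measurable fun ω => c₁ * (R ω + T ω) ^ 2 := ((hR.add hT).pow_const 2).const_mul c₁
  refine ⟨fun ϑ hϑ => hA.existsUnique_riccati hϑ, key.mono fun ω h ϑ hϑ k _ => (h ϑ hϑ).1 k,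
    key.mono fun ω h n ϑ hϑ => ⟨((h ϑ hϑ).2 n).1, ((h ϑ hϑ).2 n).2.1⟩, fun γ hγ => ⟨?_, ?_, ?_⟩⟩
  · refine CointSSM.negligibleAtRate_of_le hγ hBm (key.mono fun ω h n ϑ hϑ => ?_)
    exact (CointSSM.norm_le_jet zero_le_one _ ϑ).trans ((h ϑ hϑ).2 n).2.2
  · intro u
    refine CointSSM.negligibleAtRate_of_le hγ hBm (key.mono fun ω h n ϑ hϑ => ?_)
    obtain ⟨h1, h2, h3⟩ := (h ϑ hϑ).2 n
    rw [← CointSSM.partialDeriv_sub (h2.differentiableAt (by norm_num))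
      (h1.differentiableAt (by norm_num))]
    exact (CointSSM.norm_partialDeriv_le_jet ((h2.sub h1).differentiableAt (by norm_num)) u).trans h3
  · intro u v
    -- The factor 2 undoes the weight 1/2 of the second derivative in the jet.
    refine CointSSM.negligibleAtRate_of_le hγ (hBm.const_mul 2) (key.mono fun ω h n ϑ hϑ => ?_)
    obtain ⟨h1, h2, h3⟩ := (h ϑ hϑ).2 n
    rw [← CointSSM.partialDeriv_partialDeriv_sub h2 h1]
    refine (CointSSM.norm_partialDeriv_partialDeriv_le_jet (h2.sub h1) u v).trans ?_
    rw [mul_left_comm]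
    exact mul_le_mul_of_nonneg_left h3 zero_le_two
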